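/- **Theorem (Spectral convergence).** Let $\Omega=[-\pi,\pi]^2$ with periodic boundary conditions, $(f,g)=\int_\Omega f\bar g\,d\mathbf x$, $\|f\|=(f,f)^{1/2}$, $\hat f(\mathbf k)=(2\pi)^{-2}\int_\Omega f(\mathbf x)e^{-i\mathbf k\cdot\mathbf x}d\mathbf x$ for $\mathbf k\in\mathbb Z^2$, and for $s\ge 0$ let $H^s_{\mathrm{per}}(\Omega)$ be the space of $f\in L^2(\Omega)$ with $\|f\|_s^2=\sum_{\mathbf k}(1+|\mathbf k|^2)^s|\hat f(\mathbf k)|^2<\infty$. Put $(-\Delta)^{\alpha/2}f=\sum_{\mathbf k}|\mathbf k|^\alpha\hat f(\mathbf k)e^{i\mathbf k\cdot\mathbf x}$. Let $\alpha\in[1,2]$, $r\ge\alpha+1$ and $T>0$, and let $u$ be a real-valued solution of the fractional Zakharov–Kuznetsov equation $$\partial_t u-\partial_{x_1}(-\Delta)^{\alpha/2}u+u\,\partial_{x_1}u=0\quad\text{in }\Omega\times(0,T],\qquad u(\cdot,0)=u_0,$$ with $u\in C^1([0,T];H^r_{\mathrm{per}}(\Omega))$. For an integer $N\ge1$ let $\mathbb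 X_N=\mathrm{span}\{e^{i\mathbf k\cdot\mathbf x}:\max(|k_1|,|k_2|)\le N\}$ and let $u_N:[0,T]\to\mathbb X_N$ be the solution of the Fourier spectral Galerkin scheme $$(\partial_t u_N,v)+((-\Delta)^{\alpha/2}u_N,\partial_{x_1}v)-\tfrac12(u_N^2,\partial_{x_1}v)=0,\qquad (u_N(0),v)=(u_0,v)\qquad\text{for all }v\in\mathbb X_N .$$ 1. If $\|u(t)\|_r\le M$ and $\|\partial_t u(t)\|_r\le M$ for all $t\in[0,T]$, then there is a constant $C>0$ depending only on $\alpha,r,T$ and $M$ (in particular not on $N$) such that $$\|u(t)-u_N(t)\|\le C N^{-r}\qquad\text{for all }0\le t<T\text{ and all }N\ge1 .$$ 2. If in addition $u_0$ is real-analytic (as a periodic function), then there are constants $C,\sigma>0$, independent of $N$ and $t$, such that $$\|u(t)-u_N(t)\|\le C e^{-\sigma N}\qquad\text{for all }0\le t<T\text{ and all }N\ge1 .$$ -/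

import Mathlib

noncomputable section

namespace FZK

open MeasureTheory Complex

/-- The period cell `Ω = [-π, π]²`. -/
def cell : Set (ℝ × ℝ) := Set.Icc (-Real.pi) Real.pi ×ˢ Set.Icc (-Real.pi) Real.pi

/-- Lebesgue measure on the period cell. -/
def cellMeasure : Measure (ℝ × ℝ) := volume.restrict cell

instance : IsFiniteMeasure cellMeasure := by
  refine ⟨?_⟩
  rw [cellMeasure, Measure.restrict_apply_univ]
  exact (isCompact_Icc.prod isCompact_Icc).measure_lt_top

/-- `L²_per(Ω)`, with `‖f‖² = ∫_Ω |f|²`. -/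
abbrev L2per : Type := Lp ℂ 2 cellMeasure

/-- The pairing `(f, g) = ∫_Ω f ḡ`. -/
def pairing (f g : ℝ × ℝ → ℂ) : ℂ := ∫ x, f x * (starRingEnd ℂ) (g x) ∂cellMeasure

/-- The character `x ↦ exp (i k·x)`. -/
def expFun (k : ℤ × ℤ) (x : ℝ × ℝ) : ℂ :=
  Complex.exp (I * (((k.1 : ℝ) * x.1 + (k.2 : ℝ) * x.2 : ℝ) : ℂ))

theorem memLp_expFun (k : ℤ × ℤ) : MemLp (expFun k) 2 cellMeasure := by
  refine MemLp.of_bound (C := 1) ?_ (Filter.Eventually.of_forall fun x => ?_)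
  · apply Continuous.aestronglyMeasurable
    unfold expFun
    fun_prop
  · rw [expFun, mul_comm, Complex.norm_exp_ofReal_mul_I]

/-- The character `exp (i k·x)` as an element of `L²_per(Ω)`. -/
def expL2 (k : ℤ × ℤ) : L2per := (memLp_expFun k).toLp (expFun k)

/-- The Fourier coefficient `(2π)⁻² ∫_Ω f(x) exp (-i k·x) dx`. -/
def coeff (f : ℝ × ℝ → ℂ) (k : ℤ × ℤ) : ℂ :=
  (((2 * Real.pi) ^ 2)⁻¹ : ℝ) * ∫ x, f x * expFun (-k) x ∂cellMeasure

/-- `|k|² = k₁² + k₂²`. -/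
def normSq (k : ℤ × ℤ) : ℝ := (k.1 : ℝ) ^ 2 + (k.2 : ℝ) ^ 2

/-- `(-Δ)^{α/2} f = ∑ |k|^α f̂(k) exp (i k·x)`, the sum being taken in `L²_per(Ω)`
(it converges there exactly when `f ∈ H^α_per`). -/
def fracLap (α : ℝ) (f : L2per) : L2per :=
  ∑' k : ℤ × ℤ, (((Real.sqrt (normSq k) ^ α : ℝ) : ℂ) * coeff f k) • expL2 k

/-- `∂_{x₁} f = ∑ i k₁ f̂(k) exp (i k·x)`, the sum being taken in `L²_per(Ω)`; this is the
(weak, periodic) derivative in `x₁` of `f ∈ H^1_per`. -/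
def partialX1 (f : L2per) : L2per :=
  ∑' k : ℤ × ℤ, (I * (k.1 : ℂ) * coeff f k) • expL2 k

/-- Membership in the periodic Sobolev space: `∑ (1 + |k|²)^s |f̂(k)|² < ∞`. -/
def MemHper (s : ℝ) (f : L2per) : Prop :=
  Summable fun k : ℤ × ℤ => (1 + normSq k) ^ s * ‖coeff f k‖ ^ 2

/-- `u ∈ C¹([0,T]; H^r_per)`. The map `f ↦ ((1 + |k|²)^{r/2} f̂(k))_k` is an isometric isomorphism
from `H^r_per` with the norm `‖·‖_r` onto `ℓ²(ℤ²)`; `U` is the curve `u` read through it. In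
particular `‖u(t)‖_r = ‖U t‖` and `‖∂ₜu(t)‖_r = ‖derivWithin U [0,T] t‖`. -/
def IsC1Hper (r T : ℝ) (u : ℝ → L2per) (U : ℝ → lp (fun _ : ℤ × ℤ => ℂ) 2) : Prop :=
  ContDiffOn ℝ 1 U (Set.Icc 0 T) ∧
    ∀ t ∈ Set.Icc 0 T, ∀ k : ℤ × ℤ,
      U t k = (((1 + normSq k) ^ (r / 2) : ℝ) : ℂ) * coeff (u t) k

/-- `u` is a real-valued (strong) solution on `[0,T]` of
`∂ₜu - ∂_{x₁}(-Δ)^{α/2}u + u ∂_{x₁}u = 0` with `u(0) = u₀`. -/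
structure IsSolution (α T : ℝ) (u₀ : L2per) (u : ℝ → L2per) : Prop where
  real_valued : ∀ t ∈ Set.Icc 0 T, ∀ᵐ x ∂cellMeasure, (u t x).im = 0
  regular : ∀ t ∈ Set.Icc 0 T, MemHper (1 + α) (u t)
  initial : u 0 = u₀
  equation : ∀ t ∈ Set.Ioc 0 T, ∃ ut : L2per,
    HasDerivWithinAt u ut (Set.Icc 0 T) t ∧
      ∀ᵐ x ∂cellMeasure,
        ut x - partialX1 (fracLap α (u t)) x + u t x * partialX1 (u t) x = 0

/-- The trigonometric polynomials `span {exp (i k·x) : max (|k₁|, |k₂|) ≤ N}`. -/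
def trigSpace (N : ℕ) : Submodule ℂ L2per :=
  Submodule.span ℂ (expL2 '' {k : ℤ × ℤ | max |k.1| |k.2| ≤ (N : ℤ)})

/-- `uN` is a solution on `[0,T]` of the Fourier spectral Galerkin scheme with datum `u₀`. -/
structure IsGalerkin (α T : ℝ) (N : ℕ) (u₀ : L2per) (uN : ℝ → L2per) : Prop where
  mem : ∀ t ∈ Set.Icc 0 T, uN t ∈ trigSpace N
  initial : ∀ v ∈ trigSpace N, pairing (uN 0) v = pairing u₀ v
  scheme : ∀ t ∈ Set.Icc 0 T, ∃ ut : L2per,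
    HasDerivWithinAt uN ut (Set.Icc 0 T) t ∧
      ∀ v ∈ trigSpace N,
        pairing ut v + pairing (fracLap α (uN t)) (partialX1 v)
          - (1 / 2) * pairing (fun x => (uN t x) ^ 2) (partialX1 v) = 0

/-- `f` is (represented by) a real-analytic function on the torus, that is, by a real-analytic
function on the plane with period `2π` in each variable. -/
def IsRealAnalytic (f : L2per) : Prop :=
  ∃ g : ℝ × ℝ → ℝ, AnalyticOnNhd ℝ g Set.univ ∧
    (∀ x y : ℝ, g (x + 2 * Real.pi, y) = g (x, y) ∧ g (x, y + 2 * Real.pi) = g (x, y)) ∧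
    ∀ᵐ x ∂cellMeasure, f x = (g x : ℂ)

end FZK

end

/-! Everything is read off Fourier coefficients. With `c` the coefficients of `u` and `b` those of
`u_N`, both satisfy the same system `x_k' = rhs α x k`, for `b` only on the box of frequencies of
degree at most `N`, outside which `b` vanishes. By Parseval it suffices to bound `θ = P_N c - b` in
`ℓ²` together with the projection error `η = c - P_N c`.

Energy estimate (`error_rate`). The dispersive symbol is purely imaginary and drops out of `d/dt
‖θ‖²`. With `w = P_N c` the quadratic difference is `η*c + η*w + 2 θ*w - θ*θ`. The cubic term
vanishes because `θ` is Hermitian, and `(∂₁(θ w), θ)` is integrated by parts at the cost of the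
Wiener norm of `∂₁w` only. The terms with `η` cost `‖η‖ + ‖∂₁η‖`, so Grönwall bounds `θ` by the size
of `η` and `∂₁η`.

No power of `N` is lost on `∂₁η`, thanks to dispersive smoothing (`smoothing_le`). Where `k₁ ≠ 0`,
dividing the equation by `k₁` bounds `|k|^α |c_k|` by `|∂ₜc_k| + |(c*c)_k|/2`. Since `∂ₜu` lies in
`H^r`, since `H^r` is an algebra for `r ≥ 2`, and since `α ≥ 1`, also `∂₁u` lies in `H^r`. Its tail
is then `O(N^{-r})`, like that of `u`.

Exponential rate. The same energy estimate applies once `c t` decays exponentially, uniformly in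
`t`. Analytic data have exponentially decaying coefficients by Cauchy estimates and repeated
integration by parts. To propagate this decay, Galerkin solutions are constructed and estimated in
the norm with weight `|k|^4 e^{σ(t)|k|}`, where `|k|` stands for `absWeight` (`gevrey_rate`,
`gevrey_bound`). The commutator of the weight with the product costs half a derivative on each of
two factors, with a coefficient proportional to `σ`, and the shrinking radius `σ' = -βσ` pays for
it. The remaining growth is governed by a weighted Wiener norm of `b`, bounded uniformly in `N`: for
`c` by smoothing and by conservation of the modes `k₁ = 0`, for `c - b` by the algebraic rate and an
inverse inequality. Letting `N → ∞` transfers the decay to `c` (`CoeffSolution.exp_decay`). -/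

noncomputable section

namespace FZK

open MeasureTheory Complex Set

/-! ### Completeness of the characters, transported from the unit torus -/

section Torus

-- The multivariate Fourier basis is orthonormal for normalised Haar measure, so this is the volume
-- to use on the circle.
local instance : MeasureSpace UnitAddCircle := ⟨AddCircle.haarAddCircle⟩

/-- The section of the projection of the plane onto the torus, with values in the period cell. -/
def torusSection (t : UnitAddTorus (Fin 2)) : ℝ × ℝ :=
  (2 * Real.pi) • (MeasurableEquiv.finTwoArrow (α := ℝ)
    (UnitAddTorus.measurableEquivPiIoc (fun _ => -(1 / 2 : ℝ)) t).1)

theorem expFun_torusSection (k : ℤ × ℤ) (t : UnitAddTorus (Fin 2)) :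
    expFun k (torusSection t) = UnitAddTorus.mFourier ![k.1, k.2] t := by
  have h : t = (UnitAddTorus.measurableEquivPiIoc (fun _ => -(1 / 2 : ℝ))).symm
      (UnitAddTorus.measurableEquivPiIoc (fun _ => -(1 / 2 : ℝ)) t) := by simp
  generalize hy : UnitAddTorus.measurableEquivPiIoc (fun _ => -(1 / 2 : ℝ)) t = y at h
  rw [torusSection, hy, h]
  simp only [expFun, UnitAddTorus.mFourier, UnitAddTorus.coe_symm_measurableEquivPiIoc_apply,
    ContinuousMap.coe_mk, Fin.prod_univ_two, fourier_coe_apply]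
  rw [← Complex.exp_add]
  congr 1
  simp [MeasurableEquiv.finTwoArrow]
  ring

/-- The factor `(2π)⁻²` is the Jacobian of the dilation by `2π` and also the normalisation in
`coeff`, so coefficients on the cell become coefficients on the torus. -/
theorem measurePreserving_torusSection :
    MeasurePreserving torusSection volume
      (ENNReal.ofReal ((2 * Real.pi) ^ 2)⁻¹ • cellMeasure) := by
  have h1 := UnitAddTorus.measurePreserving_equivPiIoc (d := Fin 2) (fun _ => -(1 / 2 : ℝ))
  have hS : MeasurableSet {x : Fin 2 → ℝ | ∀ i, x i ∈ Ioc (-(1/2 : ℝ)) (-(1/2) + 1)} :=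
    MeasurableSet.univ_pi' fun _ => measurableSet_Ioc
  have h2 : MeasurePreserving (Subtype.val : {x : Fin 2 → ℝ | ∀ i, x i ∈ Ioc (-(1/2 : ℝ)) (-(1/2) + 1)} → _)
    (Measure.comap Subtype.val volume) (volume.restrict {x : Fin 2 → ℝ | ∀ i, x i ∈ Ioc (-(1/2 : ℝ)) (-(1/2) + 1)}) :=
    ⟨measurable_subtype_coe, map_comap_subtype_coe hS _⟩
  have h3 : MeasurePreserving (MeasurableEquiv.finTwoArrow (α := ℝ))
      (volume.restrict {x : Fin 2 → ℝ | ∀ i, x i ∈ Ioc (-(1/2 : ℝ)) (-(1/2) + 1)})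
      (volume.restrict (Ioc (-(1/2 : ℝ)) (-(1/2) + 1) ×ˢ Ioc (-(1/2 : ℝ)) (-(1/2) + 1))) := by
    have := (volume_preserving_finTwoArrow ℝ).restrict_preimage
      (s := Ioc (-(1/2 : ℝ)) (-(1/2) + 1) ×ˢ Ioc (-(1/2 : ℝ)) (-(1/2) + 1))
      (measurableSet_Ioc.prod measurableSet_Ioc)
    convert this using 2
    ext x
    simp [MeasurableEquiv.finTwoArrow, Fin.forall_fin_two]
  have hpi : (0 : ℝ) < 2 * Real.pi := by positivity
  have h4 : MeasurePreserving (fun x : ℝ × ℝ => (2 * Real.pi) • x)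
      volume (ENNReal.ofReal ((2 * Real.pi) ^ 2)⁻¹ • volume) := by
    refine ⟨by fun_prop, ?_⟩
    rw [Measure.map_addHaar_smul _ hpi.ne']
    simp [abs_of_pos hpi]
  have h5 := h4.restrict_preimage (s := Ioc (-Real.pi) Real.pi ×ˢ Ioc (-Real.pi) Real.pi)
    (measurableSet_Ioc.prod measurableSet_Ioc)
  have e1 : (fun x : ℝ × ℝ => (2 * Real.pi) • x) ⁻¹' (Ioc (-Real.pi) Real.pi ×ˢ Ioc (-Real.pi) Real.pi)
      = Ioc (-(1/2 : ℝ)) (-(1/2) + 1) ×ˢ Ioc (-(1/2 : ℝ)) (-(1/2) + 1) := by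
    have hp := Real.pi_pos
    have aux : ∀ x : ℝ, (-Real.pi < 2 * Real.pi * x ∧ 2 * Real.pi * x ≤ Real.pi) ↔
        (-(1/2) < x ∧ x ≤ -(1/2) + 1) := by
      intro x
      constructor
      · rintro ⟨h, h'⟩; constructor <;> nlinarith
      · rintro ⟨h, h'⟩; constructor <;> nlinarith
    ext x
    simp only [mem_preimage, mem_prod, mem_Ioc, Prod.smul_fst, Prod.smul_snd, smul_eq_mul, aux]
  rw [e1] at h5
  have e2 : (ENNReal.ofReal ((2 * Real.pi) ^ 2)⁻¹ • (volume : Measure (ℝ × ℝ))).restrict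
      (Ioc (-Real.pi) Real.pi ×ˢ Ioc (-Real.pi) Real.pi)
      = ENNReal.ofReal ((2 * Real.pi) ^ 2)⁻¹ • cellMeasure := by
    rw [Measure.restrict_smul, cellMeasure, cell]
    congr 1
    rw [Measure.volume_eq_prod, ← Measure.prod_restrict, ← Measure.prod_restrict]
    -- The section takes values in the half-open cell; the closed cell differs from it by a null
    -- set.
    rw [Measure.restrict_congr_set Ioc_ae_eq_Icc]
  rw [e2] at h5
  exact h5.comp (h3.comp (h2.comp h1))


theorem integral_comp_torusSection {g : ℝ × ℝ → ℂ} (hg : AEStronglyMeasurable g cellMeasure) :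
    ∫ t, g (torusSection t) = (((2 * Real.pi) ^ 2)⁻¹ : ℝ) * ∫ x, g x ∂cellMeasure := by
  have hmp := measurePreserving_torusSection
  rw [← integral_map hmp.measurable.aemeasurable, hmp.map_eq, integral_smul_measure]
  · rw [ENNReal.toReal_ofReal (by positivity), Complex.real_smul]
  · rw [hmp.map_eq]
    exact hg.mono_ac (Measure.smul_absolutelyContinuous)

theorem continuous_expFun (k : ℤ × ℤ) : Continuous (expFun k) := by
  unfold expFun; fun_prop

/-- The pullback to the torus has zero coordinates in `mFourierBasis`, hence vanishes; a
measure-preserving pullback keeps the `L²` norm, so `f` vanishes too. -/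
theorem eq_zero_of_coeff_eq_zero (f : L2per) (hf : ∀ k, coeff f k = 0) : f = 0 := by
  have hmp := measurePreserving_torusSection
  have hc : ENNReal.ofReal ((2 * Real.pi) ^ 2)⁻¹ ≠ 0 := by
    have := Real.pi_pos
    simp only [ne_eq, ENNReal.ofReal_eq_zero, not_le]; positivity
  have hm : MemLp (f : ℝ × ℝ → ℂ) 2 (ENNReal.ofReal ((2 * Real.pi) ^ 2)⁻¹ • cellMeasure) :=
    (Lp.memLp f).smul_measure ENNReal.ofReal_ne_top
  have hm' := hm.comp_measurePreserving hmp
  have h0 : hm'.toLp _ = 0 := by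
    apply (UnitAddTorus.mFourierBasis (d := Fin 2)).repr.injective
    ext n
    rw [UnitAddTorus.mFourierBasis_repr]
    simp only [map_zero, lp.coeFn_zero, Pi.zero_apply]
    rw [UnitAddTorus.mFourierCoeff]
    have e : ∫ t, UnitAddTorus.mFourier (-n) t • (hm'.toLp _ : UnitAddTorus (Fin 2) → ℂ) t
        = ∫ t, (fun x => f x * expFun (-(n 0, n 1)) x) (torusSection t) := by
      apply integral_congr_ae
      filter_upwards [hm'.coeFn_toLp] with t ht
      rw [ht, expFun_torusSection]
      simp only [Function.comp, smul_eq_mul, mul_comm]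
      congr 3
      ext i; fin_cases i <;> simp
    rw [e]
    exact (integral_comp_torusSection ((Lp.aestronglyMeasurable f).mul
      (continuous_expFun _).aestronglyMeasurable)).trans (hf (n 0, n 1))
  have h1 : (f : ℝ × ℝ → ℂ) ∘ torusSection =ᵐ[volume] 0 := by
    refine hm'.coeFn_toLp.symm.trans ?_
    rw [h0]
    exact Lp.coeFn_zero _ _ _
  have h2 : ∀ᵐ x ∂(ENNReal.ofReal ((2 * Real.pi) ^ 2)⁻¹ • cellMeasure), f x = 0 := by
    have h3 := eLpNorm_comp_measurePreserving (p := 2) hm.1 hmp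
    rw [eLpNorm_congr_ae h1, eLpNorm_zero] at h3
    exact (eLpNorm_eq_zero_iff hm.1 (by norm_num)).1 h3.symm
  replace h2 : ∀ᵐ x ∂cellMeasure, f x = 0 := by
    rw [ae_iff, Measure.smul_apply, smul_eq_mul, mul_eq_zero] at h2
    exact ae_iff.2 (h2.resolve_left hc)
  rw [Lp.eq_zero_iff_ae_eq_zero]
  exact h2

theorem conj_expFun (k : ℤ × ℤ) (x : ℝ × ℝ) : (starRingEnd ℂ) (expFun k x) = expFun (-k) x := by
  simp only [expFun, ← Complex.exp_conj, map_mul, Complex.conj_I, Complex.conj_ofReal]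
  congr 1
  simp; ring

theorem expFun_add (j k : ℤ × ℤ) (x : ℝ × ℝ) : expFun (j + k) x = expFun j x * expFun k x := by
  simp only [expFun, ← Complex.exp_add]
  congr 1
  simp; ring

theorem coeFn_expL2 (k : ℤ × ℤ) : (expL2 k : ℝ × ℝ → ℂ) =ᵐ[cellMeasure] expFun k :=
  (memLp_expFun k).coeFn_toLp

theorem coeff_congr {f g : ℝ × ℝ → ℂ} (h : f =ᵐ[cellMeasure] g) (k : ℤ × ℤ) :
    coeff f k = coeff g k := by
  unfold coeff
  congr 1
  apply integral_congr_ae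
  filter_upwards [h] with x hx
  rw [hx]

theorem coeff_expFun (j k : ℤ × ℤ) : coeff (expFun j) k = if j = k then 1 else 0 := by
  unfold coeff
  refine (integral_comp_torusSection
    ((continuous_expFun j).mul (continuous_expFun (-k))).aestronglyMeasurable).symm.trans ?_
  have h := (orthonormal_iff_ite.mp (UnitAddTorus.orthonormal_mFourier (d := Fin 2)))
    ![k.1, k.2] ![j.1, j.2]
  rw [ContinuousMap.inner_toLp] at h
  have e : (![k.1, k.2] = ![j.1, j.2]) ↔ j = k := by
    constructor
    · intro h
      have h0 := congrFun h 0
      have h1 := congrFun h 1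
      simp at h0 h1
      exact Prod.ext h0.symm h1.symm
    · rintro rfl; rfl
  rw [if_congr e rfl rfl] at h
  rw [← h]
  congr 1
  ext t
  rw [Pi.mul_apply, expFun_torusSection, ← conj_expFun, expFun_torusSection]

end Torus

/-! ### Parseval and the convolution theorem -/

theorem two_pi_sq_ne_zero : ((((2 * Real.pi) ^ 2 : ℝ)) : ℂ) ≠ 0 := by
  have := Real.pi_pos
  exact_mod_cast (by positivity : ((2 * Real.pi) ^ 2 : ℝ) ≠ 0)

theorem coeff_eq_inner (f : L2per) (k : ℤ × ℤ) :
    coeff f k = (((2 * Real.pi) ^ 2)⁻¹ : ℝ) * inner ℂ (expL2 k) f := by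
  unfold coeff
  rw [L2.inner_def]
  congr 1
  apply integral_congr_ae
  filter_upwards [coeFn_expL2 k] with x hx
  simp [hx, conj_expFun]

/-- The Fourier coefficient as a continuous linear functional. -/
def coeffCLM (k : ℤ × ℤ) : L2per →L[ℂ] ℂ :=
  ((((2 * Real.pi) ^ 2)⁻¹ : ℝ) : ℂ) • innerSL ℂ (expL2 k)

theorem coeffCLM_apply (k : ℤ × ℤ) (f : L2per) : coeffCLM k f = coeff f k := by
  rw [coeff_eq_inner]; simp [coeffCLM]

theorem coeff_expL2 (j k : ℤ × ℤ) : coeff (expL2 j) k = if j = k then 1 else 0 := by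
  rw [coeff_congr (coeFn_expL2 j), coeff_expFun]

theorem inner_expL2 (j k : ℤ × ℤ) :
    inner ℂ (expL2 k) (expL2 j) = if j = k then (((2 * Real.pi) ^ 2 : ℝ) : ℂ) else 0 := by
  have h := coeff_eq_inner (expL2 j) k
  rw [coeff_expL2] at h
  have h2 := two_pi_sq_ne_zero
  push_cast at h h2 ⊢
  split_ifs at h ⊢
  · field_simp at h; rw [← h]; ring
  · have := h.symm
    simpa [Real.pi_ne_zero] using this

theorem orthonormal_expL2 :
    Orthonormal ℂ (fun k : ℤ × ℤ => (((2 * Real.pi)⁻¹ : ℝ) : ℂ) • expL2 k) := by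
  rw [orthonormal_iff_ite]
  intro i j
  have := Real.pi_ne_zero
  rw [inner_smul_left, inner_smul_right, inner_expL2]
  by_cases h : i = j
  · simp only [h, Complex.conj_ofReal, if_true]
    push_cast
    field_simp
  · simp [h, Ne.symm h]

/-- The normalised characters form a Hilbert basis of `L²_per(Ω)`. -/
def expBasis : HilbertBasis (ℤ × ℤ) ℂ L2per :=
  HilbertBasis.mkOfOrthogonalEqBot orthonormal_expL2 (by
    rw [eq_bot_iff]
    intro f hf
    rw [Submodule.mem_bot]
    apply eq_zero_of_coeff_eq_zero
    intro k
    rw [coeff_eq_inner]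
    have h := (Submodule.mem_orthogonal _ _).1 hf _ (Submodule.subset_span ⟨k, rfl⟩)
    rw [inner_smul_left] at h
    have hz : inner ℂ (expL2 k) f = 0 := by simpa [Real.pi_ne_zero] using h
    rw [hz, mul_zero])

theorem expBasis_apply (k : ℤ × ℤ) : expBasis k = (((2 * Real.pi)⁻¹ : ℝ) : ℂ) • expL2 k := by
  simp [expBasis]

theorem inner_expBasis (f : L2per) (k : ℤ × ℤ) :
    inner ℂ (expBasis k) f = ((2 * Real.pi : ℝ) : ℂ) * coeff f k := by
  rw [expBasis_apply, inner_smul_left, coeff_eq_inner]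
  have := Real.pi_ne_zero
  simp only [Complex.conj_ofReal]
  push_cast
  field_simp

theorem hasSum_conj_coeff_mul_coeff (f g : L2per) :
    HasSum (fun k => (starRingEnd ℂ) (coeff f k) * coeff g k)
      ((((2 * Real.pi) ^ 2)⁻¹ : ℝ) * inner ℂ f g) := by
  have h := (expBasis.hasSum_inner_mul_inner f g).mul_left ((((2 * Real.pi) ^ 2)⁻¹ : ℝ) : ℂ)
  refine h.congr_fun fun k => ?_
  rw [← inner_conj_symm f (expBasis k), inner_expBasis, inner_expBasis]
  have := Real.pi_ne_zero
  simp only [map_mul, Complex.conj_ofReal]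
  push_cast
  field_simp

theorem hasSum_norm_coeff_sq (f : L2per) :
    HasSum (fun k => ‖coeff f k‖ ^ 2) (((2 * Real.pi) ^ 2)⁻¹ * ‖f‖ ^ 2) := by
  have h := Complex.hasSum_re (hasSum_conj_coeff_mul_coeff f f)
  convert h using 1
  · ext k
    rw [Complex.conj_mul']
    norm_cast
  · rw [inner_self_eq_norm_sq_to_K, Complex.re_ofReal_mul]
    norm_cast

/-- This is Parseval for `f` against `conj g · e_k`, whose coefficient at `a` is the conjugate of
that of `g` at `k - a`. It needs only `f, g ∈ L²`. -/
theorem coeff_mul (f g : L2per) (k : ℤ × ℤ) :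
    HasSum (fun a => coeff f a * coeff g (k - a)) (coeff (fun x => f x * g x) k) := by
  have hm : MemLp (fun x => (starRingEnd ℂ) (g x) * expFun k x) 2 cellMeasure := by
    refine MemLp.of_le (Lp.memLp g) ?_ (Filter.Eventually.of_forall fun x => ?_)
    · exact ((Complex.continuous_conj.comp_aestronglyMeasurable (Lp.aestronglyMeasurable g))).mul
        (continuous_expFun _).aestronglyMeasurable
    · rw [norm_mul, expFun, mul_comm I, Complex.norm_exp_ofReal_mul_I]; simp
  have h := hasSum_conj_coeff_mul_coeff (hm.toLp _) f
  convert h using 1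
  · ext a
    rw [mul_comm]
    congr 1
    rw [coeff_congr hm.coeFn_toLp]
    unfold coeff
    rw [map_mul, Complex.conj_ofReal, ← integral_conj]
    congr 1
    congr 1
    ext x
    simp only [map_mul, Complex.conj_conj, conj_expFun, neg_neg]
    rw [mul_assoc, ← expFun_add]
    congr 2
    abel
  · unfold coeff
    rw [L2.inner_def]
    congr 1
    apply integral_congr_ae
    filter_upwards [hm.coeFn_toLp] with x hx
    simp only [hx, RCLike.inner_apply, map_mul, Complex.conj_conj, conj_expFun]
    ring

/-- The coefficients of a square-summable Fourier series. -/
theorem coeff_tsum_smul_expL2 {d : ℤ × ℤ → ℂ} (hd : Summable fun k => ‖d k‖ ^ 2) (k : ℤ × ℤ) :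
    coeff (∑' j, d j • expL2 j : L2per) k = d k := by
  have hs : Summable fun j => d j • expL2 j := by
    let v : lp (fun _ : ℤ × ℤ => ℂ) 2 := ⟨fun j => ((2 * Real.pi : ℝ) : ℂ) * d j, by
      refine memℓp_gen ?_
      have := hd.mul_left ((2 * Real.pi) ^ 2)
      refine this.congr fun j => ?_
      simp [mul_pow, abs_of_pos Real.pi_pos]⟩
    refine (expBasis.hasSum_repr_symm v).summable.congr fun j => ?_
    rw [expBasis_apply, smul_smul]
    congr 1
    have := Real.pi_ne_zero
    change _ * d j * _ = _
    push_cast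
    field_simp
  rw [← coeffCLM_apply, ContinuousLinearMap.map_tsum _ hs]
  simp only [map_smul, coeffCLM_apply, coeff_expL2, smul_eq_mul, mul_ite, mul_one, mul_zero]
  exact tsum_ite_eq k d

/-! ### Young inequalities for sequences on a group -/

section Sequences

variable {G : Type*} [AddCommGroup G]

/-- The shear `(k, a) ↦ (a, k - a)`. -/
def shearEquiv (G : Type*) [AddCommGroup G] : G × G ≃ G × G where
  toFun p := (p.2, p.1 - p.2)
  invFun p := (p.1 + p.2, p.1)
  left_inv p := by simp
  right_inv p := by simp

theorem tsum_mul_le_of_sq {ι : Type*} {f g : ι → ℝ} {A B : ℝ} (hf0 : ∀ i, 0 ≤ f i)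
    (hg0 : ∀ i, 0 ≤ g i) (hA : 0 ≤ A) (hB : 0 ≤ B) (hf : Summable fun i => f i ^ 2)
    (hg : Summable fun i => g i ^ 2) (hfA : ∑' i, f i ^ 2 ≤ A ^ 2) (hgB : ∑' i, g i ^ 2 ≤ B ^ 2) :
    Summable (fun i => f i * g i) ∧ ∑' i, f i * g i ≤ A * B := by
  have h := Real.summable_and_inner_le_Lp_mul_Lq_tsum_of_nonneg (p := 2) (q := 2)
    (Real.HolderConjugate.two_two) hf0 hg0 (by simpa using hf) (by simpa using hg)
  refine ⟨h.1, h.2.trans ?_⟩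
  have h2 : ∀ x : ℝ, x ^ (1 / 2 : ℝ) = Real.sqrt x := fun x => (Real.sqrt_eq_rpow x).symm
  simp only [Real.rpow_two, h2]
  gcongr
  · exact Real.sqrt_le_iff.2 ⟨hA, hfA⟩
  · exact Real.sqrt_le_iff.2 ⟨hB, hgB⟩

/-- Young's inequality in trilinear form. -/
theorem young_trilinear {f g h : G → ℝ} {A B L : ℝ} (hf0 : ∀ i, 0 ≤ f i) (hg0 : ∀ i, 0 ≤ g i)
    (hh0 : ∀ i, 0 ≤ h i) (hA : 0 ≤ A) (hB : 0 ≤ B) (hf : Summable fun i => f i ^ 2)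
    (hh : Summable fun i => h i ^ 2) (hg : Summable g) (hfA : ∑' i, f i ^ 2 ≤ A ^ 2)
    (hhB : ∑' i, h i ^ 2 ≤ B ^ 2) (hgL : ∑' i, g i ≤ L) :
    Summable (fun p : G × G => f p.1 * g p.2 * h (p.1 + p.2)) ∧
      ∑' p : G × G, f p.1 * g p.2 * h (p.1 + p.2) ≤ A * L * B := by
  -- For fixed `b`, Cauchy–Schwarz in `a`; the bound is uniform in `b` and is then summed against
  -- `g`.
  have key : ∀ b, Summable (fun a => f a * h (a + b)) ∧ ∑' a, f a * h (a + b) ≤ A * B := by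
    intro b
    refine tsum_mul_le_of_sq hf0 (fun a => hh0 _) hA hB hf ?_ hfA ?_
    · exact ((Equiv.addRight b).summable_iff (f := fun i => h i ^ 2)).2 hh
    · exact ((Equiv.addRight b).tsum_eq (fun i => h i ^ 2)).trans_le hhB
  have hs : ∀ b, ∑' a, f a * g b * h (a + b) = g b * ∑' a, f a * h (a + b) := by
    intro b; rw [← tsum_mul_left]; congr 1; ext a; ring
  have hsum : Summable fun b => ∑' a, f a * g b * h (a + b) := by
    simp only [hs]
    refine Summable.of_nonneg_of_le (fun b => mul_nonneg (hg0 b) (tsum_nonneg fun a =>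
      mul_nonneg (hf0 _) (hh0 _))) (fun b => ?_) (hg.mul_right (A * B))
    exact mul_le_mul_of_nonneg_left (key b).2 (hg0 b)
  have hS : Summable (fun p : G × G => f p.2 * g p.1 * h (p.2 + p.1)) := by
    rw [summable_prod_of_nonneg (fun p => mul_nonneg (mul_nonneg (hf0 _) (hg0 _)) (hh0 _))]
    refine ⟨fun b => ?_, hsum⟩
    exact ((key b).1.mul_left (g b)).congr fun a => by ring
  constructor
  · exact ((Equiv.prodComm G G).summable_iff
      (f := fun p : G × G => f p.1 * g p.2 * h (p.1 + p.2))).1 hS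
  · rw [← (Equiv.prodComm G G).tsum_eq (fun p : G × G => f p.1 * g p.2 * h (p.1 + p.2))]
    simp only [Equiv.prodComm_apply, Prod.fst_swap, Prod.snd_swap]
    rw [hS.tsum_prod]
    simp only [hs]
    calc ∑' b, g b * ∑' a, f a * h (a + b) ≤ ∑' b, g b * (A * B) := by
          refine Summable.tsum_le_tsum (fun b => mul_le_mul_of_nonneg_left (key b).2 (hg0 b)) ?_
            (hg.mul_right _)
          simpa only [hs] using hsum
      _ = (∑' b, g b) * (A * B) := tsum_mul_right
      _ ≤ L * (A * B) := by gcongr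
      _ = A * L * B := by ring

/-- Young's inequality `ℓ¹ * ℓ² ⊆ ℓ²`. -/
theorem young_conv_sq {f g : G → ℝ} {A L : ℝ} (hf0 : ∀ i, 0 ≤ f i) (hg0 : ∀ i, 0 ≤ g i)
    (hf : Summable fun i => f i ^ 2) (hg : Summable g) (hfA : ∑' i, f i ^ 2 ≤ A ^ 2)
    (hgL : ∑' i, g i ≤ L) :
    (∀ k, Summable fun a => g a * f (k - a)) ∧
      (Summable fun k => (∑' a, g a * f (k - a)) ^ 2) ∧
      ∑' k, (∑' a, g a * f (k - a)) ^ 2 ≤ (L * A) ^ 2 := by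
  have hP : Summable fun p : G × G => g p.1 * f p.2 ^ 2 :=
    Summable.mul_of_nonneg hg hf hg0 (fun _ => sq_nonneg _)
  have hQ : Summable fun p : G × G => g p.2 * f (p.1 - p.2) ^ 2 :=
    ((shearEquiv G).summable_iff (f := fun p : G × G => g p.1 * f p.2 ^ 2)).2 hP
  have hL : 0 ≤ L := (tsum_nonneg hg0).trans hgL
  have key : ∀ k, Summable (fun a => g a * f (k - a)) ∧
      (∑' a, g a * f (k - a)) ^ 2 ≤ L * ∑' a, g a * f (k - a) ^ 2 := by
    intro k
    have hk : Summable fun a => g a * f (k - a) ^ 2 := hQ.prod_factor k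
    -- Cauchy–Schwarz for the measure with density `g`: one factor `√g` stays alone, the other goes
    -- with `f`.
    have h := tsum_mul_le_of_sq (f := fun a => Real.sqrt (g a))
      (g := fun a => Real.sqrt (g a) * f (k - a)) (A := Real.sqrt L)
      (B := Real.sqrt (∑' a, g a * f (k - a) ^ 2)) (fun _ => Real.sqrt_nonneg _)
      (fun _ => mul_nonneg (Real.sqrt_nonneg _) (hf0 _)) (Real.sqrt_nonneg _) (Real.sqrt_nonneg _)
      (by simpa only [Real.sq_sqrt (hg0 _)] using hg)
      (by simpa only [mul_pow, Real.sq_sqrt (hg0 _)] using hk)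
      (by simpa only [Real.sq_sqrt (hg0 _), Real.sq_sqrt hL] using hgL)
      (by
        rw [Real.sq_sqrt (tsum_nonneg fun a => mul_nonneg (hg0 _) (sq_nonneg _))]
        simp only [mul_pow, Real.sq_sqrt (hg0 _)]; exact le_rfl)
    have e : ∀ a, Real.sqrt (g a) * (Real.sqrt (g a) * f (k - a)) = g a * f (k - a) := by
      intro a; rw [← mul_assoc, Real.mul_self_sqrt (hg0 a)]
    simp only [e] at h
    refine ⟨h.1, ?_⟩
    have h0 : 0 ≤ ∑' a, g a * f (k - a) := tsum_nonneg fun a => mul_nonneg (hg0 _) (hf0 _)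
    calc (∑' a, g a * f (k - a)) ^ 2
        ≤ (Real.sqrt L * Real.sqrt (∑' a, g a * f (k - a) ^ 2)) ^ 2 := by gcongr; exact h.2
      _ = L * ∑' a, g a * f (k - a) ^ 2 := by
          rw [mul_pow, Real.sq_sqrt hL,
            Real.sq_sqrt (tsum_nonneg fun a => mul_nonneg (hg0 _) (sq_nonneg _))]
  have hS : Summable fun k => L * ∑' a, g a * f (k - a) ^ 2 := (hQ.prod).mul_left L
  have hS' := Summable.of_nonneg_of_le (fun k => sq_nonneg _) (fun k => (key k).2) hS
  refine ⟨fun k => (key k).1, hS', ?_⟩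
  calc ∑' k, (∑' a, g a * f (k - a)) ^ 2 ≤ ∑' k, L * ∑' a, g a * f (k - a) ^ 2 :=
        Summable.tsum_le_tsum (fun k => (key k).2) hS' hS
    _ = L * ∑' p : G × G, g p.2 * f (p.1 - p.2) ^ 2 := by rw [tsum_mul_left, hQ.tsum_prod]
    _ = L * ∑' p : G × G, g p.1 * f p.2 ^ 2 := by
        rw [← (shearEquiv G).tsum_eq (fun p : G × G => g p.1 * f p.2 ^ 2)]; rfl
    _ = L * ((∑' a, g a) * ∑' b, f b ^ 2) := by
        rw [hP.tsum_prod]; simp only [tsum_mul_left, tsum_mul_right]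
    _ ≤ L * (L * A ^ 2) := by
        gcongr
    _ = (L * A) ^ 2 := by ring

/-- Young's inequality `ℓ¹ * ℓ¹ ⊆ ℓ¹`. -/
theorem young_conv_one {f g : G → ℝ} (hf0 : ∀ i, 0 ≤ f i) (hg0 : ∀ i, 0 ≤ g i)
    (hf : Summable f) (hg : Summable g) :
    (Summable fun k => ∑' a, g a * f (k - a)) ∧
      ∑' k, ∑' a, g a * f (k - a) = (∑' a, g a) * ∑' a, f a := by
  have hP : Summable fun p : G × G => g p.1 * f p.2 := Summable.mul_of_nonneg hg hf hg0 hf0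
  have hQ : Summable fun p : G × G => g p.2 * f (p.1 - p.2) :=
    ((shearEquiv G).summable_iff (f := fun p : G × G => g p.1 * f p.2)).2 hP
  refine ⟨hQ.prod, ?_⟩
  calc ∑' k, ∑' a, g a * f (k - a) = ∑' p : G × G, g p.2 * f (p.1 - p.2) := hQ.tsum_prod.symm
    _ = ∑' p : G × G, g p.1 * f p.2 := (shearEquiv G).tsum_eq (fun p : G × G => g p.1 * f p.2)
    _ = (∑' a, g a) * ∑' a, f a := by
        rw [hP.tsum_prod]; simp only [tsum_mul_left, tsum_mul_right]

/-- Fubini along `k = a + b`: it turns a convolution tested against a sequence into a sum over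
pairs, where symmetries can be used. -/
theorem tsum_tsum_sub_eq {Φ : G → G → G → ℂ}
    (h : Summable fun p : G × G => Φ p.1 p.2 (p.1 + p.2)) :
    ∑' k, ∑' a, Φ a (k - a) k = ∑' p : G × G, Φ p.1 p.2 (p.1 + p.2) := by
  have hQ : Summable fun p : G × G => Φ p.2 (p.1 - p.2) p.1 := by
    have := ((shearEquiv G).summable_iff (f := fun p : G × G => Φ p.1 p.2 (p.1 + p.2))).2 h
    refine this.congr fun p => ?_
    simp [shearEquiv]
  rw [← (shearEquiv G).tsum_eq (fun p : G × G => Φ p.1 p.2 (p.1 + p.2))]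
  simp only [shearEquiv, Equiv.coe_fn_mk, add_sub_cancel]
  exact hQ.tsum_prod.symm

end Sequences

/-! ### Trilinear forms and their cancellations -/

/-- Convolution of sequences indexed by `ℤ²`. -/
def conv (f g : ℤ × ℤ → ℂ) (k : ℤ × ℤ) : ℂ := ∑' a, f a * g (k - a)

theorem conv_comm (f g : ℤ × ℤ → ℂ) (k : ℤ × ℤ) : conv f g k = conv g f k := by
  unfold conv
  rw [← (Equiv.subLeft k).tsum_eq (fun a => f a * g (k - a))]
  simp [mul_comm]

/-- Sequences of Fourier coefficients of real functions. -/
def Hermitian (f : ℤ × ℤ → ℂ) : Prop := ∀ k, f (-k) = (starRingEnd ℂ) (f k)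

theorem summable_pair_of_finite {f g : ℤ × ℤ → ℂ} (hf : f.support.Finite) (hg : g.support.Finite)
    (Φ : (ℤ × ℤ) × (ℤ × ℤ) → ℂ) :
    Summable fun p : (ℤ × ℤ) × (ℤ × ℤ) => Φ p * f p.1 * g p.2 := by
  apply summable_of_hasFiniteSupport
  refine (hf.prod hg).subset fun p hp => ?_
  simp only [Function.mem_support, ne_eq, mul_eq_zero, not_or] at hp
  exact ⟨hp.1.2, hp.2⟩

/-- Integration by parts for the trilinear form `∫ g f ∂₁f`. -/
theorem two_re_tsum_fst_mul {f g : ℤ × ℤ → ℂ} (hf : f.support.Finite) (hg : g.support.Finite)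
    (hgh : Hermitian g) :
    2 * (∑' p : (ℤ × ℤ) × (ℤ × ℤ),
        I * p.1.1 * (starRingEnd ℂ) (f (p.1 + p.2)) * f p.1 * g p.2).re =
      -(∑' p : (ℤ × ℤ) × (ℤ × ℤ),
        I * p.2.1 * (starRingEnd ℂ) (f (p.1 + p.2)) * f p.1 * g p.2).re := by
  -- The involution `(a, b) ↦ (a + b, -b)` exchanges the two copies of `f`. Combined with
  -- conjugation and `g (-b) = conj (g b)` it moves the derivative from one copy to the other, which
  -- is the integration by parts.
  let e : (ℤ × ℤ) × (ℤ × ℤ) ≃ (ℤ × ℤ) × (ℤ × ℤ) :=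
    { toFun := fun p => (p.1 + p.2, -p.2)
      invFun := fun p => (p.1 + p.2, -p.2)
      left_inv := fun p => by simp
      right_inv := fun p => by simp }
  have h1 := summable_pair_of_finite hf hg
    (fun p => I * p.1.1 * (starRingEnd ℂ) (f (p.1 + p.2)))
  have h2 := summable_pair_of_finite hf hg
    (fun p => I * p.2.1 * (starRingEnd ℂ) (f (p.1 + p.2)))
  have h3 : (starRingEnd ℂ) (∑' p : (ℤ × ℤ) × (ℤ × ℤ),
      I * p.1.1 * (starRingEnd ℂ) (f (p.1 + p.2)) * f p.1 * g p.2) =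
      -((∑' p : (ℤ × ℤ) × (ℤ × ℤ),
        I * p.1.1 * (starRingEnd ℂ) (f (p.1 + p.2)) * f p.1 * g p.2) +
        ∑' p : (ℤ × ℤ) × (ℤ × ℤ),
        I * p.2.1 * (starRingEnd ℂ) (f (p.1 + p.2)) * f p.1 * g p.2) := by
    rw [← h1.tsum_add h2, ← tsum_neg, Complex.conj_tsum, ← e.tsum_eq]
    congr 1
    ext p
    have hg2 := hgh p.2
    simp only [e, Equiv.coe_fn_mk, map_mul, Complex.conj_I, Complex.conj_conj, map_intCast,
      add_neg_cancel_right, hg2, Prod.fst_add]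
    push_cast
    ring
  have h4 := congrArg Complex.re h3
  simp only [Complex.conj_re, Complex.neg_re, Complex.add_re] at h4
  linarith

theorem tsum_prod_swap (Φ : (ℤ × ℤ) × (ℤ × ℤ) → ℂ) :
    ∑' p : (ℤ × ℤ) × (ℤ × ℤ), Φ p.swap = ∑' p, Φ p :=
  (Equiv.prodComm (ℤ × ℤ) (ℤ × ℤ)).tsum_eq Φ

/-- For `g = f` the swap of the two arguments identifies both sums in `two_re_tsum_fst_mul`, so the
real part `x` satisfies `2x = -x`. This is `∫ f² ∂₁f = 0`. -/
theorem re_tsum_cubic_eq_zero {f : ℤ × ℤ → ℂ} (hf : f.support.Finite) (hfh : Hermitian f) :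
    (∑' p : (ℤ × ℤ) × (ℤ × ℤ),
        I * p.1.1 * (starRingEnd ℂ) (f (p.1 + p.2)) * f p.1 * f p.2).re = 0 := by
  have h := two_re_tsum_fst_mul hf hf hfh
  have h2 : (∑' p : (ℤ × ℤ) × (ℤ × ℤ),
        I * p.2.1 * (starRingEnd ℂ) (f (p.1 + p.2)) * f p.1 * f p.2) =
      ∑' p : (ℤ × ℤ) × (ℤ × ℤ),
        I * p.1.1 * (starRingEnd ℂ) (f (p.1 + p.2)) * f p.1 * f p.2 := by
    rw [← tsum_prod_swap]
    congr 1
    ext p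
    simp only [Prod.fst_swap, Prod.snd_swap, add_comm p.2 p.1]
    ring
  rw [h2] at h
  linarith

/-- `∫ g f ∂₁f` is controlled by the Wiener norm of `∂₁g` and the `ℓ²` norm of `f`. -/
theorem norm_tsum_snd_mul_le {f g : ℤ × ℤ → ℂ} (hf : f.support.Finite) (hg : g.support.Finite)
    {L : ℝ} (hL : ∑' k, |(k.1 : ℝ)| * ‖g k‖ ≤ L) :
    ‖∑' p : (ℤ × ℤ) × (ℤ × ℤ), I * p.2.1 * (starRingEnd ℂ) (f (p.1 + p.2)) * f p.1 * g p.2‖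
      ≤ L * ∑' k, ‖f k‖ ^ 2 := by
  have hfs : Summable fun k => ‖f k‖ ^ 2 :=
    summable_of_hasFiniteSupport (hf.subset fun k hk => by
      simp only [Function.mem_support, ne_eq] at hk ⊢; intro h; simp [h] at hk)
  have hgs : Summable fun k : ℤ × ℤ => |(k.1 : ℝ)| * ‖g k‖ :=
    summable_of_hasFiniteSupport (hg.subset fun k hk => by
      simp only [Function.mem_support, ne_eq] at hk ⊢; intro h; simp [h] at hk)
  have h0 : 0 ≤ ∑' k, ‖f k‖ ^ 2 := tsum_nonneg fun _ => sq_nonneg _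
  have hy := young_trilinear (f := fun k => ‖f k‖) (h := fun k => ‖f k‖)
    (g := fun k : ℤ × ℤ => |(k.1 : ℝ)| * ‖g k‖) (A := Real.sqrt (∑' k, ‖f k‖ ^ 2))
    (B := Real.sqrt (∑' k, ‖f k‖ ^ 2)) (L := L)
    (fun _ => norm_nonneg _) (fun _ => by positivity) (fun _ => norm_nonneg _)
    (Real.sqrt_nonneg _) (Real.sqrt_nonneg _) hfs hfs hgs
    (by rw [Real.sq_sqrt h0]) (by rw [Real.sq_sqrt h0]) hL
  have e : ∀ p : (ℤ × ℤ) × (ℤ × ℤ),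
      ‖I * p.2.1 * (starRingEnd ℂ) (f (p.1 + p.2)) * f p.1 * g p.2‖ =
        ‖f p.1‖ * (|(p.2.1 : ℝ)| * ‖g p.2‖) * ‖f (p.1 + p.2)‖ := by
    intro p
    simp only [norm_mul, Complex.norm_I, RCLike.norm_conj, Complex.norm_intCast]
    ring
  calc _ ≤ ∑' p : (ℤ × ℤ) × (ℤ × ℤ),
        ‖I * p.2.1 * (starRingEnd ℂ) (f (p.1 + p.2)) * f p.1 * g p.2‖ :=
        norm_tsum_le_tsum_norm (by simp only [e]; exact hy.1)
    _ ≤ _ := by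
        simp only [e]
        refine hy.2.trans (le_of_eq ?_)
        have := Real.mul_self_sqrt h0
        linear_combination L * this

/-! ### Truncation and the energy inequality for the error -/

/-- The frequencies of the trigonometric polynomials of degree at most `N`. -/
def box (N : ℕ) : Finset (ℤ × ℤ) := Finset.Icc (-(N : ℤ)) N ×ˢ Finset.Icc (-(N : ℤ)) N

theorem mem_box {N : ℕ} {k : ℤ × ℤ} : k ∈ box N ↔ max |k.1| |k.2| ≤ (N : ℤ) := by
  simp [box, abs_le]

theorem neg_mem_box {N : ℕ} {k : ℤ × ℤ} : -k ∈ box N ↔ k ∈ box N := by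
  simp [mem_box]

/-- The projection onto the trigonometric polynomials of degree at most `N`. -/
def trunc (N : ℕ) (c : ℤ × ℤ → ℂ) (k : ℤ × ℤ) : ℂ := if k ∈ box N then c k else 0

theorem norm_trunc_le (N : ℕ) (c : ℤ × ℤ → ℂ) (k : ℤ × ℤ) : ‖trunc N c k‖ ≤ ‖c k‖ := by
  unfold trunc; split_ifs <;> simp

theorem trunc_of_notMem {N : ℕ} (c : ℤ × ℤ → ℂ) {k : ℤ × ℤ} (hk : k ∉ box N) :
    trunc N c k = 0 := if_neg hk

theorem Hermitian.trunc {c : ℤ × ℤ → ℂ} (hc : Hermitian c) (N : ℕ) : Hermitian (trunc N c) := by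
  intro k
  simp only [FZK.trunc, neg_mem_box, hc k]
  split_ifs <;> simp

theorem Hermitian.sub {c d : ℤ × ℤ → ℂ} (hc : Hermitian c) (hd : Hermitian d) :
    Hermitian fun k => c k - d k := by
  intro k; simp [hc k, hd k]

theorem support_finite_of_box {N : ℕ} {f : ℤ × ℤ → ℂ} (hf : ∀ k ∉ box N, f k = 0) :
    f.support.Finite :=
  (box N).finite_toSet.subset fun k hk => by
    by_contra h; exact hk (hf k (by simpa using h))

/-- The right-hand side of the equation in Fourier coefficients. -/
def rhs (α : ℝ) (c : ℤ × ℤ → ℂ) (k : ℤ × ℤ) : ℂ :=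
  I * k.1 * ((Real.sqrt (normSq k) ^ α : ℝ) : ℂ) * c k - I * k.1 / 2 * conv c c k

/-- The trilinear form `(∂₁(g h), f)`. -/
def triForm (f g h : ℤ × ℤ → ℂ) : ℂ :=
  ∑' k : ℤ × ℤ, (starRingEnd ℂ) (f k) * (I * k.1 * conv g h k)

theorem triForm_eq {f g h : ℤ × ℤ → ℂ}
    (hs : Summable fun p : (ℤ × ℤ) × (ℤ × ℤ) =>
      I * (p.1 + p.2).1 * (starRingEnd ℂ) (f (p.1 + p.2)) * g p.1 * h p.2) :
    triForm f g h = ∑' p : (ℤ × ℤ) × (ℤ × ℤ),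
      I * (p.1 + p.2).1 * (starRingEnd ℂ) (f (p.1 + p.2)) * g p.1 * h p.2 := by
  rw [← tsum_tsum_sub_eq (Φ := fun a b k => I * k.1 * (starRingEnd ℂ) (f k) * g a * h b) hs]
  unfold triForm conv
  congr 1
  ext k
  rw [← tsum_mul_left, ← tsum_mul_left]
  congr 1
  ext a
  ring

/-- A product with a factor in the Wiener algebra, tested against an `ℓ²` sequence. -/
theorem norm_triForm_le {f g h : ℤ × ℤ → ℂ} {A ε L0 L1 : ℝ} (hA : 0 ≤ A) (hε : 0 ≤ ε)
    (hf : Summable fun k => ‖f k‖ ^ 2) (hfA : ∑' k, ‖f k‖ ^ 2 ≤ A ^ 2)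
    (hg : Summable fun k => ‖g k‖ ^ 2) (hgε : ∑' k, ‖g k‖ ^ 2 ≤ ε ^ 2)
    (hg' : Summable fun k : ℤ × ℤ => (|(k.1 : ℝ)| * ‖g k‖) ^ 2)
    (hgε' : ∑' k : ℤ × ℤ, (|(k.1 : ℝ)| * ‖g k‖) ^ 2 ≤ ε ^ 2)
    (hh : Summable fun k => ‖h k‖) (hhL : ∑' k, ‖h k‖ ≤ L0)
    (hh' : Summable fun k : ℤ × ℤ => |(k.1 : ℝ)| * ‖h k‖)
    (hhL' : ∑' k : ℤ × ℤ, |(k.1 : ℝ)| * ‖h k‖ ≤ L1) :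
    ‖triForm f g h‖ ≤ (L0 + L1) * ε * A := by
  have y1 := young_trilinear (f := fun k => ‖g k‖) (h := fun k => ‖f k‖)
    (g := fun k : ℤ × ℤ => |(k.1 : ℝ)| * ‖h k‖) (fun _ => norm_nonneg _) (fun _ => by positivity)
    (fun _ => norm_nonneg _) hε hA hg hf hh' hgε hfA hhL'
  have y2 := young_trilinear (f := fun k : ℤ × ℤ => |(k.1 : ℝ)| * ‖g k‖) (h := fun k => ‖f k‖)
    (g := fun k : ℤ × ℤ => ‖h k‖) (fun _ => by positivity) (fun _ => norm_nonneg _)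
    (fun _ => norm_nonneg _) hε hA hg' hf hh hgε' hfA hhL
  -- Leibniz rule on the Fourier side: `|a₁ + b₁| ≤ |a₁| + |b₁|` puts the derivative on `g` or on
  -- `h`, never on `f`.
  have key : ∀ p : (ℤ × ℤ) × (ℤ × ℤ),
      ‖I * ((p.1 + p.2).1 : ℂ) * (starRingEnd ℂ) (f (p.1 + p.2)) * g p.1 * h p.2‖ ≤
        ‖g p.1‖ * (|(p.2.1 : ℝ)| * ‖h p.2‖) * ‖f (p.1 + p.2)‖ +
          |(p.1.1 : ℝ)| * ‖g p.1‖ * ‖h p.2‖ * ‖f (p.1 + p.2)‖ := by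
    intro p
    simp only [norm_mul, Complex.norm_I, RCLike.norm_conj, Complex.norm_intCast, one_mul,
      Prod.fst_add]
    push_cast
    have h1 := abs_add_le (p.1.1 : ℝ) (p.2.1 : ℝ)
    have h2 : 0 ≤ ‖f (p.1 + p.2)‖ * ‖g p.1‖ * ‖h p.2‖ := by positivity
    nlinarith [mul_le_mul_of_nonneg_right h1 h2]
  have hs := Summable.of_nonneg_of_le (fun p => norm_nonneg _) key (y1.1.add y2.1)
  rw [triForm_eq hs.of_norm]
  calc _ ≤ _ := norm_tsum_le_tsum_norm hs
    _ ≤ _ := Summable.tsum_le_tsum key hs (y1.1.add y2.1)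
    _ ≤ ε * L1 * A + ε * L0 * A := by rw [y1.1.tsum_add y2.1]; exact add_le_add y1.2 y2.2
    _ = (L0 + L1) * ε * A := by ring

theorem summable_triForm_of_finite {f g h : ℤ × ℤ → ℂ} (hg : g.support.Finite)
    (hh : h.support.Finite) : Summable fun p : (ℤ × ℤ) × (ℤ × ℤ) =>
      I * ((p.1 + p.2).1 : ℂ) * (starRingEnd ℂ) (f (p.1 + p.2)) * g p.1 * h p.2 :=
  summable_pair_of_finite hg hh _

theorem triForm_split {f g : ℤ × ℤ → ℂ} (hf : f.support.Finite) (hg : g.support.Finite) :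
    triForm f f g = (∑' p : (ℤ × ℤ) × (ℤ × ℤ),
        I * p.1.1 * (starRingEnd ℂ) (f (p.1 + p.2)) * f p.1 * g p.2) +
      ∑' p : (ℤ × ℤ) × (ℤ × ℤ),
        I * p.2.1 * (starRingEnd ℂ) (f (p.1 + p.2)) * f p.1 * g p.2 := by
  rw [triForm_eq (summable_triForm_of_finite hf hg),
    ← (summable_pair_of_finite hf hg _).tsum_add (summable_pair_of_finite hf hg _)]
  congr 1
  ext p
  simp only [Prod.fst_add]
  push_cast
  ring

/-- Of the two Leibniz terms, the one with the derivative on `f` has real part minus half that of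
the other, so no derivative of `f` remains. -/
theorem abs_re_triForm_self_le {f g : ℤ × ℤ → ℂ} (hf : f.support.Finite) (hg : g.support.Finite)
    (hgh : Hermitian g) {L : ℝ} (hL : ∑' k, |(k.1 : ℝ)| * ‖g k‖ ≤ L) :
    |(triForm f f g).re| ≤ L / 2 * ∑' k, ‖f k‖ ^ 2 := by
  have h1 := two_re_tsum_fst_mul hf hg hgh
  have h2 := norm_tsum_snd_mul_le hf hg hL
  have h3 := Complex.abs_re_le_norm (∑' p : (ℤ × ℤ) × (ℤ × ℤ),
        I * p.2.1 * (starRingEnd ℂ) (f (p.1 + p.2)) * f p.1 * g p.2)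
  rw [triForm_split hf hg, Complex.add_re, abs_le]
  have h4 := abs_le.1 (h3.trans h2)
  constructor <;> linarith [h4.1, h4.2]

theorem re_triForm_cubic {f : ℤ × ℤ → ℂ} (hf : f.support.Finite) (hfh : Hermitian f) :
    (triForm f f f).re = 0 := by
  have h1 := two_re_tsum_fst_mul hf hf hfh
  have h2 := re_tsum_cubic_eq_zero hf hfh
  rw [triForm_split hf hf, Complex.add_re]
  linarith

theorem summable_conv {f g : ℤ × ℤ → ℂ} (hf : Summable fun k => ‖f k‖)
    (hg : Summable fun k => ‖g k‖) (k : ℤ × ℤ) : Summable fun a => f a * g (k - a) := by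
  have hg' : Summable fun a => ‖g (k - a)‖ :=
    ((Equiv.subLeft k).summable_iff (f := fun a => ‖g a‖)).2 hg
  obtain ⟨M, hM⟩ : ∃ M, ∀ a, ‖g a‖ ≤ M := ⟨∑' a, ‖g a‖, fun a => hg.le_tsum a fun _ _ => norm_nonneg _⟩
  refine Summable.of_norm_bounded (hf.mul_right M) fun a => ?_
  rw [norm_mul]
  exact mul_le_mul_of_nonneg_left (hM _) (norm_nonneg _)

theorem summable_norm_of_finite {f : ℤ × ℤ → ℂ} (hf : f.support.Finite) (m : ℤ × ℤ → ℝ) :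
    Summable fun k => m k * ‖f k‖ :=
  summable_of_hasFiniteSupport (hf.subset fun k hk => by
    simp only [Function.mem_support, ne_eq] at hk ⊢; intro h; simp [h] at hk)

/-- Decomposition of the difference of the quadratic terms. -/
theorem conv_sub_conv {c w b : ℤ × ℤ → ℂ} (hc : Summable fun k => ‖c k‖)
    (hw : Summable fun k => ‖w k‖) (hb : Summable fun k => ‖b k‖) (k : ℤ × ℤ) :
    conv c c k - conv b b k =
      conv (fun k => c k - w k) c k + conv (fun k => c k - w k) w k
        + 2 * conv (fun k => w k - b k) w k
        - conv (fun k => w k - b k) (fun k => w k - b k) k := by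
  have hη : Summable fun k => ‖c k - w k‖ :=
    Summable.of_nonneg_of_le (fun _ => norm_nonneg _) (fun _ => norm_sub_le _ _) (hc.add hw)
  have hθ : Summable fun k => ‖w k - b k‖ :=
    Summable.of_nonneg_of_le (fun _ => norm_nonneg _) (fun _ => norm_sub_le _ _) (hw.add hb)
  have e1 := conv_comm (fun k => c k - w k) c k
  have e2 : 2 * conv (fun k => w k - b k) w k = conv w (fun k => w k - b k) k
      + conv (fun k => w k - b k) w k := by
    rw [conv_comm w]; ring
  rw [e1, e2]
  unfold conv
  rw [← (summable_conv hc hc k).tsum_sub (summable_conv hb hb k),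
    ← (summable_conv hc hη k).tsum_add (summable_conv hη hw k),
    ← (summable_conv hw hθ k).tsum_add (summable_conv hθ hw k),
    ← ((summable_conv hc hη k).add (summable_conv hη hw k)).tsum_add
      ((summable_conv hw hθ k).add (summable_conv hθ hw k)),
    ← (((summable_conv hc hη k).add (summable_conv hη hw k)).add
      ((summable_conv hw hθ k).add (summable_conv hθ hw k))).tsum_sub (summable_conv hθ hθ k)]
  congr 1
  ext a
  ring

/-- The energy inequality for the difference of a solution and a Galerkin solution. -/
theorem error_rate {α : ℝ} {c b : ℤ × ℤ → ℂ} {N : ℕ} {L0 L1 ε : ℝ} (hε : 0 ≤ ε)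
    (hc : Hermitian c) (hb : Hermitian b) (hbs : ∀ k ∉ box N, b k = 0)
    (h0 : Summable fun k => ‖c k‖) (hL0 : ∑' k, ‖c k‖ ≤ L0)
    (h1 : Summable fun k : ℤ × ℤ => |(k.1 : ℝ)| * ‖c k‖)
    (hL1 : ∑' k : ℤ × ℤ, |(k.1 : ℝ)| * ‖c k‖ ≤ L1)
    (hη : Summable fun k => ‖c k - trunc N c k‖ ^ 2)
    (hηε : ∑' k, ‖c k - trunc N c k‖ ^ 2 ≤ ε ^ 2)
    (hη' : Summable fun k : ℤ × ℤ => (|(k.1 : ℝ)| * ‖c k - trunc N c k‖) ^ 2)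
    (hηε' : ∑' k : ℤ × ℤ, (|(k.1 : ℝ)| * ‖c k - trunc N c k‖) ^ 2 ≤ ε ^ 2) :
    2 * (∑ k ∈ box N, (starRingEnd ℂ) (c k - b k) * (rhs α c k - rhs α b k)).re ≤
      (L0 + 2 * L1) * (∑ k ∈ box N, ‖c k - b k‖ ^ 2 + ε ^ 2) := by
  set w := trunc N c with hwdef
  set η : ℤ × ℤ → ℂ := fun k => c k - w k with hηdef
  set θ : ℤ × ℤ → ℂ := fun k => w k - b k with hθdef
  have hws : ∀ k ∉ box N, w k = 0 := fun k hk => trunc_of_notMem c hk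
  have hθs : ∀ k ∉ box N, θ k = 0 := fun k hk => by simp [hθdef, hws k hk, hbs k hk]
  have hθb : ∀ k ∈ box N, θ k = c k - b k := fun k hk => by simp [hθdef, hwdef, trunc, hk]
  have fw := support_finite_of_box hws
  have fb := support_finite_of_box hbs
  have fθ := support_finite_of_box hθs
  have hwh : Hermitian w := hc.trunc N
  have hθh : Hermitian θ := hwh.sub hb
  have sw : Summable fun k => ‖w k‖ := by simpa using summable_norm_of_finite fw 1
  have sb : Summable fun k => ‖b k‖ := by simpa using summable_norm_of_finite fb 1
  have sw1 := summable_norm_of_finite fw (fun k => |(k.1 : ℝ)|)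
  have hwL0 : ∑' k, ‖w k‖ ≤ L0 :=
    (Summable.tsum_le_tsum (fun k => norm_trunc_le N c k) sw h0).trans hL0
  have hwL1 : ∑' k : ℤ × ℤ, |(k.1 : ℝ)| * ‖w k‖ ≤ L1 :=
    (Summable.tsum_le_tsum (fun k => mul_le_mul_of_nonneg_left (norm_trunc_le N c k)
      (abs_nonneg _)) sw1 h1).trans hL1
  have hE : ∑ k ∈ box N, ‖c k - b k‖ ^ 2 = ∑' k, ‖θ k‖ ^ 2 := by
    rw [tsum_eq_sum (s := box N) fun k hk => by simp [hθs k hk]]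
    exact Finset.sum_congr rfl fun k hk => by rw [hθb k hk]
  set y := ∑' k, ‖θ k‖ ^ 2 with hy
  have hy0 : 0 ≤ y := tsum_nonneg fun _ => sq_nonneg _
  have sθ : Summable fun k => ‖θ k‖ ^ 2 :=
    summable_of_hasFiniteSupport (fθ.subset fun k hk => by
      simp only [Function.mem_support, ne_eq] at hk ⊢; intro h; simp [h] at hk)
  have hyA : ∑' k, ‖θ k‖ ^ 2 ≤ Real.sqrt y ^ 2 := by rw [Real.sq_sqrt hy0]
  have b1 := norm_triForm_le (Real.sqrt_nonneg y) hε sθ hyA hη hηε hη' hηε' h0 hL0 h1 hL1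
  have b2 := norm_triForm_le (Real.sqrt_nonneg y) hε sθ hyA hη hηε hη' hηε' sw hwL0 sw1 hwL1
  have b3 := abs_re_triForm_self_le fθ fw hwh hwL1
  have b4 := re_triForm_cubic fθ hθh
  -- Because `θ` is supported in the box, testing with it implements the Galerkin projection.
  have fin : ∀ g h : ℤ × ℤ → ℂ, triForm θ g h =
      ∑ k ∈ box N, (starRingEnd ℂ) (θ k) * (I * k.1 * conv g h k) := fun g h => by
    rw [triForm, tsum_eq_sum (s := box N) fun k hk => by simp [hθs k hk]]
  have main : 2 * (∑ k ∈ box N, (starRingEnd ℂ) (c k - b k) * (rhs α c k - rhs α b k)).re =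
      -(triForm θ η c + triForm θ η w + 2 * triForm θ θ w - triForm θ θ θ).re := by
    simp only [fin]
    rw [Finset.mul_sum, ← Finset.sum_add_distrib, ← Finset.sum_add_distrib,
      ← Finset.sum_sub_distrib, Complex.re_sum, Complex.re_sum, Finset.mul_sum,
      ← Finset.sum_neg_distrib]
    refine Finset.sum_congr rfl fun k hk => ?_
    rw [hθb k hk]
    have hcv := conv_sub_conv h0 sw sb k
    -- The dispersive contribution is `i` times a real number, so it disappears in the real part
    -- taken next.
    have e : (starRingEnd ℂ) (c k - b k) * (rhs α c k - rhs α b k) =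
        (((k.1 : ℝ) * Real.sqrt (normSq k) ^ α * ‖c k - b k‖ ^ 2 : ℝ) : ℂ) * I
          - (1 / 2 : ℝ) * ((starRingEnd ℂ) (c k - b k) * (I * k.1 * (conv c c k - conv b b k))) := by
      unfold rhs
      have := Complex.conj_mul' (c k - b k)
      push_cast
      linear_combination (I * k.1 * ((Real.sqrt (normSq k) ^ α : ℝ) : ℂ)) * this
    rw [e, Complex.sub_re, Complex.re_ofReal_mul, Complex.re_ofReal_mul, Complex.I_re, mul_zero,
      hcv, zero_sub]
    have e2 : (starRingEnd ℂ) (c k - b k) * (I * k.1 * (conv η c k + conv η w k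
        + 2 * conv θ w k - conv θ θ k)) =
        (starRingEnd ℂ) (c k - b k) * (I * k.1 * conv η c k) +
        (starRingEnd ℂ) (c k - b k) * (I * k.1 * conv η w k) +
        2 * ((starRingEnd ℂ) (c k - b k) * (I * k.1 * conv θ w k)) -
        (starRingEnd ℂ) (c k - b k) * (I * k.1 * conv θ θ k) := by ring
    rw [e2]
    ring
  rw [main, hE]
  simp only [Complex.add_re, Complex.sub_re]
  have r1 := (abs_le.1 ((Complex.abs_re_le_norm _).trans b1)).1
  have r2 := (abs_le.1 ((Complex.abs_re_le_norm _).trans b2)).1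
  have r3 := (abs_le.1 b3).1
  have r5 : (2 * triForm θ θ w).re = 2 * (triForm θ θ w).re := by simp
  have hL0' : 0 ≤ L0 := (tsum_nonneg fun _ => norm_nonneg _).trans hL0
  have hL1' : 0 ≤ L1 := (tsum_nonneg fun _ => by positivity).trans hL1
  have hamgm : 2 * (ε * Real.sqrt y) ≤ ε ^ 2 + y := by
    nlinarith [sq_nonneg (ε - Real.sqrt y), Real.sq_sqrt hy0]
  have := mul_le_mul_of_nonneg_left hamgm (add_nonneg hL0' hL1')
  rw [r5, b4]
  -- The two `η` terms give `2 (L0 + L1) ε √y`, hence at most `(L0 + L1)(ε² + y)`; the term `2 θ*w`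
  -- adds `L1 y`. Together this is at most `(L0 + 2 L1)(y + ε²)`.
  nlinarith [sq_nonneg ε, mul_nonneg hL1' (sq_nonneg ε)]

/-! ### Coefficient systems and Grönwall -/

/-- The Fourier coefficients of a solution on `[0,T]`. -/
structure CoeffSolution (α T : ℝ) (c : ℝ → ℤ × ℤ → ℂ) : Prop where
  hermitian : ∀ t ∈ Icc 0 T, Hermitian (c t)
  continuousOn : ∀ k, ContinuousOn (fun t => c t k) (Icc 0 T)
  hasDerivAt : ∀ t ∈ Ioo 0 T, ∀ k, HasDerivAt (fun s => c s k) (rhs α (c t) k) t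

/-- The Fourier coefficients of a solution of the Galerkin scheme on `[0,T]`. -/
structure CoeffGalerkin (α T : ℝ) (N : ℕ) (c₀ : ℤ × ℤ → ℂ) (b : ℝ → ℤ × ℤ → ℂ) : Prop where
  support : ∀ t ∈ Icc 0 T, ∀ k ∉ box N, b t k = 0
  initial : ∀ k ∈ box N, b 0 k = c₀ k
  hasDerivWithinAt : ∀ t ∈ Icc 0 T, ∀ k ∈ box N,
    HasDerivWithinAt (fun s => b s k) (rhs α (b t) k) (Icc 0 T) t

theorem hasDerivWithinAt_norm_sq {f : ℝ → ℂ} {f' : ℂ} {s : Set ℝ} {t : ℝ}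
    (hf : HasDerivWithinAt f f' s t) :
    HasDerivWithinAt (fun x => ‖f x‖ ^ 2) (2 * ((starRingEnd ℂ) (f t) * f').re) s t := by
  have h := hf.norm_sq
  convert h using 2
  rw [real_inner_comm]
  simp [Complex.inner]

/-- Grönwall with the differential inequality on the open interval only, since `CoeffSolution`
provides no derivative at the end points: `y e^{-At}` is antitone. -/
theorem exp_growth_bound {y y' : ℝ → ℝ} {A T : ℝ} (hy : ContinuousOn y (Icc 0 T))
    (hy' : ∀ t ∈ Ioo 0 T, HasDerivAt y (y' t) t) (h : ∀ t ∈ Ioo 0 T, y' t ≤ A * y t) :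
    ∀ t ∈ Icc 0 T, y t ≤ y 0 * Real.exp (A * t) := by
  intro t ht
  have hd : ∀ s ∈ Ioo 0 T, HasDerivAt (fun s => y s * Real.exp (-A * s))
      (y' s * Real.exp (-A * s) + y s * (Real.exp (-A * s) * (-A * 1))) s := fun s hs =>
    (hy' s hs).mul (((hasDerivAt_id s).const_mul (-A)).exp)
  have hanti : AntitoneOn (fun s => y s * Real.exp (-A * s)) (Icc 0 T) := by
    refine antitoneOn_of_deriv_nonpos (convex_Icc 0 T) ?_ ?_ ?_
    · exact hy.mul (by fun_prop)
    · rw [interior_Icc]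
      exact fun s hs => (hd s hs).differentiableAt.differentiableWithinAt
    · rw [interior_Icc]
      intro s hs
      rw [(hd s hs).deriv]
      have := h s hs
      have he := Real.exp_pos (-A * s)
      nlinarith
  have h1 := hanti (left_mem_Icc.2 (ht.1.trans ht.2)) ht ht.1
  simp only [mul_zero, Real.exp_zero, mul_one] at h1
  have he := Real.exp_pos (A * t)
  calc y t = y t * Real.exp (-A * t) * Real.exp (A * t) := by
        rw [mul_assoc, ← Real.exp_add]; simp
    _ ≤ y 0 * Real.exp (A * t) := by gcongr

/-- The error estimate in Fourier coefficients. -/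
theorem CoeffSolution.error_le {α T : ℝ} {c b : ℝ → ℤ × ℤ → ℂ} {N : ℕ} {L0 L1 ε : ℝ}
    (hε : 0 ≤ ε) (hc : CoeffSolution α T c) (hb : CoeffGalerkin α T N (c 0) b)
    (hbh : ∀ t ∈ Icc 0 T, Hermitian (b t))
    (h0 : ∀ t ∈ Ioo 0 T, (Summable fun k => ‖c t k‖) ∧ ∑' k, ‖c t k‖ ≤ L0)
    (h1 : ∀ t ∈ Ioo 0 T, (Summable fun k : ℤ × ℤ => |(k.1 : ℝ)| * ‖c t k‖) ∧
      ∑' k : ℤ × ℤ, |(k.1 : ℝ)| * ‖c t k‖ ≤ L1)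
    (hη : ∀ t ∈ Ioo 0 T, (Summable fun k => ‖c t k - trunc N (c t) k‖ ^ 2) ∧
      ∑' k, ‖c t k - trunc N (c t) k‖ ^ 2 ≤ ε ^ 2)
    (hη' : ∀ t ∈ Ioo 0 T,
      (Summable fun k : ℤ × ℤ => (|(k.1 : ℝ)| * ‖c t k - trunc N (c t) k‖) ^ 2) ∧
      ∑' k : ℤ × ℤ, (|(k.1 : ℝ)| * ‖c t k - trunc N (c t) k‖) ^ 2 ≤ ε ^ 2) :
    ∀ t ∈ Icc 0 T, ∑ k ∈ box N, ‖c t k - b t k‖ ^ 2 ≤ ε ^ 2 * Real.exp ((L0 + 2 * L1) * t) := by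
  intro t ht
  have hbc : ∀ k ∈ box N, ContinuousOn (fun t => b t k) (Icc 0 T) := fun k hk s hs =>
    (hb.hasDerivWithinAt s hs k hk).continuousWithinAt
  -- Adding the constant `ε²` to the squared error makes the inequality of `error_rate` homogeneous,
  -- and the initial value is then exactly `ε²`.
  have key := exp_growth_bound (y := fun s => ∑ k ∈ box N, ‖c s k - b s k‖ ^ 2 + ε ^ 2)
    (y' := fun s => 2 * (∑ k ∈ box N, (starRingEnd ℂ) (c s k - b s k) *
      (rhs α (c s) k - rhs α (b s) k)).re) (A := L0 + 2 * L1) (T := T) ?_ ?_ ?_ t ht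
  · have hz : ∑ k ∈ box N, ‖c 0 k - b 0 k‖ ^ 2 = 0 :=
      Finset.sum_eq_zero fun k hk => by rw [hb.initial k hk]; simp
    simp only [hz, zero_add] at key
    nlinarith [sq_nonneg ε]
  · refine ContinuousOn.add (continuousOn_finsetSum _ fun k hk => ?_) continuousOn_const
    exact (((hc.continuousOn k).sub (hbc k hk)).norm).pow 2
  · intro s hs
    refine HasDerivAt.add_const _ ?_
    rw [Complex.re_sum, Finset.mul_sum]
    refine HasDerivAt.fun_sum fun k hk => ?_
    rw [← hasDerivWithinAt_univ]
    refine hasDerivWithinAt_norm_sq (f := fun s => c s k - b s k) ?_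
    rw [hasDerivWithinAt_univ]
    exact (hc.hasDerivAt s hs k).sub
      ((hb.hasDerivWithinAt s (Ioo_subset_Icc_self hs) k hk).hasDerivAt (Icc_mem_nhds hs.1 hs.2))
  · intro s hs
    have hs' := Ioo_subset_Icc_self hs
    exact error_rate hε (hc.hermitian s hs') (hbh s hs') (hb.support s hs') (h0 s hs).1 (h0 s hs).2
      (h1 s hs).1 (h1 s hs).2 (hη s hs).1 (hη s hs).2 (hη' s hs).1 (hη' s hs).2

/-! ### The Galerkin system preserves real functions -/

section Galerkin

variable (α : ℝ) (N : ℕ)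

/-- Extension by zero of a family indexed by the box. -/
def extBox {N : ℕ} (v : box N → ℂ) (k : ℤ × ℤ) : ℂ := if h : k ∈ box N then v ⟨k, h⟩ else 0

theorem extBox_mem {N : ℕ} (v : box N → ℂ) (k : box N) : extBox v k = v k := by
  simp [extBox]

theorem extBox_notMem {N : ℕ} (v : box N → ℂ) {k : ℤ × ℤ} (hk : k ∉ box N) : extBox v k = 0 := by
  simp [extBox, hk]

theorem extBox_restrict {N : ℕ} {f : ℤ × ℤ → ℂ} (hf : ∀ k ∉ box N, f k = 0) :
    extBox (fun k : box N => f k) = f := by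
  ext k
  by_cases hk : k ∈ box N
  · simp [extBox, hk]
  · simp [extBox, hk, hf k hk]

/-- The vector field of the Galerkin scheme. -/
def galerkinField (v : box N → ℂ) (k : box N) : ℂ := rhs α (extBox v) k

theorem contDiff_extBox (k : ℤ × ℤ) : ContDiff ℝ 1 fun v : box N → ℂ => extBox v k := by
  by_cases hk : k ∈ box N
  · simp only [extBox, hk, dif_pos]
    fun_prop
  · simp only [extBox, hk, dif_neg, not_false_eq_true]
    fun_prop

theorem conv_eq_sum_box {f : ℤ × ℤ → ℂ} (hf : ∀ k ∉ box N, f k = 0) (g : ℤ × ℤ → ℂ) (k : ℤ × ℤ) :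
    conv f g k = ∑ a ∈ box N, f a * g (k - a) :=
  tsum_eq_sum fun a ha => by simp [hf a ha]

theorem contDiff_galerkinField : ContDiff ℝ 1 (galerkinField α N) := by
  rw [contDiff_pi]
  intro k
  unfold galerkinField rhs
  have h : ∀ v : box N → ℂ, conv (extBox v) (extBox v) k =
      ∑ a ∈ box N, extBox v a * extBox v (k - a) := fun v =>
    conv_eq_sum_box N (fun k hk => extBox_notMem v hk) _ _
  simp only [h]
  refine ContDiff.sub (contDiff_const.mul (contDiff_extBox N _)) (contDiff_const.mul ?_)
  exact ContDiff.sum fun a _ => (contDiff_extBox N _).mul (contDiff_extBox N _)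

/-- The coefficients of the complex conjugate. -/
def starSeq (f : ℤ × ℤ → ℂ) (k : ℤ × ℤ) : ℂ := (starRingEnd ℂ) (f (-k))

theorem conv_starSeq (f : ℤ × ℤ → ℂ) (k : ℤ × ℤ) :
    conv (starSeq f) (starSeq f) k = starSeq (conv f f) k := by
  unfold conv starSeq
  rw [Complex.conj_tsum, ← (Equiv.neg (ℤ × ℤ)).tsum_eq]
  congr 1
  ext a
  simp only [Equiv.neg_apply, neg_neg, map_mul]
  congr 3
  abel

/-- The symbols `i k₁` and `i k₁ |k|^α` commute with `k ↦ -k` followed by conjugation, so the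
conjugate of a solution is again a solution. -/
theorem rhs_starSeq (f : ℤ × ℤ → ℂ) (k : ℤ × ℤ) :
    rhs α (starSeq f) k = starSeq (rhs α f) k := by
  have hn : normSq (-k) = normSq k := by simp [normSq]
  unfold rhs
  rw [conv_starSeq]
  simp only [starSeq, hn, map_sub, map_mul, map_div₀, Complex.conj_I, Complex.conj_ofReal,
    map_intCast, map_ofNat, Prod.fst_neg]
  push_cast
  ring

theorem hermitian_iff_starSeq {f : ℤ × ℤ → ℂ} : Hermitian f ↔ starSeq f = f := by
  constructor
  · intro h; ext k; rw [starSeq, h k, Complex.conj_conj]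
  · intro h k
    have := congrFun h (-k)
    rw [starSeq, neg_neg] at this
    exact this.symm

variable {α N}

theorem hasDerivWithinAt_starSeq {b : ℝ → ℤ × ℤ → ℂ} {b' : ℤ × ℤ → ℂ} {s : Set ℝ} {t : ℝ}
    {k : ℤ × ℤ} (h : HasDerivWithinAt (fun x => b x (-k)) (b' (-k)) s t) :
    HasDerivWithinAt (fun x => starSeq (b x) k) (starSeq b' k) s t :=
  (Complex.conjCLE.toContinuousLinearMap.hasFDerivAt.comp_hasDerivWithinAt t h)

/-- The Galerkin solution with real initial datum is real. -/
theorem CoeffGalerkin.hermitian {T : ℝ} {c₀ : ℤ × ℤ → ℂ} {b : ℝ → ℤ × ℤ → ℂ}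
    (hb : CoeffGalerkin α T N c₀ b) (hc₀ : Hermitian c₀) :
    ∀ t ∈ Icc 0 T, Hermitian (b t) := by
  intro t ht
  set f : ℝ → box N → ℂ := fun t k => b t k with hf
  set g : ℝ → box N → ℂ := fun t k => starSeq (b t) k with hg
  have hstar : ∀ t ∈ Icc 0 T, ∀ k ∉ box N, starSeq (b t) k = 0 := fun t ht k hk => by
    rw [starSeq, hb.support t ht _ (by rwa [neg_mem_box]), map_zero]
  have hfd : ∀ t ∈ Icc 0 T, HasDerivWithinAt f (galerkinField α N (f t)) (Icc 0 T) t := by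
    intro t ht
    rw [hasDerivWithinAt_pi]
    intro k
    have := hb.hasDerivWithinAt t ht k k.2
    rw [galerkinField, hf, extBox_restrict (hb.support t ht)]
    exact this
  have hgd : ∀ t ∈ Icc 0 T, HasDerivWithinAt g (galerkinField α N (g t)) (Icc 0 T) t := by
    intro t ht
    rw [hasDerivWithinAt_pi]
    intro k
    have := hb.hasDerivWithinAt t ht (-k) (neg_mem_box.2 k.2)
    rw [galerkinField, hg, extBox_restrict (hstar t ht), rhs_starSeq]
    exact hasDerivWithinAt_starSeq this
  have hfc : ContinuousOn f (Icc 0 T) := fun t ht => (hfd t ht).continuousWithinAt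
  have hgc : ContinuousOn g (Icc 0 T) := fun t ht => (hgd t ht).continuousWithinAt
  obtain ⟨R1, hR1⟩ := isCompact_Icc.exists_bound_of_continuousOn hfc
  obtain ⟨R2, hR2⟩ := isCompact_Icc.exists_bound_of_continuousOn hgc
  -- Both curves stay in one compact ball, on which the `C¹` vector field is Lipschitz; this is what
  -- ODE uniqueness needs.
  obtain ⟨K, hK⟩ := LocallyLipschitzOn.exists_lipschitzOnWith_of_compact
    (isCompact_closedBall (0 : box N → ℂ) (max R1 R2))
    ((contDiff_galerkinField α N).locallyLipschitz.locallyLipschitzOn)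
  have hIci : ∀ {F : ℝ → box N → ℂ} {F' : box N → ℂ} {t : ℝ}, t ∈ Ico 0 T →
      HasDerivWithinAt F F' (Icc 0 T) t → HasDerivWithinAt F F' (Ici t) t :=
    fun ht h => (h.mono (Icc_subset_Icc_left ht.1)).mono_of_mem_nhdsWithin
      (Icc_mem_nhdsGE ht.2)
  have h := ODE_solution_unique_of_mem_Icc_right (v := fun _ => galerkinField α N)
    (s := fun _ => Metric.closedBall 0 (max R1 R2)) (K := K) (f := f) (g := g) (a := 0) (b := T)
    (fun _ _ => hK) hfc (fun t ht => hIci ht (hfd t (Ico_subset_Icc_self ht)))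
    (fun t ht => by simpa using Or.inl (hR1 t (Ico_subset_Icc_self ht))) hgc
    (fun t ht => hIci ht (hgd t (Ico_subset_Icc_self ht)))
    (fun t ht => by simpa using Or.inr (hR2 t (Ico_subset_Icc_self ht)))
    (by
      ext k
      simp only [hf, hg, starSeq]
      rw [hb.initial k k.2, hb.initial (-k) (neg_mem_box.2 k.2), hc₀, Complex.conj_conj]) ht
  rw [hermitian_iff_starSeq]
  ext k
  by_cases hk : k ∈ box N
  · exact (congrFun h ⟨k, hk⟩).symm
  · rw [hstar t ht k hk, hb.support t ht k hk]

end Galerkin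

/-! ### Energy conservation and global existence of Galerkin solutions -/

theorem Hermitian.rhs {α : ℝ} {f : ℤ × ℤ → ℂ} (hf : Hermitian f) : Hermitian (rhs α f) := by
  rw [hermitian_iff_starSeq] at hf ⊢
  ext k
  rw [← rhs_starSeq, hf]

theorem re_conj_mul_dispersion (α : ℝ) (k : ℤ × ℤ) (z w : ℂ) :
    ((starRingEnd ℂ) z * (I * k.1 * ((Real.sqrt (normSq k) ^ α : ℝ) : ℂ) * z - I * k.1 / 2 * w)).re
      = -(1 / 2) * ((starRingEnd ℂ) z * (I * k.1 * w)).re := by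
  have e : (starRingEnd ℂ) z * (I * k.1 * ((Real.sqrt (normSq k) ^ α : ℝ) : ℂ) * z - I * k.1 / 2 * w)
      = (((k.1 : ℝ) * Real.sqrt (normSq k) ^ α * ‖z‖ ^ 2 : ℝ) : ℂ) * I
          + (-(1 / 2) : ℝ) * ((starRingEnd ℂ) z * (I * k.1 * w)) := by
    have := Complex.conj_mul' z
    push_cast
    linear_combination (I * k.1 * ((Real.sqrt (normSq k) ^ α : ℝ) : ℂ)) * this
  rw [e, Complex.add_re, Complex.re_ofReal_mul, Complex.re_ofReal_mul, Complex.I_re, mul_zero,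
    zero_add]

/-- The dispersion is skew and the nonlinearity contributes only the cubic form, which vanishes for
Hermitian sequences. -/
theorem energy_conservation (α : ℝ) {N : ℕ} {f : ℤ × ℤ → ℂ} (hf : ∀ k ∉ box N, f k = 0)
    (hfh : Hermitian f) : (∑ k ∈ box N, (starRingEnd ℂ) (f k) * rhs α f k).re = 0 := by
  have h := re_triForm_cubic (support_finite_of_box hf) hfh
  rw [triForm, tsum_eq_sum (s := box N) fun k hk => by simp [hf k hk], Complex.re_sum] at h
  simp only [rhs, Complex.re_sum, re_conj_mul_dispersion]
  rw [← Finset.mul_sum, h, mul_zero]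

/-- The field is quadratic, so Picard–Lindelöf alone gives only a short time. A cutoff field,
bounded on the whole space, can be solved on all of `[0, T]`; energy conservation then shows that
the cutoff is never active. -/
theorem exists_coeffGalerkin (α : ℝ) {T : ℝ} (hT : 0 < T) (N : ℕ) {c₀ : ℤ × ℤ → ℂ}
    (hc₀ : Hermitian c₀) : ∃ b, CoeffGalerkin α T N c₀ b := by
  -- Symmetrisation onto Hermitian sequences. The field composed with `S` takes Hermitian values at
  -- every point, so Hermitian data remain Hermitian without a uniqueness argument.
  set S : (box N → ℂ) → ℤ × ℤ → ℂ := fun v k => (extBox v k + starSeq (extBox v) k) / 2 with hS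
  have hSs : ∀ v, ∀ k ∉ box N, S v k = 0 := fun v k hk => by
    have hk' : -k ∉ box N := by rwa [neg_mem_box]
    simp [hS, starSeq, extBox_notMem v hk, extBox_notMem v hk']
  have hSh : ∀ v, Hermitian (S v) := fun v k => by
    simp only [hS, starSeq, neg_neg, map_div₀, map_add, Complex.conj_conj, map_ofNat]
    ring
  have hSc : ContDiff ℝ 1 fun v : box N → ℂ => fun k : box N => S v k := by
    rw [contDiff_pi]
    intro k
    simp only [hS, starSeq]
    refine ContDiff.div_const (ContDiff.add (contDiff_extBox N _) ?_) 2
    exact Complex.conjCLE.toContinuousLinearMap.contDiff.comp (contDiff_extBox N (-k))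
  set x₀ : box N → ℂ := fun k => c₀ k with hx₀
  set R : ℝ := Real.sqrt (∑ k : box N, ‖c₀ k‖ ^ 2) with hR
  have hR0 : 0 ≤ R := Real.sqrt_nonneg _
  -- The cutoff is `1` on the sup-norm ball of radius `R + 1`, which contains the conserved `ℓ²`
  -- sphere of radius `R`.
  let χ : ContDiffBump (0 : box N → ℂ) := ⟨R + 1, R + 2, by linarith, by linarith⟩
  set F : (box N → ℂ) → box N → ℂ := fun v => galerkinField α N fun k : box N => S v k with hF
  have hFeq : ∀ v k, F v k = rhs α (S v) k := fun v k => by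
    simp only [hF, galerkinField]
    rw [extBox_restrict (hSs v)]
  have hFc : ContDiff ℝ 1 F := (contDiff_galerkinField α N).comp hSc
  set G : (box N → ℂ) → box N → ℂ := fun v => χ v • F v with hG
  have hGc : ContDiff ℝ 1 G := χ.contDiff.smul hFc
  have hGs : HasCompactSupport G := χ.hasCompactSupport.smul_right
  obtain ⟨L, hL⟩ := hGs.exists_bound_of_continuous hGc.continuous
  have hL0 : 0 ≤ L := (norm_nonneg _).trans (hL 0)
  obtain ⟨K, hK⟩ := LocallyLipschitzOn.exists_lipschitzOnWith_of_compact
    (isCompact_closedBall x₀ (L * T)) hGc.locallyLipschitz.locallyLipschitzOn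
  -- The speed is at most `L` everywhere, so a ball of radius `L * T` cannot be left before time
  -- `T`.
  have hPL : IsPicardLindelof (fun _ : ℝ => G) (tmin := 0) (tmax := T) ⟨0, le_rfl, hT.le⟩ x₀
      ⟨L * T, by positivity⟩ 0 ⟨L, hL0⟩ K :=
    IsPicardLindelof.of_time_independent (fun x _ => hL x) hK (by simp only [sub_zero, sub_self, max_eq_left hT.le]; exact le_of_eq (sub_zero _).symm)
  obtain ⟨v, hv0, hvd⟩ := hPL.exists_eq_forall_mem_Icc_hasDerivWithinAt₀
  replace hv0 : v 0 = x₀ := hv0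
  have hvk : ∀ t ∈ Icc 0 T, ∀ k : ℤ × ℤ, k ∈ box N → HasDerivWithinAt (fun s => extBox (v s) k)
      (χ (v t) * rhs α (S (v t)) k) (Icc 0 T) t := by
    intro t ht k hk
    have := hasDerivWithinAt_pi.1 (hvd t ht) ⟨k, hk⟩
    simp only [hG, Pi.smul_apply, hFeq, Complex.real_smul] at this
    have e : ∀ s, extBox (v s) k = v s ⟨k, hk⟩ := fun s => extBox_mem (v s) ⟨k, hk⟩
    simpa only [e] using this
  have hIci : ∀ {f : ℝ → ℂ} {f' : ℂ} {t : ℝ}, t ∈ Ico 0 T →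
      HasDerivWithinAt f f' (Icc 0 T) t → HasDerivWithinAt f f' (Ici t) t :=
    fun ht h => (h.mono (Icc_subset_Icc_left ht.1)).mono_of_mem_nhdsWithin
      (Icc_mem_nhdsGE ht.2)
  have hherm : ∀ t ∈ Icc 0 T, Hermitian (extBox (v t)) := by
    intro t ht
    rw [hermitian_iff_starSeq]
    ext k
    by_cases hk : k ∈ box N
    · have hk' := neg_mem_box.2 hk
      have hd : ∀ s ∈ Icc 0 T, HasDerivWithinAt
          (fun s => starSeq (extBox (v s)) k - extBox (v s) k) 0 (Icc 0 T) s := by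
        intro s hs
        have h1 := hasDerivWithinAt_starSeq (b := fun s => extBox (v s))
          (b' := fun k => χ (v s) * rhs α (S (v s)) k) (hvk s hs (-k) hk')
        have h2 := h1.sub (hvk s hs k hk)
        have e : starSeq (fun k => χ (v s) * rhs α (S (v s)) k) k - χ (v s) * rhs α (S (v s)) k
            = 0 := by
          simp only [starSeq, map_mul, Complex.conj_ofReal]
          rw [(hSh (v s)).rhs k, Complex.conj_conj, sub_self]
        rw [e] at h2
        exact h2
      have hconst := constant_of_has_deriv_right_zero
        (fun s hs => (hd s hs).continuousWithinAt)
        (fun s hs => hIci hs (hd s (Ico_subset_Icc_self hs))) t ht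
      have hz : starSeq (extBox (v 0)) k - extBox (v 0) k = 0 := by
        rw [hv0]
        simp only [starSeq, extBox, hk, hk', dif_pos, hx₀]
        rw [hc₀ k, Complex.conj_conj, sub_self]
      rw [hz] at hconst
      exact sub_eq_zero.1 hconst
    · simp [starSeq, extBox_notMem (v t) hk, extBox_notMem (v t) (mt neg_mem_box.1 hk)]
  have hSv : ∀ t ∈ Icc 0 T, S (v t) = extBox (v t) := by
    intro t ht
    ext k
    simp only [hS]
    rw [hermitian_iff_starSeq.1 (hherm t ht)]
    ring
  have henergy : ∀ t ∈ Icc 0 T, ∑ k ∈ box N, ‖extBox (v t) k‖ ^ 2 = R ^ 2 := by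
    intro t ht
    have hd : ∀ s ∈ Icc 0 T, HasDerivWithinAt (fun s => ∑ k ∈ box N, ‖extBox (v s) k‖ ^ 2) 0
        (Icc 0 T) s := by
      intro s hs
      have h1 := HasDerivWithinAt.fun_sum fun k hk => hasDerivWithinAt_norm_sq (hvk s hs k hk)
      refine h1.congr_deriv ?_
      rw [hSv s hs]
      have h2 := energy_conservation α (fun k hk => extBox_notMem (v s) hk) (hherm s hs)
      rw [Complex.re_sum] at h2
      have h3 : ∀ k, 2 * ((starRingEnd ℂ) (extBox (v s) k) * (χ (v s) * rhs α (extBox (v s)) k)).re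
          = 2 * χ (v s) * ((starRingEnd ℂ) (extBox (v s) k) * rhs α (extBox (v s)) k).re := by
        intro k
        rw [mul_left_comm, Complex.re_ofReal_mul]; ring
      simp only [h3]
      rw [← Finset.mul_sum, h2, mul_zero]
    have hconst := constant_of_has_deriv_right_zero
      (fun s hs => (hd s hs).continuousWithinAt)
      (fun s hs => ((hd s (Ico_subset_Icc_self hs)).mono
        (Icc_subset_Icc_left hs.1)).mono_of_mem_nhdsWithin (Icc_mem_nhdsGE hs.2)) t ht
    rw [hconst, hv0, hR, Real.sq_sqrt (Finset.sum_nonneg fun _ _ => sq_nonneg _),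
      ← Finset.sum_coe_sort (box N)]
    refine Finset.sum_congr rfl fun k _ => ?_
    rw [extBox_mem]
  have hχ : ∀ t ∈ Icc 0 T, χ (v t) = 1 := by
    intro t ht
    apply χ.one_of_mem_closedBall
    rw [mem_closedBall_zero_iff]
    refine (pi_norm_le_iff_of_nonneg (by linarith : (0 : ℝ) ≤ R + 1)).2 fun k => ?_
    have h1 := henergy t ht
    have h2 : ‖extBox (v t) k‖ ^ 2 ≤ R ^ 2 := by
      rw [← h1]
      exact Finset.single_le_sum (f := fun k => ‖extBox (v t) k‖ ^ 2)
        (fun _ _ => sq_nonneg _) k.2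
    rw [extBox_mem] at h2
    linarith [(sq_le_sq₀ (norm_nonneg _) hR0).1 h2]
  refine ⟨fun t => extBox (v t), fun t _ k hk => extBox_notMem (v t) hk, fun k hk => ?_,
    fun t ht k hk => ?_⟩
  · simp only [hv0, extBox, hk, dif_pos, hx₀]
  · have := hvk t ht k hk
    rwa [hχ t ht, hSv t ht, Complex.ofReal_one, one_mul] at this

/-! ### Sobolev weights, the Wiener algebra and dispersive smoothing -/

theorem normSq_nonneg (k : ℤ × ℤ) : 0 ≤ normSq k := by unfold normSq; positivity

theorem one_add_normSq_pos (k : ℤ × ℤ) : 0 < 1 + normSq k := by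
  have := normSq_nonneg k; linarith

theorem summable_one_add_int_sq_inv : Summable fun n : ℤ => (1 + (n : ℝ) ^ 2)⁻¹ := by
  have h : Summable fun n : ℤ => 1 / (n : ℝ) ^ 2 := Real.summable_one_div_int_pow.2 one_lt_two
  refine h.of_norm_bounded_eventually ?_
  rw [Filter.eventually_cofinite]
  refine (Set.finite_singleton (0 : ℤ)).subset fun n hn => ?_
  by_contra h0
  have h1 : (n : ℝ) ≠ 0 := by exact_mod_cast h0
  apply hn
  have : 0 < (n : ℝ) ^ 2 := by positivity
  rw [Real.norm_of_nonneg (by positivity), one_div]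
  exact inv_anti₀ this (by linarith)

theorem summable_prod_one_add_sq_inv :
    Summable fun k : ℤ × ℤ => (1 + (k.1 : ℝ) ^ 2)⁻¹ * (1 + (k.2 : ℝ) ^ 2)⁻¹ :=
  Summable.mul_of_nonneg summable_one_add_int_sq_inv summable_one_add_int_sq_inv
    (fun _ => by positivity) (fun _ => by positivity)

theorem summable_weight_inv : Summable fun k : ℤ × ℤ => ((1 + normSq k) ^ 2)⁻¹ := by
  refine summable_prod_one_add_sq_inv.of_nonneg_of_le (fun k => by positivity) fun k => ?_
  rw [← mul_inv]
  refine inv_anti₀ (by positivity) ?_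
  unfold normSq
  nlinarith [sq_nonneg (k.1 : ℝ), sq_nonneg (k.2 : ℝ), mul_nonneg (sq_nonneg (k.1 : ℝ))
    (sq_nonneg (k.2 : ℝ)), sq_nonneg ((k.1 : ℝ) ^ 2), sq_nonneg ((k.2 : ℝ) ^ 2)]

/-- The constant of the embedding of `H²` into the Wiener algebra. -/
def wienerConst : ℝ := Real.sqrt (∑' k : ℤ × ℤ, ((1 + normSq k) ^ 2)⁻¹)

theorem wienerConst_nonneg : 0 ≤ wienerConst := Real.sqrt_nonneg _

theorem rpow_half_sq {x : ℝ} (hx : 0 ≤ x) (r : ℝ) : (x ^ (r / 2)) ^ 2 = x ^ r := by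
  rw [← Real.rpow_natCast, ← Real.rpow_mul hx]
  norm_num

/-- The Sobolev space `H^r`, `r ≥ 2`, is contained in the Wiener algebra. -/
theorem wiener_le_sobolev {f : ℤ × ℤ → ℂ} {r M : ℝ} (hr : 2 ≤ r) (hM : 0 ≤ M)
    (hf : Summable fun k => ((1 + normSq k) ^ (r / 2) * ‖f k‖) ^ 2)
    (hfM : ∑' k, ((1 + normSq k) ^ (r / 2) * ‖f k‖) ^ 2 ≤ M ^ 2) :
    (Summable fun k => ‖f k‖) ∧ ∑' k, ‖f k‖ ≤ wienerConst * M := by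
  have hle : ∀ k : ℤ × ℤ, (((1 + normSq k) ^ (r / 2))⁻¹) ^ 2 ≤ ((1 + normSq k) ^ 2)⁻¹ := by
    intro k
    rw [inv_pow, rpow_half_sq (one_add_normSq_pos k).le]
    refine inv_anti₀ (pow_pos (one_add_normSq_pos k) 2) ?_
    rw [← Real.rpow_two]
    exact Real.rpow_le_rpow_of_exponent_le (by linarith [normSq_nonneg k]) hr
  have hs : Summable fun k : ℤ × ℤ => (((1 + normSq k) ^ (r / 2))⁻¹) ^ 2 :=
    summable_weight_inv.of_nonneg_of_le (fun k => sq_nonneg _) hle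
  have h := tsum_mul_le_of_sq (f := fun k : ℤ × ℤ => ((1 + normSq k) ^ (r / 2))⁻¹)
    (g := fun k => (1 + normSq k) ^ (r / 2) * ‖f k‖) (A := wienerConst) (B := M)
    (fun k => inv_nonneg.2 (Real.rpow_nonneg (one_add_normSq_pos k).le _))
    (fun k => mul_nonneg (Real.rpow_nonneg (one_add_normSq_pos k).le _) (norm_nonneg _))
    wienerConst_nonneg hM hs hf
    (by
      rw [wienerConst, Real.sq_sqrt (tsum_nonneg fun k => by positivity)]
      exact Summable.tsum_le_tsum hle hs summable_weight_inv) hfM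
  have e : ∀ k : ℤ × ℤ, ((1 + normSq k) ^ (r / 2))⁻¹ * ((1 + normSq k) ^ (r / 2) * ‖f k‖) = ‖f k‖ :=
    fun k => inv_mul_cancel_left₀ (Real.rpow_pos_of_pos (one_add_normSq_pos k) _).ne' _
  simpa only [e] using h

/-- `1 + |a + b|²` is at most `4` times the larger of the two weights, and `4^{r/2} = 2^r`. This is
the Leibniz rule behind the algebra property. -/
theorem weight_add_le {r : ℝ} (hr : 0 ≤ r) (a b : ℤ × ℤ) :
    (1 + normSq (a + b)) ^ (r / 2) ≤
      2 ^ r * ((1 + normSq a) ^ (r / 2) + (1 + normSq b) ^ (r / 2)) := by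
  have hr2 : 0 ≤ r / 2 := by linarith
  have ha := one_add_normSq_pos a
  have hb := one_add_normSq_pos b
  have h4 : (4 : ℝ) ^ (r / 2) = 2 ^ r := by
    rw [show (4 : ℝ) = 2 ^ (2 : ℝ) by norm_num, ← Real.rpow_mul (by norm_num)]
    congr 1; ring
  have hsum : 1 + normSq (a + b) ≤ 2 * (1 + normSq a) + 2 * (1 + normSq b) := by
    simp only [normSq, Prod.fst_add, Prod.snd_add]
    push_cast
    nlinarith [sq_nonneg ((a.1 : ℝ) - b.1), sq_nonneg ((a.2 : ℝ) - b.2)]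
  have hp : ∀ x : ℤ × ℤ, 1 + normSq (a + b) ≤ 4 * (1 + normSq x) →
      (1 + normSq (a + b)) ^ (r / 2) ≤ 2 ^ r * (1 + normSq x) ^ (r / 2) := by
    intro x hx
    rw [← h4, ← Real.mul_rpow (by norm_num) (one_add_normSq_pos x).le]
    exact Real.rpow_le_rpow (one_add_normSq_pos _).le hx hr2
  have h2r : (0 : ℝ) < 2 ^ r := by positivity
  rcases le_total (normSq a) (normSq b) with h | h
  · refine (hp b (by linarith)).trans ?_
    have := Real.rpow_nonneg ha.le (r / 2)
    nlinarith
  · refine (hp a (by linarith)).trans ?_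
    have := Real.rpow_nonneg hb.le (r / 2)
    nlinarith

theorem norm_conv_le {f g : ℤ × ℤ → ℂ} (hf : Summable fun k => ‖f k‖)
    (hg : Summable fun k => ‖g k‖) (k : ℤ × ℤ) : ‖conv f g k‖ ≤ ∑' a, ‖f a‖ * ‖g (k - a)‖ := by
  have := summable_conv (f := fun k => (‖f k‖ : ℂ)) (g := fun k => (‖g k‖ : ℂ)) (by simpa using hf)
    (by simpa using hg) k
  have h2 : Summable fun a => ‖f a * g (k - a)‖ := by
    simp only [norm_mul]
    exact_mod_cast this
  refine (norm_tsum_le_tsum_norm h2).trans (le_of_eq ?_)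
  simp only [norm_mul]

theorem conv_wiener {f : ℤ × ℤ → ℂ} {L : ℝ} (hf : Summable fun k => ‖f k‖)
    (hL : ∑' k, ‖f k‖ ≤ L) :
    (Summable fun k => ‖conv f f k‖) ∧ ∑' k, ‖conv f f k‖ ≤ L ^ 2 := by
  have h := young_conv_one (fun _ => norm_nonneg _) (fun _ => norm_nonneg _) hf hf
  have hs := Summable.of_nonneg_of_le (fun _ => norm_nonneg _) (norm_conv_le hf hf) h.1
  refine ⟨hs, (Summable.tsum_le_tsum (norm_conv_le hf hf) hs h.1).trans ?_⟩
  rw [h.2, sq]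
  have h0 : 0 ≤ ∑' k, ‖f k‖ := tsum_nonneg fun _ => norm_nonneg _
  gcongr
  exact h0.trans hL

/-- `H^r`, `r ≥ 2`, is an algebra. -/
theorem conv_sobolev {f : ℤ × ℤ → ℂ} {r M : ℝ} (hr : 2 ≤ r) (hM : 0 ≤ M)
    (hf : Summable fun k => ((1 + normSq k) ^ (r / 2) * ‖f k‖) ^ 2)
    (hfM : ∑' k, ((1 + normSq k) ^ (r / 2) * ‖f k‖) ^ 2 ≤ M ^ 2) :
    (Summable fun k => ((1 + normSq k) ^ (r / 2) * ‖conv f f k‖) ^ 2) ∧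
      ∑' k, ((1 + normSq k) ^ (r / 2) * ‖conv f f k‖) ^ 2 ≤
        (2 * 2 ^ r * (wienerConst * M * M)) ^ 2 := by
  obtain ⟨hs, hsM⟩ := wiener_le_sobolev hr hM hf hfM
  set h : ℤ × ℤ → ℝ := fun k => (1 + normSq k) ^ (r / 2) * ‖f k‖ with hh
  have hw : ∀ k : ℤ × ℤ, 0 ≤ (1 + normSq k) ^ (r / 2) := fun k =>
    Real.rpow_nonneg (one_add_normSq_pos k).le _
  have hh0 : ∀ k, 0 ≤ h k := fun k => mul_nonneg (hw k) (norm_nonneg _)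
  obtain ⟨y1, y2, y3⟩ := young_conv_sq hh0 (fun _ => norm_nonneg _) hf hs hfM hsM
  -- The weight goes on either factor. Both choices give the same sum by `a ↦ k - a`, whence the
  -- `2`; Young's `ℓ¹ * ℓ² ⊆ ℓ²` finishes, the unweighted factor being in the Wiener algebra.
  have key : ∀ k, (1 + normSq k) ^ (r / 2) * ‖conv f f k‖ ≤
      2 * 2 ^ r * ∑' a, ‖f a‖ * h (k - a) := by
    intro k
    have y1' : Summable fun a => h a * ‖f (k - a)‖ := by
      refine ((Equiv.subLeft k).summable_iff.2 (y1 k)).congr fun a => ?_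
      simp [mul_comm]
    have hflip : ∑' a, h a * ‖f (k - a)‖ = ∑' a, ‖f a‖ * h (k - a) := by
      rw [← (Equiv.subLeft k).tsum_eq (fun a => ‖f a‖ * h (k - a))]
      simp [mul_comm]
    have hsum : Summable fun a => 2 ^ r * (h a * ‖f (k - a)‖ + ‖f a‖ * h (k - a)) :=
      (y1'.add (y1 k)).mul_left _
    have hterm : ∀ a, (1 + normSq k) ^ (r / 2) * (‖f a‖ * ‖f (k - a)‖) ≤
        2 ^ r * (h a * ‖f (k - a)‖ + ‖f a‖ * h (k - a)) := by
      intro a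
      have h1 := weight_add_le (by linarith : 0 ≤ r) a (k - a)
      rw [add_sub_cancel] at h1
      have h2 := mul_le_mul_of_nonneg_right h1
        (mul_nonneg (norm_nonneg (f a)) (norm_nonneg (f (k - a))))
      refine h2.trans (le_of_eq ?_)
      simp only [hh]; ring
    have hts : Summable fun a => (1 + normSq k) ^ (r / 2) * (‖f a‖ * ‖f (k - a)‖) :=
      hsum.of_nonneg_of_le (fun a => mul_nonneg (hw k) (by positivity)) hterm
    calc (1 + normSq k) ^ (r / 2) * ‖conv f f k‖
        ≤ (1 + normSq k) ^ (r / 2) * ∑' a, ‖f a‖ * ‖f (k - a)‖ :=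
          mul_le_mul_of_nonneg_left (norm_conv_le hs hs k) (hw k)
      _ = ∑' a, (1 + normSq k) ^ (r / 2) * (‖f a‖ * ‖f (k - a)‖) := tsum_mul_left.symm
      _ ≤ ∑' a, 2 ^ r * (h a * ‖f (k - a)‖ + ‖f a‖ * h (k - a)) :=
          Summable.tsum_le_tsum hterm hts hsum
      _ = 2 * 2 ^ r * ∑' a, ‖f a‖ * h (k - a) := by
          rw [tsum_mul_left, y1'.tsum_add (y1 k), hflip]; ring
  have key2 : ∀ k, ((1 + normSq k) ^ (r / 2) * ‖conv f f k‖) ^ 2 ≤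
      (2 * 2 ^ r) ^ 2 * (∑' a, ‖f a‖ * h (k - a)) ^ 2 := fun k => by
    rw [← mul_pow]
    exact pow_le_pow_left₀ (mul_nonneg (hw k) (norm_nonneg _)) (key k) 2
  have hS := y2.mul_left ((2 * 2 ^ r) ^ 2)
  have hS' := hS.of_nonneg_of_le (fun _ => sq_nonneg _) key2
  refine ⟨hS', (Summable.tsum_le_tsum key2 hS' hS).trans ?_⟩
  rw [tsum_mul_left, mul_pow _ (wienerConst * M * M)]
  gcongr

/-- The modulus of a nonzero frequency is dominated by its `α`-th power. -/
theorem abs_fst_le_rpow {α : ℝ} (hα : 1 ≤ α) {k : ℤ × ℤ} (hk : k.1 ≠ 0) :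
    |(k.1 : ℝ)| ≤ Real.sqrt (normSq k) ^ α ∧ |(k.2 : ℝ)| ≤ Real.sqrt (normSq k) ^ α ∧
      1 ≤ Real.sqrt (normSq k) ^ α := by
  have h1 : |(k.1 : ℝ)| ≤ Real.sqrt (normSq k) := Real.abs_le_sqrt (by
    unfold normSq; nlinarith [sq_nonneg (k.2 : ℝ)])
  have h2 : |(k.2 : ℝ)| ≤ Real.sqrt (normSq k) := Real.abs_le_sqrt (by
    unfold normSq; nlinarith [sq_nonneg (k.1 : ℝ)])
  have h3 : (1 : ℝ) ≤ |(k.1 : ℝ)| := by exact_mod_cast Int.one_le_abs hk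
  have h4 : Real.sqrt (normSq k) ≤ Real.sqrt (normSq k) ^ α :=
    Real.self_le_rpow_of_one_le (h3.trans h1) hα
  exact ⟨h1.trans h4, h2.trans h4, h3.trans (h1.trans h4)⟩

/-- Dispersive smoothing: the equation controls `(-Δ)^{α/2} u` off the line `k₁ = 0`. -/
theorem smoothing_le (α : ℝ) (c : ℤ × ℤ → ℂ) {k : ℤ × ℤ} (hk : k.1 ≠ 0) :
    Real.sqrt (normSq k) ^ α * ‖c k‖ ≤ ‖rhs α c k‖ + ‖conv c c k‖ / 2 := by
  have h3 : (1 : ℝ) ≤ |(k.1 : ℝ)| := by exact_mod_cast Int.one_le_abs hk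
  -- All terms but `rhs` carry the factor `k₁`; dividing by `|k₁| ≥ 1` removes the derivative from
  -- the nonlinearity and only improves the bound for `rhs`.
  have e : I * k.1 * ((Real.sqrt (normSq k) ^ α : ℝ) : ℂ) * c k =
      rhs α c k + I * k.1 / 2 * conv c c k := by unfold rhs; ring
  have h := congrArg norm e
  have h1 := norm_add_le (rhs α c k) (I * k.1 / 2 * conv c c k)
  rw [← h] at h1
  have hs : 0 ≤ Real.sqrt (normSq k) ^ α := Real.rpow_nonneg (Real.sqrt_nonneg _) _
  simp only [norm_mul, norm_div, Complex.norm_I, Complex.norm_intCast, one_mul, Complex.norm_real,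
    Real.norm_of_nonneg hs, Complex.norm_ofNat] at h1
  have h4 : |(k.1 : ℝ)| * (Real.sqrt (normSq k) ^ α * ‖c k‖) ≤
      |(k.1 : ℝ)| * (‖rhs α c k‖ + ‖conv c c k‖ / 2) := by
    nlinarith [norm_nonneg (rhs α c k)]
  exact le_of_mul_le_mul_left h4 (by linarith)

theorem abs_fst_mul_le {α : ℝ} (hα : 1 ≤ α) (c : ℤ × ℤ → ℂ) (k : ℤ × ℤ) :
    |(k.1 : ℝ)| * ‖c k‖ ≤ ‖rhs α c k‖ + ‖conv c c k‖ / 2 := by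
  by_cases hk : k.1 = 0
  · simp only [hk, Int.cast_zero, abs_zero, zero_mul]; positivity
  · exact (mul_le_mul_of_nonneg_right (abs_fst_le_rpow hα hk).1 (norm_nonneg _)).trans
      (smoothing_le α c hk)

/-- Bounds in `H^r` for a solution and its time derivative. -/
structure SobolevBound (α r M : ℝ) (c : ℤ × ℤ → ℂ) : Prop where
  summable : Summable fun k => ((1 + normSq k) ^ (r / 2) * ‖c k‖) ^ 2
  le : ∑' k, ((1 + normSq k) ^ (r / 2) * ‖c k‖) ^ 2 ≤ M ^ 2
  summable_rhs : Summable fun k => ((1 + normSq k) ^ (r / 2) * ‖rhs α c k‖) ^ 2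
  rhs_le : ∑' k, ((1 + normSq k) ^ (r / 2) * ‖rhs α c k‖) ^ 2 ≤ M ^ 2

section

variable {α r M : ℝ} {c : ℤ × ℤ → ℂ}

/-- The right-hand side of the smoothing estimate is in the Wiener algebra. -/
theorem SobolevBound.smoothing_wiener (h : SobolevBound α r M c) (hr : 2 ≤ r) (hM : 0 ≤ M) :
    (Summable fun k => ‖rhs α c k‖ + ‖conv c c k‖ / 2) ∧
      ∑' k, (‖rhs α c k‖ + ‖conv c c k‖ / 2) ≤
        wienerConst * M + (wienerConst * M) ^ 2 / 2 := by
  obtain ⟨s1, l1⟩ := wiener_le_sobolev hr hM h.summable h.le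
  obtain ⟨s2, l2⟩ := wiener_le_sobolev hr hM h.summable_rhs h.rhs_le
  obtain ⟨s3, l3⟩ := conv_wiener s1 l1
  refine ⟨s2.add (s3.div_const 2), ?_⟩
  rw [s2.tsum_add (s3.div_const 2), tsum_div_const]
  linarith

/-- Supplies the constant `L1` of the energy estimate: smoothing replaces the derivative by
quantities already in the Wiener algebra. -/
theorem SobolevBound.wiener_fst (h : SobolevBound α r M c) (hα : 1 ≤ α) (hr : 2 ≤ r)
    (hM : 0 ≤ M) : (Summable fun k : ℤ × ℤ => |(k.1 : ℝ)| * ‖c k‖) ∧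
      ∑' k : ℤ × ℤ, |(k.1 : ℝ)| * ‖c k‖ ≤ wienerConst * M + (wienerConst * M) ^ 2 / 2 := by
  obtain ⟨s, l⟩ := h.smoothing_wiener hr hM
  have s' := s.of_nonneg_of_le (fun k => by positivity) (abs_fst_mul_le hα c)
  exact ⟨s', (Summable.tsum_le_tsum (abs_fst_mul_le hα c) s' s).trans l⟩

/-- The constant in the truncation estimate. -/
def tailConst (r M : ℝ) : ℝ := 2 * (M + 2 ^ r * (wienerConst * M * M))

theorem le_tailConst (hM : 0 ≤ M) : M ≤ tailConst r M := by
  have : 0 ≤ 2 ^ r * (wienerConst * M * M) := by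
    have := wienerConst_nonneg
    positivity
  unfold tailConst
  linarith

/-- Smoothing gains the derivative back: `∂₁u` has the same Sobolev index `r` as `u`. This is why
the rate is `N^{-r}` and not `N^{1-r}`. -/
theorem SobolevBound.sobolev_fst (h : SobolevBound α r M c) (hα : 1 ≤ α) (hr : 2 ≤ r)
    (hM : 0 ≤ M) :
    (Summable fun k : ℤ × ℤ => ((1 + normSq k) ^ (r / 2) * (|(k.1 : ℝ)| * ‖c k‖)) ^ 2) ∧
      ∑' k : ℤ × ℤ, ((1 + normSq k) ^ (r / 2) * (|(k.1 : ℝ)| * ‖c k‖)) ^ 2 ≤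
        tailConst r M ^ 2 := by
  obtain ⟨s3, l3⟩ := conv_sobolev hr hM h.summable h.le
  have hle : ∀ k : ℤ × ℤ, ((1 + normSq k) ^ (r / 2) * (|(k.1 : ℝ)| * ‖c k‖)) ^ 2 ≤
      2 * ((1 + normSq k) ^ (r / 2) * ‖rhs α c k‖) ^ 2 +
        (1 / 2) * ((1 + normSq k) ^ (r / 2) * ‖conv c c k‖) ^ 2 := by
    intro k
    have hw : 0 ≤ (1 + normSq k) ^ (r / 2) := Real.rpow_nonneg (one_add_normSq_pos k).le _
    have h1 := mul_le_mul_of_nonneg_left (abs_fst_mul_le hα c k) hw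
    have h2 : 0 ≤ (1 + normSq k) ^ (r / 2) * (|(k.1 : ℝ)| * ‖c k‖) := by positivity
    have h3 := pow_le_pow_left₀ h2 h1 2
    refine h3.trans ?_
    nlinarith [sq_nonneg ((1 + normSq k) ^ (r / 2) * ‖rhs α c k‖ -
      (1 + normSq k) ^ (r / 2) * ‖conv c c k‖ / 2)]
  have s := (h.summable_rhs.mul_left 2).add (s3.mul_left (1 / 2))
  have s' := s.of_nonneg_of_le (fun k => sq_nonneg _) hle
  refine ⟨s', (Summable.tsum_le_tsum hle s' s).trans ?_⟩
  rw [(h.summable_rhs.mul_left 2).tsum_add (s3.mul_left (1 / 2)), tsum_mul_left, tsum_mul_left]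
  have h1 := h.rhs_le
  have hp : 0 ≤ 2 ^ r * (wienerConst * M * M) := by
    have := wienerConst_nonneg
    positivity
  unfold tailConst
  nlinarith [mul_nonneg hM hp]

end

/-! ### Tails and the algebraic rate for coefficients -/

/-- Decay of the tail of an `H^r` sequence. -/
theorem tail_le_of_sobolev {c : ℤ × ℤ → ℂ} {m : ℤ × ℤ → ℝ} {r M : ℝ} (hr : 0 ≤ r)
    (hm : ∀ k, 0 ≤ m k) {N : ℕ} (hN : 1 ≤ N)
    (hs : Summable fun k => ((1 + normSq k) ^ (r / 2) * (m k * ‖c k‖)) ^ 2)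
    (hle : ∑' k, ((1 + normSq k) ^ (r / 2) * (m k * ‖c k‖)) ^ 2 ≤ M ^ 2) :
    (Summable fun k => (m k * ‖c k - trunc N c k‖) ^ 2) ∧
      ∑' k, (m k * ‖c k - trunc N c k‖) ^ 2 ≤ (M * (N : ℝ) ^ (-r)) ^ 2 := by
  have hN0 : (0 : ℝ) < N := by exact_mod_cast hN
  have key : ∀ k, (m k * ‖c k - trunc N c k‖) ^ 2 ≤
      ((N : ℝ) ^ (-r)) ^ 2 * ((1 + normSq k) ^ (r / 2) * (m k * ‖c k‖)) ^ 2 := by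
    intro k
    by_cases hk : k ∈ box N
    · simp only [trunc, hk, if_true, sub_self, norm_zero, mul_zero, zero_pow two_ne_zero]; positivity
    · rw [trunc_of_notMem c hk, sub_zero, ← mul_pow]
      refine pow_le_pow_left₀ (mul_nonneg (hm k) (norm_nonneg _)) ?_ 2
      rw [← mul_assoc]
      refine le_mul_of_one_le_left (mul_nonneg (hm k) (norm_nonneg _)) ?_
      -- Outside the box one component exceeds `N` in modulus, so the Sobolev weight is at least
      -- `N^r`.
      rw [Real.rpow_neg hN0.le, ← div_eq_inv_mul, one_le_div (Real.rpow_pos_of_pos hN0 _)]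
      have h2 : (N : ℝ) ^ r = ((N : ℝ) ^ 2) ^ (r / 2) := by
        rw [← Real.rpow_natCast, ← Real.rpow_mul hN0.le]; congr 1; push_cast; ring
      rw [h2]
      refine Real.rpow_le_rpow (by positivity) ?_ (by linarith)
      rw [mem_box, not_le, lt_max_iff] at hk
      have : ∀ n : ℤ, (N : ℤ) < |n| → (N : ℝ) ^ 2 ≤ (n : ℝ) ^ 2 := by
        intro n hn
        rw [← sq_abs (n : ℝ)]
        have : (N : ℝ) < |(n : ℝ)| := by exact_mod_cast hn
        gcongr
      unfold normSq
      rcases hk with h | h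
      · nlinarith [this _ h, sq_nonneg (k.2 : ℝ)]
      · nlinarith [this _ h, sq_nonneg (k.1 : ℝ)]
  have hs2 := hs.mul_left (((N : ℝ) ^ (-r)) ^ 2)
  have hs' := hs2.of_nonneg_of_le (fun _ => sq_nonneg _) key
  refine ⟨hs', (Summable.tsum_le_tsum key hs' hs2).trans ?_⟩
  rw [tsum_mul_left, mul_pow M, mul_comm]
  gcongr

/-- The algebraic rate of convergence in Fourier coefficients. -/
theorem CoeffSolution.algebraic_rate {α r T M : ℝ} (hα : 1 ≤ α) (hr : 2 ≤ r) (hM : 0 ≤ M) :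
    ∃ C : ℝ, 0 < C ∧ ∀ c : ℝ → ℤ × ℤ → ℂ, CoeffSolution α T c →
      (∀ t ∈ Ioo 0 T, SobolevBound α r M (c t)) → ∀ (N : ℕ) (b : ℝ → ℤ × ℤ → ℂ), 1 ≤ N →
      CoeffGalerkin α T N (c 0) b → ∀ t ∈ Icc 0 T,
      ∑ k ∈ box N, ‖c t k - b t k‖ ^ 2 ≤ (C * (N : ℝ) ^ (-r)) ^ 2 := by
  set A := wienerConst * M + 2 * (wienerConst * M + (wienerConst * M) ^ 2 / 2) with hA
  have hA0 : 0 ≤ A := by have := wienerConst_nonneg; positivity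
  have hD : 0 ≤ tailConst r M := hM.trans (le_tailConst hM)
  refine ⟨(tailConst r M + 1) * Real.exp (A * T), by positivity, ?_⟩
  intro c hc hbd N b hN hb t ht
  have hT : 0 ≤ T := ht.1.trans ht.2
  have hN0 : (0 : ℝ) < N := by exact_mod_cast hN
  have hNr : 0 < (N : ℝ) ^ (-r) := Real.rpow_pos_of_pos hN0 _
  have key := hc.error_le (L0 := wienerConst * M)
    (L1 := wienerConst * M + (wienerConst * M) ^ 2 / 2) (ε := tailConst r M * (N : ℝ) ^ (-r))
    (by positivity) hb (hb.hermitian (hc.hermitian 0 ⟨le_rfl, hT⟩))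
    (fun s hs => wiener_le_sobolev hr hM (hbd s hs).summable (hbd s hs).le)
    (fun s hs => (hbd s hs).wiener_fst hα hr hM)
    (fun s hs => by
      have := tail_le_of_sobolev (c := c s) (m := 1) (r := r) (M := tailConst r M) (by linarith)
        (fun _ => zero_le_one) hN (by simpa using (hbd s hs).summable)
        (by
          simp only [Pi.one_apply, one_mul]
          exact (hbd s hs).le.trans (pow_le_pow_left₀ hM (le_tailConst hM) 2))
      simpa only [Pi.one_apply, one_mul] using this)
    (fun s hs => tail_le_of_sobolev (m := fun k : ℤ × ℤ => |(k.1 : ℝ)|) (by linarith)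
      (fun _ => abs_nonneg _) hN ((hbd s hs).sobolev_fst hα hr hM).1
      ((hbd s hs).sobolev_fst hα hr hM).2) t ht
  refine key.trans ?_
  rw [← hA]
  have h1 : Real.exp (A * t) ≤ Real.exp (A * T) ^ 2 := by
    rw [← Real.exp_nat_mul]
    apply Real.exp_le_exp.2
    push_cast
    nlinarith [mul_le_mul_of_nonneg_left ht.2 hA0, mul_nonneg hA0 hT]
  calc (tailConst r M * (N : ℝ) ^ (-r)) ^ 2 * Real.exp (A * t)
      ≤ ((tailConst r M + 1) * (N : ℝ) ^ (-r)) ^ 2 * Real.exp (A * T) ^ 2 := by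
        gcongr
        linarith
    _ = _ := by ring

/-! ### From functions to coefficients, and the algebraic rate -/

theorem pairing_expL2 (f : ℝ × ℝ → ℂ) (k : ℤ × ℤ) :
    pairing f (expL2 k) = (((2 * Real.pi) ^ 2 : ℝ) : ℂ) * coeff f k := by
  unfold pairing coeff
  rw [← mul_assoc, ← Complex.ofReal_mul, mul_inv_cancel₀ (by have := Real.pi_pos; positivity),
    Complex.ofReal_one, one_mul]
  apply integral_congr_ae
  filter_upwards [coeFn_expL2 k] with x hx
  rw [hx, conj_expFun]

theorem pairing_smul (f : ℝ × ℝ → ℂ) (z : ℂ) (g : L2per) :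
    pairing f (z • g : L2per) = (starRingEnd ℂ) z * pairing f g := by
  unfold pairing
  rw [← integral_const_mul]
  apply integral_congr_ae
  filter_upwards [Lp.coeFn_smul z g] with x hx
  rw [hx, Pi.smul_apply, smul_eq_mul, map_mul]
  ring

theorem partialX1_expL2 (k : ℤ × ℤ) : partialX1 (expL2 k) = (I * (k.1 : ℂ)) • expL2 k := by
  unfold partialX1
  rw [tsum_eq_single k]
  · rw [coeff_expL2, if_pos rfl, mul_one]
  · intro j hj
    rw [coeff_expL2, if_neg (Ne.symm hj), mul_zero, zero_smul]

theorem coeff_fracLap {α : ℝ} {f : L2per}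
    (hf : Summable fun k => ‖((Real.sqrt (normSq k) ^ α : ℝ) : ℂ) * coeff f k‖ ^ 2) (k : ℤ × ℤ) :
    coeff (fracLap α f) k = ((Real.sqrt (normSq k) ^ α : ℝ) : ℂ) * coeff f k :=
  coeff_tsum_smul_expL2 hf k

theorem coeff_partialX1 {f : L2per}
    (hf : Summable fun k : ℤ × ℤ => ‖I * (k.1 : ℂ) * coeff f k‖ ^ 2) (k : ℤ × ℤ) :
    coeff (partialX1 f) k = I * (k.1 : ℂ) * coeff f k :=
  coeff_tsum_smul_expL2 hf k

theorem coeff_eq_zero_of_mem_trigSpace {N : ℕ} {f : L2per} (hf : f ∈ trigSpace N) {k : ℤ × ℤ}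
    (hk : k ∉ box N) : coeff f k = 0 := by
  rw [← coeffCLM_apply]
  induction hf using Submodule.span_induction with
  | mem x hx =>
    obtain ⟨j, hj, rfl⟩ := hx
    rw [coeffCLM_apply, coeff_expL2, if_neg]
    rintro rfl
    exact hk (mem_box.2 hj)
  | zero => simp
  | add x y _ _ hx hy => rw [map_add, hx, hy, add_zero]
  | smul z x _ hx => rw [map_smul, hx, smul_zero]

theorem expL2_mem_trigSpace {N : ℕ} {k : ℤ × ℤ} (hk : k ∈ box N) : expL2 k ∈ trigSpace N :=
  Submodule.subset_span ⟨k, mem_box.1 hk, rfl⟩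

theorem coeff_sq (f : L2per) (k : ℤ × ℤ) :
    coeff (fun x => f x ^ 2) k = conv (coeff f) (coeff f) k := by
  simp only [sq]
  exact (coeff_mul f f k).tsum_eq.symm

theorem hasDerivWithinAt_coeff {u : ℝ → L2per} {ut : L2per} {s : Set ℝ} {t : ℝ}
    (h : HasDerivWithinAt u ut s t) (k : ℤ × ℤ) :
    HasDerivWithinAt (fun s => coeff (u s) k) (coeff ut k) s t := by
  have h2 := ((coeffCLM k).restrictScalars ℝ).hasFDerivAt.comp_hasDerivWithinAt t h
  simp only [ContinuousLinearMap.coe_restrictScalars', coeffCLM_apply] at h2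
  refine h2.congr_of_eventuallyEq ?_ ?_
  · exact Filter.Eventually.of_forall fun s => (coeffCLM_apply k (u s)).symm
  · exact (coeffCLM_apply k (u t)).symm

theorem IsGalerkin.coeffGalerkin {α T : ℝ} {N : ℕ} {u₀ : L2per} {uN : ℝ → L2per}
    (h : IsGalerkin α T N u₀ uN) : CoeffGalerkin α T N (coeff u₀) fun t => coeff (uN t) where
  support t ht k hk := coeff_eq_zero_of_mem_trigSpace (h.mem t ht) hk
  initial k hk := by
    have := h.initial _ (expL2_mem_trigSpace hk)
    rw [pairing_expL2, pairing_expL2] at this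
    exact mul_left_cancel₀ two_pi_sq_ne_zero this
  hasDerivWithinAt t ht k hk := by
    obtain ⟨ut, hd, hut⟩ := h.scheme t ht
    have h1 := hut _ (expL2_mem_trigSpace hk)
    have hfin : (coeff (uN t)).support.Finite :=
      support_finite_of_box fun k hk => coeff_eq_zero_of_mem_trigSpace (h.mem t ht) hk
    have hs : Summable fun k => ‖((Real.sqrt (normSq k) ^ α : ℝ) : ℂ) * coeff (uN t) k‖ ^ 2 :=
      summable_of_hasFiniteSupport (hfin.subset fun k hk => by
        simp only [Function.mem_support, ne_eq] at hk ⊢; intro h; simp [h] at hk)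
    rw [partialX1_expL2, pairing_smul, pairing_smul, pairing_expL2, pairing_expL2, pairing_expL2,
      coeff_fracLap hs, coeff_sq] at h1
    refine (hasDerivWithinAt_coeff hd k).congr_deriv ?_
    have h2 := two_pi_sq_ne_zero
    apply mul_left_cancel₀ h2
    simp only [map_mul, Complex.conj_I, map_intCast] at h1
    unfold rhs
    linear_combination h1

theorem hermitian_coeff {f : L2per} (hf : ∀ᵐ x ∂cellMeasure, (f x).im = 0) :
    Hermitian (coeff f) := by
  intro k
  unfold coeff
  rw [map_mul, Complex.conj_ofReal, ← integral_conj]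
  congr 1
  apply integral_congr_ae
  filter_upwards [hf] with x hx
  rw [map_mul, conj_expFun, Complex.conj_eq_iff_im.2 hx]

theorem summable_sq_of_sobolev {s : ℝ} {f : L2per} (hf : MemHper s f) {m : ℤ × ℤ → ℂ}
    (hm : ∀ k, ‖m k‖ ^ 2 ≤ (1 + normSq k) ^ s) : Summable fun k => ‖m k * coeff f k‖ ^ 2 :=
  Summable.of_nonneg_of_le (fun _ => sq_nonneg _) (fun k => by
    rw [norm_mul, mul_pow]
    exact mul_le_mul_of_nonneg_right (hm k) (sq_nonneg _)) hf

/-- The nonlinearity is brought to the conservative form `½ ∂₁(u²)` on the Fourier side: the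
convolution of `u` with `∂₁u` is averaged with its reflection `a ↦ k - a`, and `a₁ + (k - a)₁ = k₁`.
-/
theorem IsSolution.coeff_equation {α T : ℝ} (hα : 1 ≤ α) {u₀ : L2per} {u : ℝ → L2per}
    (h : IsSolution α T u₀ u) {t : ℝ} (ht : t ∈ Icc 0 T) {ut : L2per}
    (hut : ∀ᵐ x ∂cellMeasure,
        ut x - partialX1 (fracLap α (u t)) x + u t x * partialX1 (u t) x = 0) (k : ℤ × ℤ) :
    coeff ut k = rhs α (coeff (u t)) k := by
  set c := coeff (u t) with hc
  have hreg := h.regular t ht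
  have hb : ∀ k : ℤ × ℤ, 1 ≤ 1 + normSq k := fun k => by linarith [normSq_nonneg k]
  have hk1 : ∀ k : ℤ × ℤ, ‖I * (k.1 : ℂ)‖ ^ 2 ≤ 1 + normSq k := fun k => by
    simp only [norm_mul, Complex.norm_I, Complex.norm_intCast, one_mul, sq_abs]
    unfold normSq; nlinarith [sq_nonneg (k.2 : ℝ)]
  have hkα : ∀ k : ℤ × ℤ, ‖((Real.sqrt (normSq k) ^ α : ℝ) : ℂ)‖ ^ 2 ≤ (1 + normSq k) ^ α :=
    fun k => by
      have h0 : 0 ≤ Real.sqrt (normSq k) ^ α := Real.rpow_nonneg (Real.sqrt_nonneg _) _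
      rw [Complex.norm_real, Real.norm_of_nonneg h0, ← Real.rpow_natCast,
        ← Real.rpow_mul (Real.sqrt_nonneg _), mul_comm, Real.rpow_mul (Real.sqrt_nonneg _)]
      refine Real.rpow_le_rpow (by positivity) ?_ (by linarith)
      rw [Nat.cast_ofNat, Real.rpow_two, Real.sq_sqrt (normSq_nonneg k)]
      linarith
  -- The series defining `fracLap` and `partialX1` would have the default value `0` if they
  -- diverged; membership in `H^{1+α}` ensures that they, and their composite, converge.
  have s1 : Summable fun k => ‖((Real.sqrt (normSq k) ^ α : ℝ) : ℂ) * coeff (u t) k‖ ^ 2 :=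
    summable_sq_of_sobolev hreg fun k => (hkα k).trans
      (Real.rpow_le_rpow_of_exponent_le (hb k) (by linarith))
  have s2 : Summable fun k : ℤ × ℤ => ‖I * (k.1 : ℂ) * coeff (u t) k‖ ^ 2 :=
    summable_sq_of_sobolev hreg fun k => (hk1 k).trans
      (Real.self_le_rpow_of_one_le (hb k) (by linarith))
  have s3 : Summable fun k : ℤ × ℤ => ‖I * (k.1 : ℂ) * coeff (fracLap α (u t)) k‖ ^ 2 := by
    simp only [coeff_fracLap s1, ← mul_assoc]
    refine summable_sq_of_sobolev hreg fun k => ?_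
    rw [norm_mul, mul_pow, Real.rpow_add (one_add_normSq_pos k), Real.rpow_one]
    exact mul_le_mul (hk1 k) (hkα k) (sq_nonneg _) (one_add_normSq_pos k).le
  have e1 : coeff ut k = coeff (partialX1 (fracLap α (u t))) k
      - coeff (fun x => u t x * partialX1 (u t) x) k := by
    have hint : Integrable (fun x => u t x * partialX1 (u t) x * expFun (-k) x) cellMeasure := by
      have h1 : Integrable (fun x => u t x * partialX1 (u t) x) cellMeasure :=
        (Lp.memLp (u t)).integrable_mul (Lp.memLp (partialX1 (u t)))
      refine h1.mul_bdd (c := 1) (continuous_expFun (-k)).aestronglyMeasurable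
        (Filter.Eventually.of_forall fun x => ?_)
      rw [expFun, mul_comm I, Complex.norm_exp_ofReal_mul_I]
    have hint2 : Integrable (fun x => partialX1 (fracLap α (u t)) x * expFun (-k) x) cellMeasure :=
      (Lp.memLp (partialX1 (fracLap α (u t)))).integrable_mul (memLp_expFun (-k))
    unfold coeff
    rw [← mul_sub, ← integral_sub hint2 hint]
    congr 1
    apply integral_congr_ae
    filter_upwards [hut] with x hx
    linear_combination (expFun (-k) x) * hx
  have hmul := coeff_mul (u t) (partialX1 (u t)) k
  simp only [coeff_partialX1 s2] at hmul
  have hmul2 : HasSum (fun a : ℤ × ℤ => I * (a.1 : ℂ) * coeff (u t) a * coeff (u t) (k - a))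
      (coeff (fun x => u t x * partialX1 (u t) x) k) := by
    have := ((Equiv.subLeft k).hasSum_iff).2 hmul
    refine this.congr_fun fun a => ?_
    simp [mul_comm, mul_left_comm]
  have hconv := (coeff_mul (u t) (u t) k).summable
  have e2 : 2 * coeff (fun x => u t x * partialX1 (u t) x) k = I * k.1 * conv c c k := by
    rw [two_mul, conv, ← tsum_mul_left]
    refine ((hmul.add hmul2).congr_fun fun a => ?_).tsum_eq.symm
    simp only [Prod.fst_sub, hc]
    push_cast
    ring
  rw [e1, coeff_partialX1 s3, coeff_fracLap s1]
  unfold rhs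
  linear_combination (-1 / 2) * e2

theorem IsSolution.coeffSolution {α T : ℝ} (hα : 1 ≤ α) {u₀ : L2per}
    {u : ℝ → L2per} (h : IsSolution α T u₀ u) {r : ℝ} {U : ℝ → lp (fun _ : ℤ × ℤ => ℂ) 2}
    (hU : IsC1Hper r T u U) : CoeffSolution α T fun t => coeff (u t) where
  hermitian t ht := hermitian_coeff (h.real_valued t ht)
  -- The equation is assumed for `t > 0` only, so continuity at `0` comes from the curve `U`.
  continuousOn k := by
    have h1 : ContinuousOn (fun t => U t k) (Icc 0 T) :=
      ((lp.evalCLM ℂ (fun _ : ℤ × ℤ => ℂ) 2 k).continuous.comp_continuousOn hU.1.continuousOn)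
    have hw : (((1 + normSq k) ^ (r / 2) : ℝ) : ℂ) ≠ 0 := by
      exact_mod_cast (Real.rpow_pos_of_pos (one_add_normSq_pos k) _).ne'
    refine (h1.div_const (((1 + normSq k) ^ (r / 2) : ℝ) : ℂ)).congr fun t ht => ?_
    change coeff (u t) k = U t k / _
    rw [hU.2 t ht k, mul_div_cancel_left₀ _ hw]
  hasDerivAt t ht k := by
    obtain ⟨ut, hd, hut⟩ := h.equation t (Ioo_subset_Ioc_self ht)
    have h1 := (hasDerivWithinAt_coeff hd k).hasDerivAt (Icc_mem_nhds ht.1 ht.2)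
    rwa [h.coeff_equation hα (Ioo_subset_Icc_self ht) hut k] at h1

theorem lp_two_hasSum (v : lp (fun _ : ℤ × ℤ => ℂ) 2) : HasSum (fun k => ‖v k‖ ^ 2) (‖v‖ ^ 2) := by
  have := lp.hasSum_norm (p := 2) (by norm_num) v
  simpa using this

theorem IsC1Hper.sobolev {r T M : ℝ} {u : ℝ → L2per}
    {U : ℝ → lp (fun _ : ℤ × ℤ => ℂ) 2} (hU : IsC1Hper r T u U) {t : ℝ} (ht : t ∈ Icc 0 T)
    (hM : ‖U t‖ ≤ M) :
    (Summable fun k => ((1 + normSq k) ^ (r / 2) * ‖coeff (u t) k‖) ^ 2) ∧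
      ∑' k, ((1 + normSq k) ^ (r / 2) * ‖coeff (u t) k‖) ^ 2 ≤ M ^ 2 := by
  have h := lp_two_hasSum (U t)
  have e : ∀ k : ℤ × ℤ, ‖U t k‖ ^ 2 = ((1 + normSq k) ^ (r / 2) * ‖coeff (u t) k‖) ^ 2 := by
    intro k
    rw [hU.2 t ht k, norm_mul, Complex.norm_real,
      Real.norm_of_nonneg (Real.rpow_nonneg (one_add_normSq_pos k).le _)]
  simp only [e] at h
  exact ⟨h.summable, h.tsum_eq ▸ pow_le_pow_left₀ (norm_nonneg _) hM 2⟩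

/-- Uniqueness of derivatives identifies the entries of `U'` with the weighted entries of `rhs`. So
the assumed bound on `∂ₜu` in `H^r` becomes the bound on `rhs` that smoothing requires. -/
theorem IsC1Hper.sobolevBound {α r T M : ℝ} {u : ℝ → L2per}
    {U : ℝ → lp (fun _ : ℤ × ℤ => ℂ) 2} (hU : IsC1Hper r T u U)
    (hc : CoeffSolution α T fun t => coeff (u t)) {t : ℝ} (ht : t ∈ Ioo 0 T)
    (hM : ‖U t‖ ≤ M) (hM' : ‖derivWithin U (Icc 0 T) t‖ ≤ M) :
    SobolevBound α r M (coeff (u t)) := by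
  have ht' := Ioo_subset_Icc_self ht
  obtain ⟨h1, h2⟩ := hU.sobolev ht' hM
  have h := lp_two_hasSum (derivWithin U (Icc 0 T) t)
  have e : ∀ k : ℤ × ℤ, ‖derivWithin U (Icc 0 T) t k‖ ^ 2 =
      ((1 + normSq k) ^ (r / 2) * ‖rhs α (coeff (u t)) k‖) ^ 2 := by
    intro k
    have hnhds := Icc_mem_nhds ht.1 ht.2
    have hd : HasDerivAt U (derivWithin U (Icc 0 T) t) t :=
      ((hU.1.differentiableOn one_ne_zero t ht').hasDerivWithinAt).hasDerivAt hnhds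
    have hd1 : HasDerivAt (fun s => U s k) (derivWithin U (Icc 0 T) t k) t :=
      ((lp.evalCLM ℂ (fun _ : ℤ × ℤ => ℂ) 2 k).restrictScalars ℝ).hasFDerivAt.comp_hasDerivAt t hd
    have hd2 : HasDerivAt (fun s => U s k)
        ((((1 + normSq k) ^ (r / 2) : ℝ) : ℂ) * rhs α (coeff (u t)) k) t := by
      refine ((hc.hasDerivAt t ht k).const_mul _).congr_of_eventuallyEq ?_
      filter_upwards [hnhds] with s hs using hU.2 s hs k
    rw [hd1.unique hd2, norm_mul, Complex.norm_real,
      Real.norm_of_nonneg (Real.rpow_nonneg (one_add_normSq_pos k).le _)]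
  simp only [e] at h
  exact ⟨h1, h2, h.summable, h.tsum_eq ▸ pow_le_pow_left₀ (norm_nonneg _) hM' 2⟩

/-- The error in `L²` in terms of the Fourier coefficients. -/
theorem norm_sub_le_of_coeff {N : ℕ} {f g : L2per} (hg : ∀ k ∉ box N, coeff g k = 0) {A B : ℝ}
    (hA : 0 ≤ A) (hB : 0 ≤ B) (h1 : ∑ k ∈ box N, ‖coeff f k - coeff g k‖ ^ 2 ≤ A ^ 2)
    (h2 : ∑' k, ‖coeff f k - trunc N (coeff f) k‖ ^ 2 ≤ B ^ 2) :
    ‖f - g‖ ≤ 2 * Real.pi * (A + B) := by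
  have hP := hasSum_norm_coeff_sq (f - g)
  have hsub : ∀ k, coeff (f - g : L2per) k = coeff f k - coeff g k := fun k => by
    simp only [← coeffCLM_apply, map_sub]
  simp only [hsub] at hP
  have hf : Summable fun k => ‖coeff f k - trunc N (coeff f) k‖ ^ 2 := by
    refine (hasSum_norm_coeff_sq f).summable.of_nonneg_of_le (fun _ => sq_nonneg _) fun k => ?_
    unfold trunc
    split_ifs <;> simp
  have hfin : Summable fun k => if k ∈ box N then ‖coeff f k - coeff g k‖ ^ 2 else 0 :=
    summable_of_ne_finset_zero (s := box N) fun k hk => if_neg hk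
  have e : ∀ k, ‖coeff f k - coeff g k‖ ^ 2 =
      (if k ∈ box N then ‖coeff f k - coeff g k‖ ^ 2 else 0) +
        ‖coeff f k - trunc N (coeff f) k‖ ^ 2 := by
    intro k
    by_cases hk : k ∈ box N
    · simp [trunc, hk]
    · simp [trunc, hk, hg k hk]
  have h3 : ((2 * Real.pi) ^ 2)⁻¹ * ‖f - g‖ ^ 2 ≤ A ^ 2 + B ^ 2 := by
    rw [← hP.tsum_eq, tsum_congr e, hfin.tsum_add hf, tsum_eq_sum (s := box N) fun k hk => if_neg hk]
    refine add_le_add (le_trans (le_of_eq ?_) h1) h2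
    exact Finset.sum_congr rfl fun k hk => if_pos hk
  have hpi := Real.pi_pos
  rw [inv_mul_le_iff₀ (by positivity)] at h3
  refine (sq_le_sq₀ (norm_nonneg _) (by positivity)).1 (h3.trans ?_)
  rw [mul_pow (2 * Real.pi)]
  gcongr
  nlinarith [mul_nonneg hA hB]

theorem algebraic_convergence (α r T : ℝ) (hα : 1 ≤ α) (hr : 2 ≤ r) (M : ℝ) :
    ∃ C : ℝ, 0 < C ∧
      ∀ (u₀ : L2per) (u : ℝ → L2per) (U : ℝ → lp (fun _ : ℤ × ℤ => ℂ) 2),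
        IsSolution α T u₀ u → IsC1Hper r T u U →
        (∀ t ∈ Icc 0 T, ‖U t‖ ≤ M ∧ ‖derivWithin U (Icc 0 T) t‖ ≤ M) →
        ∀ (N : ℕ) (uN : ℝ → L2per), 1 ≤ N → IsGalerkin α T N u₀ uN →
          ∀ t ∈ Ico 0 T, ‖u t - uN t‖ ≤ C * (N : ℝ) ^ (-r) := by
  -- The constant is chosen before any solution is given, and `M` may be negative; hence `|M|`.
  obtain ⟨C, hC, h⟩ := CoeffSolution.algebraic_rate (α := α) (r := r) (T := T) (M := |M|)
    hα hr (abs_nonneg M)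
  refine ⟨2 * Real.pi * (C + |M|), by have := Real.pi_pos; positivity, ?_⟩
  intro u₀ u U hu hU hM N uN hN huN t ht
  have ht' := Ico_subset_Icc_self ht
  have hc := hu.coeffSolution hα hU
  have hb := huN.coeffGalerkin
  rw [← hu.initial] at hb
  have hMb : ∀ t ∈ Icc 0 T, ‖U t‖ ≤ |M| ∧ ‖derivWithin U (Icc 0 T) t‖ ≤ |M| := fun t ht =>
    ⟨(hM t ht).1.trans (le_abs_self M), (hM t ht).2.trans (le_abs_self M)⟩
  have h1 := h _ hc (fun s hs => hU.sobolevBound hc hs (hMb s (Ioo_subset_Icc_self hs)).1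
    (hMb s (Ioo_subset_Icc_self hs)).2) N _ hN hb t ht'
  have h2 := hU.sobolev ht' (hMb t ht').1
  have h3 := tail_le_of_sobolev (c := coeff (u t)) (m := 1) (r := r) (M := |M|) (by linarith)
    (fun _ => zero_le_one) hN (by simpa using h2.1) (by simpa using h2.2)
  simp only [Pi.one_apply, one_mul] at h3
  have hN0 : (0 : ℝ) < N := by exact_mod_cast hN
  have hNr : 0 < (N : ℝ) ^ (-r) := Real.rpow_pos_of_pos hN0 _
  refine (norm_sub_le_of_coeff (hb.support t ht') (by positivity) (by positivity) h1 h3.2).trans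
    (le_of_eq ?_)
  ring

/-! ### Analytic weights and uniform analyticity of Galerkin solutions -/

/-- The weight `1 + |k₁| + |k₂|`. -/
def absWeight (k : ℤ × ℤ) : ℝ := 1 + |(k.1 : ℝ)| + |(k.2 : ℝ)|

theorem one_le_absWeight (k : ℤ × ℤ) : 1 ≤ absWeight k := by
  unfold absWeight; linarith [abs_nonneg (k.1 : ℝ), abs_nonneg (k.2 : ℝ)]

theorem absWeight_neg (k : ℤ × ℤ) : absWeight (-k) = absWeight k := by simp [absWeight]

/-- The extra `1` records that the weight of the zero frequency is `1`; its consequence `x ≤ z y` is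
needed in `gevrey_commutator`. -/
theorem absWeight_add_le (a b : ℤ × ℤ) : absWeight (a + b) + 1 ≤ absWeight a + absWeight b := by
  simp only [absWeight, Prod.fst_add, Prod.snd_add]
  push_cast
  linarith [abs_add_le (a.1 : ℝ) b.1, abs_add_le (a.2 : ℝ) b.2]

theorem absWeight_le_add (a b : ℤ × ℤ) : absWeight a + 1 ≤ absWeight (a + b) + absWeight b := by
  have := absWeight_add_le (a + b) (-b)
  rwa [add_neg_cancel_right, absWeight_neg] at this

/-- The analytic weight as a function of the modulus of the frequency. -/
def gevrey (σ x : ℝ) : ℝ := x ^ 4 * Real.exp (σ * x)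

theorem gevrey_nonneg (σ : ℝ) (x : ℝ) : 0 ≤ gevrey σ x := by unfold gevrey; positivity

theorem gevrey_sub_le {σ x y m : ℝ} (hσ : 0 ≤ σ) (hy : 0 ≤ y) (hyx : y ≤ x) (hxm : x ≤ m) :
    gevrey σ x - gevrey σ y ≤ (x - y) * (Real.exp (σ * m) * (4 * m ^ 3 + σ * m ^ 4)) := by
  have hx : 0 ≤ x := hy.trans hyx
  have hm : 0 ≤ m := hx.trans hxm
  have h1 : x ^ 4 - y ^ 4 ≤ (x - y) * (4 * x ^ 3) := by
    have : x ^ 4 - y ^ 4 = (x - y) * (x ^ 3 + x ^ 2 * y + x * y ^ 2 + y ^ 3) := by ring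
    rw [this]
    refine mul_le_mul_of_nonneg_left ?_ (by linarith)
    have e1 : x ^ 2 * y ≤ x ^ 2 * x := by gcongr
    have e2 : x * y ^ 2 ≤ x * x ^ 2 := by gcongr
    have e3 : y ^ 3 ≤ x ^ 3 := by gcongr
    nlinarith
  have h2 : Real.exp (σ * x) - Real.exp (σ * y) ≤ (x - y) * (σ * Real.exp (σ * x)) := by
    have h := Real.add_one_le_exp (σ * y - σ * x)
    rw [Real.exp_sub, le_div_iff₀ (Real.exp_pos _)] at h
    nlinarith
  have hE : Real.exp (σ * x) ≤ Real.exp (σ * m) := by gcongr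
  have hy4 : y ^ 4 ≤ x ^ 4 := by gcongr
  have hxy : 0 ≤ x - y := by linarith
  have hEx := Real.exp_pos (σ * x)
  calc gevrey σ x - gevrey σ y
      = (x ^ 4 - y ^ 4) * Real.exp (σ * x) + y ^ 4 * (Real.exp (σ * x) - Real.exp (σ * y)) := by
        unfold gevrey; ring
    _ ≤ (x - y) * (4 * x ^ 3) * Real.exp (σ * x) + y ^ 4 * ((x - y) * (σ * Real.exp (σ * x))) := by
        gcongr
    _ ≤ (x - y) * (4 * x ^ 3) * Real.exp (σ * x) + x ^ 4 * ((x - y) * (σ * Real.exp (σ * x))) := by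
        gcongr
    _ = (x - y) * (Real.exp (σ * x) * (4 * x ^ 3 + σ * x ^ 4)) := by ring
    _ ≤ _ := by gcongr

theorem gevrey_mono {σ x y : ℝ} (hσ : 0 ≤ σ) (hx : 0 ≤ x) (hxy : x ≤ y) :
    gevrey σ x ≤ gevrey σ y := by
  unfold gevrey; gcongr

theorem abs_gevrey_sub_le {σ x y m : ℝ} (hσ : 0 ≤ σ) (hx : 0 ≤ x) (hy : 0 ≤ y) (hxm : x ≤ m)
    (hym : y ≤ m) :
    |gevrey σ x - gevrey σ y| ≤ |x - y| * (Real.exp (σ * m) * (4 * m ^ 3 + σ * m ^ 4)) := by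
  rcases le_total y x with h | h
  · rw [abs_of_nonneg (sub_nonneg.2 (gevrey_mono hσ hy h)), abs_of_nonneg (sub_nonneg.2 h)]
    exact gevrey_sub_le hσ hy h hxm
  · rw [abs_sub_comm, abs_sub_comm x,
      abs_of_nonneg (sub_nonneg.2 (gevrey_mono hσ hx h)), abs_of_nonneg (sub_nonneg.2 h)]
    exact gevrey_sub_le hσ hx h hym

theorem exp_le_one_add {x : ℝ} : Real.exp x ≤ 1 + x * Real.exp x := by
  have h := Real.add_one_le_exp (-x)
  have := mul_le_mul_of_nonneg_right h (Real.exp_pos x).le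
  rw [← Real.exp_add, neg_add_cancel, Real.exp_zero] at this
  linarith

/-- The commutator estimate for the analytic weight. -/
theorem gevrey_commutator {σ x y z : ℝ} (hσ : 0 ≤ σ) (hx : 1 ≤ x) (hy : 1 ≤ y) (hz : 1 ≤ z)
    (h2 : x ≤ z + y - 1) (h3 : z ≤ x + y - 1) :
    x * |gevrey σ z - gevrey σ x| ≤ 48 * (y * gevrey σ x + x * gevrey σ y +
      σ * (y ^ 2 * Real.exp (σ * y) * (Real.sqrt x * Real.sqrt z) * gevrey σ x +
        x ^ 2 * Real.exp (σ * x) * (Real.sqrt y * Real.sqrt z) * gevrey σ y)) := by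
  have h1 : z ≤ x + y := by linarith
  have gx := gevrey_nonneg σ x
  have gy := gevrey_nonneg σ y
  have sx := Real.one_le_sqrt.2 hx
  have sy := Real.one_le_sqrt.2 hy
  have sz := Real.one_le_sqrt.2 hz
  have hP : 1 ≤ Real.sqrt x * Real.sqrt z := one_le_mul_of_one_le_of_one_le sx sz
  have hP' : 1 ≤ Real.sqrt y * Real.sqrt z := one_le_mul_of_one_le_of_one_le sy sz
  have hEx := Real.exp_pos (σ * x)
  have hEy := Real.exp_pos (σ * y)
  have ey : Real.exp (σ * y) ≤ 1 + σ * y * Real.exp (σ * y) := exp_le_one_add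
  have ex : Real.exp (σ * x) ≤ 1 + σ * x * Real.exp (σ * x) := exp_le_one_add
  have hsum : Real.exp (σ * (x + y)) = Real.exp (σ * x) * Real.exp (σ * y) := by
    rw [mul_add, Real.exp_add]
  -- For `y ≤ x` the difference is estimated by the mean value bound, gaining `y` in place of a
  -- derivative. For `x ≤ y` no cancellation is needed, as the prefactor `x` falls on the lower
  -- frequency. In both cases the exponential of the lower frequency is split by `e^s ≤ 1 + s e^s`,
  -- so a loss at high frequency always comes with a factor `σ`.
  rcases le_total y x with h | h
  · have hc := abs_gevrey_sub_le hσ (by linarith : 0 ≤ z) (by linarith : 0 ≤ x) h1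
      (by linarith : x ≤ x + y)
    have hd : |z - x| ≤ y := abs_le.2 ⟨by linarith, by linarith⟩
    have hm : x + y ≤ 2 * x := by linarith
    -- From `(z - 1)(y - 1) ≥ 0` and `h2`, `x ≤ z + y - 1 ≤ z y`. This shares the full power `x` as
    -- half a derivative on each of the two high-frequency factors.
    have hxP : x ≤ Real.sqrt x * Real.sqrt z * y := by
      have hxz : x ≤ z * y := by nlinarith
      have h4 : x ^ 2 ≤ (Real.sqrt x * Real.sqrt z * y) ^ 2 := by
        rw [mul_pow, mul_pow, Real.sq_sqrt (by linarith), Real.sq_sqrt (by linarith)]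
        have : x * x ≤ x * (z * y) := by gcongr
        nlinarith [mul_nonneg (by linarith : 0 ≤ x) (by nlinarith : 0 ≤ z * y)]
      exact (sq_le_sq₀ (by linarith) (by positivity)).1 h4
    have hfirst : x * |gevrey σ z - gevrey σ x| ≤
        32 * y * gevrey σ x * Real.exp (σ * y) + 16 * σ * y * Real.exp (σ * y) * x * gevrey σ x := by
      calc x * |gevrey σ z - gevrey σ x|
          ≤ x * (y * (Real.exp (σ * (x + y)) * (4 * (2 * x) ^ 3 + σ * (2 * x) ^ 4))) := by
            refine mul_le_mul_of_nonneg_left (hc.trans ?_) (by linarith)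
            gcongr
        _ = _ := by rw [hsum]; unfold gevrey; ring
    refine hfirst.trans ?_
    have t1 : 32 * y * gevrey σ x * Real.exp (σ * y) ≤
        32 * y * gevrey σ x * (1 + σ * y * Real.exp (σ * y) * (Real.sqrt x * Real.sqrt z)) := by
      refine mul_le_mul_of_nonneg_left (ey.trans ?_) (by positivity)
      linarith [le_mul_of_one_le_right (by positivity : 0 ≤ σ * y * Real.exp (σ * y)) hP]
    have t2 : 16 * σ * y * Real.exp (σ * y) * x * gevrey σ x ≤
        16 * σ * y * Real.exp (σ * y) * (Real.sqrt x * Real.sqrt z * y) * gevrey σ x := by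
      gcongr
    have t3 : 0 ≤ σ * (x ^ 2 * Real.exp (σ * x) * (Real.sqrt y * Real.sqrt z) * gevrey σ y) := by
      positivity
    have t4 : 0 ≤ x * gevrey σ y := by positivity
    have t5 : 0 ≤ y * gevrey σ x := by positivity
    linarith
  · have hg : |gevrey σ z - gevrey σ x| ≤ 16 * (gevrey σ y * Real.exp (σ * x)) := by
      have hb : ∀ w, 0 ≤ w → w ≤ x + y → gevrey σ w ≤ 16 * (gevrey σ y * Real.exp (σ * x)) := by
        intro w hw hwm
        calc gevrey σ w ≤ gevrey σ (x + y) := gevrey_mono hσ hw hwm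
          _ ≤ (2 * y) ^ 4 * Real.exp (σ * (x + y)) := by
            unfold gevrey; gcongr; linarith
          _ = _ := by rw [hsum]; unfold gevrey; ring
      rw [abs_le]
      constructor
      · linarith [hb x (by linarith) (by linarith), gevrey_nonneg σ z]
      · linarith [hb z (by linarith) h1]
    have t1 : x * |gevrey σ z - gevrey σ x| ≤ x * (16 * (gevrey σ y *
        (1 + σ * x * Real.exp (σ * x) * (Real.sqrt y * Real.sqrt z)))) := by
      refine mul_le_mul_of_nonneg_left (hg.trans ?_) (by linarith)
      gcongr
      linarith [le_mul_of_one_le_right (by positivity : 0 ≤ σ * x * Real.exp (σ * x)) hP']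
    have t3 : 0 ≤ σ * (y ^ 2 * Real.exp (σ * y) * (Real.sqrt x * Real.sqrt z) * gevrey σ x) := by
      positivity
    have t6 : 0 ≤ σ * (x ^ 2 * Real.exp (σ * x) * (Real.sqrt y * Real.sqrt z) * gevrey σ y) := by
      positivity
    have t4 : 0 ≤ x * gevrey σ y := by positivity
    have t5 : 0 ≤ y * gevrey σ x := by positivity
    linarith

theorem summable_of_support {f : ℤ × ℤ → ℂ} (hf : f.support.Finite) {F : ℤ × ℤ → ℝ}
    (hF : ∀ k, f k = 0 → F k = 0) : Summable F :=
  summable_of_hasFiniteSupport (hf.subset fun k hk => by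
    simp only [Function.mem_support, ne_eq] at hk ⊢; exact fun h => hk (hF k h))

/-- The energy inequality in the analytic norm. -/
theorem gevrey_rate {α σ L X : ℝ} {N : ℕ} {b : ℤ × ℤ → ℂ} (hσ : 0 ≤ σ)
    (hbs : ∀ k ∉ box N, b k = 0) (hbh : Hermitian b)
    (hL : ∑' k, absWeight k * ‖b k‖ ≤ L)
    (hX : ∑' k, absWeight k ^ 2 * Real.exp (σ * absWeight k) * ‖b k‖ ≤ X) :
    2 * (∑ k ∈ box N, (gevrey σ (absWeight k) ^ 2 : ℝ) *
        ((starRingEnd ℂ) (b k) * rhs α b k).re) ≤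
      193 * (L * ∑ k ∈ box N, (gevrey σ (absWeight k) * ‖b k‖) ^ 2 +
        σ * X * ∑ k ∈ box N, absWeight k * (gevrey σ (absWeight k) * ‖b k‖) ^ 2) := by
  have fb := support_finite_of_box hbs
  set g : ℤ × ℤ → ℝ := fun k => gevrey σ (absWeight k) with hg
  have hg0 : ∀ k, 0 ≤ g k := fun k => gevrey_nonneg σ _
  have hJ0 : ∀ k, 0 ≤ absWeight k := fun k => zero_le_one.trans (one_le_absWeight k)
  set f : ℤ × ℤ → ℂ := fun k => g k * b k with hf
  have hfs : ∀ k ∉ box N, f k = 0 := fun k hk => by simp [hf, hbs k hk]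
  have ff := support_finite_of_box hfs
  have hfn : ∀ k, ‖f k‖ = g k * ‖b k‖ := fun k => by
    simp [hf, abs_of_nonneg (hg0 k)]
  set E := ∑' k, ‖f k‖ ^ 2 with hE
  set F := ∑' k, (Real.sqrt (absWeight k) * ‖f k‖) ^ 2 with hF
  have hE0 : 0 ≤ E := tsum_nonneg fun _ => sq_nonneg _
  have hF0 : 0 ≤ F := tsum_nonneg fun _ => sq_nonneg _
  have hEs : ∑ k ∈ box N, (g k * ‖b k‖) ^ 2 = E := by
    rw [hE, tsum_eq_sum (s := box N) fun k hk => by simp [hfs k hk]]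
    exact Finset.sum_congr rfl fun k _ => by rw [hfn]
  have hFs : ∑ k ∈ box N, absWeight k * (g k * ‖b k‖) ^ 2 = F := by
    rw [hF, tsum_eq_sum (s := box N) fun k hk => by simp [hfs k hk]]
    exact Finset.sum_congr rfl fun k _ => by
      rw [hfn, mul_pow (Real.sqrt _), Real.sq_sqrt (hJ0 k)]
  -- reduction to the trilinear form
  have hmain : 2 * (∑ k ∈ box N, (g k ^ 2 : ℝ) * ((starRingEnd ℂ) (b k) * rhs α b k).re) =
      -(triForm (fun k => g k * f k) b b).re := by
    rw [triForm, tsum_eq_sum (s := box N) fun k hk => by simp [hfs k hk], Complex.re_sum,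
      Finset.mul_sum, ← Finset.sum_neg_distrib]
    refine Finset.sum_congr rfl fun k _ => ?_
    rw [rhs, re_conj_mul_dispersion]
    have : (starRingEnd ℂ) (g k * f k) * (I * k.1 * conv b b k) =
        ((g k ^ 2 : ℝ) : ℂ) * ((starRingEnd ℂ) (b k) * (I * k.1 * conv b b k)) := by
      simp only [hf, map_mul, Complex.conj_ofReal]; push_cast; ring
    rw [this, Complex.re_ofReal_mul]
    ring
  set Q := ∑' p : (ℤ × ℤ) × (ℤ × ℤ),
    I * p.1.1 * (starRingEnd ℂ) (g (p.1 + p.2) * f (p.1 + p.2)) * b p.1 * b p.2 with hQ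
  have hsplit : triForm (fun k => g k * f k) b b = 2 * Q := by
    have hsw : ∑' p : (ℤ × ℤ) × (ℤ × ℤ),
        I * p.2.1 * (starRingEnd ℂ) (g (p.1 + p.2) * f (p.1 + p.2)) * b p.1 * b p.2 = Q := by
      rw [← tsum_prod_swap, hQ]
      congr 1
      ext p
      simp only [Prod.fst_swap, Prod.snd_swap, add_comm p.2 p.1]
      ring
    rw [triForm_eq (summable_triForm_of_finite fb fb), two_mul]
    nth_rewrite 2 [← hsw]
    rw [hQ, ← (summable_pair_of_finite fb fb _).tsum_add (summable_pair_of_finite fb fb _)]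
    congr 1
    ext p
    simp only [Prod.fst_add]
    push_cast
    ring
  set Q1 := ∑' p : (ℤ × ℤ) × (ℤ × ℤ),
    I * p.1.1 * (starRingEnd ℂ) (f (p.1 + p.2)) * f p.1 * b p.2 with hQ1
  set Q2 := ∑' p : (ℤ × ℤ) × (ℤ × ℤ),
    I * p.1.1 * (starRingEnd ℂ) (f (p.1 + p.2)) * (g (p.1 + p.2) - g p.1) * b p.1 * b p.2 with hQ2
  -- Half of the weight is moved from the output frequency to `p.1`: `Q1` has the form to which
  -- integration by parts applies, `Q2` carries the commutator.
  have hQ12 : Q = Q1 + Q2 := by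
    rw [hQ, hQ1, hQ2, ← (summable_pair_of_finite ff fb _).tsum_add (summable_pair_of_finite fb fb
      (fun p => I * p.1.1 * (starRingEnd ℂ) (f (p.1 + p.2)) * (g (p.1 + p.2) - g p.1)))]
    congr 1
    ext p
    simp only [hf, map_mul, Complex.conj_ofReal]
    ring
  -- the symmetric part
  have hL1 : ∑' k : ℤ × ℤ, |(k.1 : ℝ)| * ‖b k‖ ≤ L := by
    refine le_trans (Summable.tsum_le_tsum (fun k => ?_) (summable_norm_of_finite fb _)
      (summable_norm_of_finite fb _)) hL
    gcongr
    unfold absWeight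
    linarith [abs_nonneg (k.2 : ℝ)]
  have b1 : |2 * Q1.re| ≤ L * E := by
    rw [two_re_tsum_fst_mul ff fb hbh, abs_neg]
    exact (Complex.abs_re_le_norm _).trans (norm_tsum_snd_mul_le ff fb hL1)
  -- the commutator
  have sE : Summable fun k => ‖f k‖ ^ 2 := summable_of_support ff fun k hk => by simp [hk]
  have sF : Summable fun k => (Real.sqrt (absWeight k) * ‖f k‖) ^ 2 :=
    summable_of_support ff fun k hk => by simp [hk]
  have y1 := young_trilinear (f := fun k => ‖f k‖) (h := fun k => ‖f k‖)
    (g := fun k => absWeight k * ‖b k‖) (A := Real.sqrt E) (B := Real.sqrt E) (L := L)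
    (fun _ => norm_nonneg _) (fun k => mul_nonneg (hJ0 k) (norm_nonneg _)) (fun _ => norm_nonneg _)
    (Real.sqrt_nonneg _) (Real.sqrt_nonneg _) sE sE (summable_norm_of_finite fb _)
    (by rw [Real.sq_sqrt hE0]) (by rw [Real.sq_sqrt hE0]) hL
  have y2 := young_trilinear (f := fun k => Real.sqrt (absWeight k) * ‖f k‖)
    (h := fun k => Real.sqrt (absWeight k) * ‖f k‖)
    (g := fun k => absWeight k ^ 2 * Real.exp (σ * absWeight k) * ‖b k‖)
    (A := Real.sqrt F) (B := Real.sqrt F) (L := X)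
    (fun _ => by positivity) (fun k => by positivity) (fun _ => by positivity)
    (Real.sqrt_nonneg _) (Real.sqrt_nonneg _) sF sF (summable_norm_of_finite fb _)
    (by rw [Real.sq_sqrt hF0]) (by rw [Real.sq_sqrt hF0]) hX
  set T1 : (ℤ × ℤ) × (ℤ × ℤ) → ℝ :=
    fun p => ‖f p.1‖ * (absWeight p.2 * ‖b p.2‖) * ‖f (p.1 + p.2)‖ with hT1
  set T2 : (ℤ × ℤ) × (ℤ × ℤ) → ℝ := fun p => Real.sqrt (absWeight p.1) * ‖f p.1‖ *
    (absWeight p.2 ^ 2 * Real.exp (σ * absWeight p.2) * ‖b p.2‖) *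
      (Real.sqrt (absWeight (p.1 + p.2)) * ‖f (p.1 + p.2)‖) with hT2
  have hT1E : ∑' p, T1 p ≤ L * E := y1.2.trans (le_of_eq (by
    rw [mul_right_comm, Real.mul_self_sqrt hE0, mul_comm]))
  have hT2F : ∑' p, T2 p ≤ X * F := y2.2.trans (le_of_eq (by
    rw [mul_right_comm, Real.mul_self_sqrt hF0, mul_comm]))
  have sw : ∀ {Φ : (ℤ × ℤ) × (ℤ × ℤ) → ℝ}, Summable Φ →
      Summable (fun p : (ℤ × ℤ) × (ℤ × ℤ) => Φ p.swap) ∧ ∑' p : (ℤ × ℤ) × (ℤ × ℤ), Φ p.swap = ∑' p, Φ p := fun {Φ} h =>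
    ⟨((Equiv.prodComm (ℤ × ℤ) (ℤ × ℤ)).summable_iff (f := Φ)).2 h,
      (Equiv.prodComm (ℤ × ℤ) (ℤ × ℤ)).tsum_eq Φ⟩
  have s1 := sw y1.1
  have s2 := sw y2.1
  have hterm : ∀ p : (ℤ × ℤ) × (ℤ × ℤ),
      ‖I * p.1.1 * (starRingEnd ℂ) (f (p.1 + p.2)) * (g (p.1 + p.2) - g p.1) * b p.1 * b p.2‖ ≤
        48 * (T1 p + T1 p.swap + σ * (T2 p + T2 p.swap)) := by
    intro p
    have hc := gevrey_commutator hσ (one_le_absWeight p.1) (one_le_absWeight p.2)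
      (one_le_absWeight (p.1 + p.2))
      (by linarith [absWeight_le_add p.1 p.2]) (by linarith [absWeight_add_le p.1 p.2])
    have hn : ‖I * p.1.1 * (starRingEnd ℂ) (f (p.1 + p.2)) * (g (p.1 + p.2) - g p.1) * b p.1 *
        b p.2‖ = |(p.1.1 : ℝ)| * |g (p.1 + p.2) - g p.1| *
          (‖f (p.1 + p.2)‖ * ‖b p.1‖ * ‖b p.2‖) := by
      rw [← Complex.ofReal_sub]
      simp only [norm_mul, Complex.norm_I, RCLike.norm_conj, Complex.norm_intCast, one_mul,
        Complex.norm_real, Real.norm_eq_abs]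
      ring
    rw [hn]
    have hk : |(p.1.1 : ℝ)| ≤ absWeight p.1 := by
      unfold absWeight
      linarith [abs_nonneg (p.1.2 : ℝ)]
    calc |(p.1.1 : ℝ)| * |g (p.1 + p.2) - g p.1| * (‖f (p.1 + p.2)‖ * ‖b p.1‖ * ‖b p.2‖)
        ≤ absWeight p.1 * |g (p.1 + p.2) - g p.1| * (‖f (p.1 + p.2)‖ * ‖b p.1‖ * ‖b p.2‖) := by
          gcongr
      _ ≤ _ := mul_le_mul_of_nonneg_right hc (by positivity)
      _ = _ := by
          simp only [hT1, hT2, Prod.fst_swap, Prod.snd_swap, hfn, add_comm p.2 p.1]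
          simp only [hg]
          ring
  have sall : Summable fun p : (ℤ × ℤ) × (ℤ × ℤ) =>
      48 * (T1 p + T1 p.swap + σ * (T2 p + T2 p.swap)) :=
    ((y1.1.add s1.1).add ((y2.1.add s2.1).mul_left σ)).mul_left 48
  have snorm := Summable.of_nonneg_of_le (fun _ => norm_nonneg _) hterm sall
  have b2 : ‖Q2‖ ≤ 96 * (L * E + σ * X * F) := by
    calc ‖Q2‖ ≤ _ := norm_tsum_le_tsum_norm snorm
      _ ≤ _ := Summable.tsum_le_tsum hterm snorm sall
      _ = 96 * (∑' p, T1 p + σ * ∑' p, T2 p) := by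
          rw [tsum_mul_left, (y1.1.add s1.1).tsum_add ((y2.1.add s2.1).mul_left σ), tsum_mul_left,
            y1.1.tsum_add s1.1, y2.1.tsum_add s2.1, s1.2, s2.2]
          ring
      _ ≤ 96 * (L * E + σ * (X * F)) := by gcongr
      _ = _ := by ring
  rw [hEs, hFs, hmain, hsplit, hQ12]
  have r1 := (abs_le.1 b1).1
  have r2 := (abs_le.1 ((Complex.abs_re_le_norm Q2).trans b2)).1
  have hX0 : 0 ≤ X := le_trans (tsum_nonneg fun k => by positivity) hX
  have hσXF : 0 ≤ σ * X * F := by positivity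
  have e : (2 * (Q1 + Q2)).re = 2 * Q1.re + 2 * Q2.re := by simp; ring
  rw [e]
  -- The symmetric part contributes `1` and the commutator `2 · 96`, which gives `193`.
  linarith

theorem summable_absWeight_inv : Summable fun k : ℤ × ℤ => ((absWeight k ^ 2)⁻¹) ^ 2 := by
  refine summable_prod_one_add_sq_inv.of_nonneg_of_le (fun k => by positivity) fun k => ?_
  have h1 : 1 + (k.1 : ℝ) ^ 2 ≤ absWeight k ^ 2 := by
    unfold absWeight
    nlinarith [sq_abs (k.1 : ℝ), abs_nonneg (k.1 : ℝ), abs_nonneg (k.2 : ℝ),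
      mul_nonneg (abs_nonneg (k.1 : ℝ)) (abs_nonneg (k.2 : ℝ))]
  have h2 : 1 + (k.2 : ℝ) ^ 2 ≤ absWeight k ^ 2 := by
    unfold absWeight
    nlinarith [sq_abs (k.2 : ℝ), abs_nonneg (k.1 : ℝ), abs_nonneg (k.2 : ℝ),
      mul_nonneg (abs_nonneg (k.1 : ℝ)) (abs_nonneg (k.2 : ℝ))]
  rw [sq]
  gcongr

/-- The constant relating the analytic `ℓ¹` and `ℓ²` norms. -/
def gevreyConst : ℝ := Real.sqrt (∑' k : ℤ × ℤ, ((absWeight k ^ 2)⁻¹) ^ 2)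

/-- Cauchy–Schwarz. Of the four powers in `gevrey`, two supply the weight on the left and two give
the square-summable factor `absWeight⁻²` on `ℤ²`. -/
theorem gevrey_wiener_le {σ : ℝ} {N : ℕ} {b : ℤ × ℤ → ℂ} (hbs : ∀ k ∉ box N, b k = 0) :
    ∑' k, absWeight k ^ 2 * Real.exp (σ * absWeight k) * ‖b k‖ ≤
      gevreyConst * Real.sqrt (∑ k ∈ box N, (gevrey σ (absWeight k) * ‖b k‖) ^ 2) := by
  have fb := support_finite_of_box hbs
  have hE : ∑' k, (gevrey σ (absWeight k) * ‖b k‖) ^ 2 =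
      ∑ k ∈ box N, (gevrey σ (absWeight k) * ‖b k‖) ^ 2 :=
    tsum_eq_sum fun k hk => by simp [hbs k hk]
  have h := tsum_mul_le_of_sq (f := fun k : ℤ × ℤ => (absWeight k ^ 2)⁻¹)
    (g := fun k => gevrey σ (absWeight k) * ‖b k‖) (A := gevreyConst)
    (B := Real.sqrt (∑ k ∈ box N, (gevrey σ (absWeight k) * ‖b k‖) ^ 2))
    (fun _ => by positivity) (fun k => mul_nonneg (gevrey_nonneg _ _) (norm_nonneg _))
    (Real.sqrt_nonneg _) (Real.sqrt_nonneg _) summable_absWeight_inv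
    (summable_of_support fb fun k hk => by simp [hk])
    (by rw [gevreyConst, Real.sq_sqrt (tsum_nonneg fun _ => sq_nonneg _)])
    (by rw [hE, Real.sq_sqrt (Finset.sum_nonneg fun _ _ => sq_nonneg _)])
  refine le_trans (le_of_eq ?_) h.2
  congr 1
  ext k
  have : absWeight k ≠ 0 := (zero_lt_one.trans_le (one_le_absWeight k)).ne'
  unfold gevrey
  field_simp

/-- Uniform analyticity of the Galerkin solutions on the whole time interval. -/
theorem gevrey_bound (α : ℝ) {T σ₀ L E₀ : ℝ} (hσ₀ : 0 < σ₀) (hL : 0 ≤ L)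
    (hE₀ : 0 < E₀) : ∃ σ₁ C : ℝ, 0 < σ₁ ∧ 0 < C ∧
      ∀ (N : ℕ) (c₀ : ℤ × ℤ → ℂ) (b : ℝ → ℤ × ℤ → ℂ), CoeffGalerkin α T N c₀ b →
        (∀ t ∈ Icc 0 T, Hermitian (b t)) → (∀ t ∈ Ico 0 T, ∑' k, absWeight k * ‖b t k‖ ≤ L) →
        ∑ k ∈ box N, (gevrey σ₀ (absWeight k) * ‖b 0 k‖) ^ 2 ≤ E₀ →
        ∀ t ∈ Icc 0 T, ∀ k ∈ box N, ‖b t k‖ ≤ C * Real.exp (-σ₁ * absWeight k) := by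
  -- The added `1` makes the differential inequality strict, as the comparison at the boundary
  -- requires.
  set A := 193 * L + 1 with hA
  have hA0 : 0 < A := by positivity
  set Em := E₀ * Real.exp (A * T) with hEm
  have hEm0 : 0 < Em := by positivity
  -- Shrinking the radius produces `-2βσF`; this `β` makes it absorb the commutator term `193 σ X F`
  -- as long as the energy is at most `Em`.
  set β := 193 * gevreyConst * Real.sqrt Em / 2 with hβ
  have hκ : 0 ≤ gevreyConst := Real.sqrt_nonneg _
  have hβ0 : 0 ≤ β := by positivity
  refine ⟨σ₀ * Real.exp (-β * T), Real.sqrt Em, by positivity, by positivity, ?_⟩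
  intro N c₀ b hb hbh hbL hbE
  set σ : ℝ → ℝ := fun t => σ₀ * Real.exp (-β * t) with hσ
  have hσpos : ∀ t, 0 < σ t := fun t => by positivity
  have hσd : ∀ t, HasDerivAt σ (-β * σ t) t := by
    intro t
    have := (((hasDerivAt_id t).const_mul (-β)).exp).const_mul σ₀
    refine this.congr_deriv ?_
    simp only [hσ, id]
    ring
  set E : ℝ → ℝ := fun t => ∑ k ∈ box N, (gevrey (σ t) (absWeight k) * ‖b t k‖) ^ 2 with hE
  set F : ℝ → ℝ := fun t =>
    ∑ k ∈ box N, absWeight k * (gevrey (σ t) (absWeight k) * ‖b t k‖) ^ 2 with hF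
  set R : ℝ → ℝ := fun t => ∑ k ∈ box N, (gevrey (σ t) (absWeight k) ^ 2 : ℝ) *
        ((starRingEnd ℂ) (b t k) * rhs α (b t) k).re with hR
  have hJ0 : ∀ k, 0 ≤ absWeight k := fun k => zero_le_one.trans (one_le_absWeight k)
  have hF0 : ∀ t, 0 ≤ F t := fun t =>
    Finset.sum_nonneg fun k _ => mul_nonneg (hJ0 k) (sq_nonneg _)
  have hgd : ∀ t x, HasDerivAt (fun s => gevrey (σ s) x ^ 2)
      (-2 * β * σ t * x * gevrey (σ t) x ^ 2) t := by
    intro t x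
    have h1 : HasDerivAt (fun s => gevrey (σ s) x)
        (x ^ 4 * (Real.exp (σ t * x) * (-β * σ t * x))) t :=
      (((hσd t).mul_const x).exp).const_mul (x ^ 4)
    refine (h1.pow 2).congr_deriv ?_
    unfold gevrey
    push_cast
    ring
  have hEd : ∀ t ∈ Icc 0 T, HasDerivWithinAt E (-2 * β * σ t * F t + 2 * R t) (Icc 0 T) t := by
    intro t ht
    have h1 : HasDerivWithinAt E (∑ k ∈ box N,
        ((-2 * β * σ t * absWeight k * gevrey (σ t) (absWeight k) ^ 2) * ‖b t k‖ ^ 2 +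
          gevrey (σ t) (absWeight k) ^ 2 *
            (2 * ((starRingEnd ℂ) (b t k) * rhs α (b t) k).re))) (Icc 0 T) t := by
      simp only [hE, mul_pow]
      exact HasDerivWithinAt.fun_sum fun k hk => (hgd t (absWeight k)).hasDerivWithinAt.mul
        (hasDerivWithinAt_norm_sq (hb.hasDerivWithinAt t ht k hk))
    refine h1.congr_deriv ?_
    simp only [hF, hR, Finset.mul_sum]
    rw [← Finset.sum_add_distrib]
    refine Finset.sum_congr rfl fun k _ => ?_
    ring
  -- The inequality is tested only at times when `E` touches the barrier, and there `E ≤ Em` is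
  -- known; this closes the bootstrap.
  have hbar : ∀ t ∈ Icc 0 T, E t ≤ E₀ * Real.exp (A * t) := by
    refine image_le_of_deriv_right_lt_deriv_boundary (f' := fun t => -2 * β * σ t * F t + 2 * R t)
      (B' := fun t => E₀ * (Real.exp (A * t) * (A * 1)))
      (fun t ht => (hEd t ht).continuousWithinAt)
      (fun t ht => ((hEd t (Ico_subset_Icc_self ht)).mono
        (Icc_subset_Icc_left ht.1)).mono_of_mem_nhdsWithin (Icc_mem_nhdsGE ht.2)) ?_
      (fun t => (((hasDerivAt_id t).const_mul A).exp).const_mul E₀) ?_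
    · simp only [hE, hσ, mul_zero, Real.exp_zero, mul_one]
      exact hbE
    · intro t ht hEt
      have ht' := Ico_subset_Icc_self ht
      have hrate := gevrey_rate (α := α) (hσpos t).le (hb.support t ht') (hbh t ht') (hbL t ht)
        (gevrey_wiener_le (hb.support t ht'))
      change 2 * R t ≤ 193 * (L * E t + σ t * (gevreyConst * Real.sqrt (E t)) * F t) at hrate
      have hEpos : 0 < E t := by rw [hEt]; positivity
      have hEle : E t ≤ Em := by
        rw [hEt, hEm]
        have := ht.2.le
        gcongr
      have h2 : 193 * (σ t * (gevreyConst * Real.sqrt (E t)) * F t) ≤ 2 * β * σ t * F t := by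
        have hs := Real.sqrt_le_sqrt hEle
        have := hF0 t
        have := hσpos t
        calc 193 * (σ t * (gevreyConst * Real.sqrt (E t)) * F t)
            ≤ 193 * (σ t * (gevreyConst * Real.sqrt Em) * F t) := by gcongr
          _ = 2 * β * σ t * F t := by rw [hβ]; ring
      have h3 : E₀ * (Real.exp (A * t) * (A * 1)) = A * E t := by rw [hEt]; ring
      rw [h3, hA]
      linarith
  intro t ht k hk
  have h1 : (gevrey (σ t) (absWeight k) * ‖b t k‖) ^ 2 ≤ Real.sqrt Em ^ 2 := by
    rw [Real.sq_sqrt hEm0.le]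
    refine le_trans ?_ ((hbar t ht).trans ?_)
    · exact Finset.single_le_sum
        (f := fun k => (gevrey (σ t) (absWeight k) * ‖b t k‖) ^ 2) (fun _ _ => sq_nonneg _) hk
    · have := ht.2
      rw [hEm]
      gcongr
  have h2 := (sq_le_sq₀ (mul_nonneg (gevrey_nonneg _ _) (norm_nonneg _)) (Real.sqrt_nonneg _)).1 h1
  have hσle : σ₀ * Real.exp (-β * T) ≤ σ t := by
    simp only [hσ]
    have : -β * T ≤ -β * t := by nlinarith [ht.2]
    gcongr
  have h3 : Real.exp (σ₀ * Real.exp (-β * T) * absWeight k) ≤ gevrey (σ t) (absWeight k) := by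
    unfold gevrey
    refine le_trans ?_ (le_mul_of_one_le_left (Real.exp_pos _).le
      (one_le_pow₀ (one_le_absWeight k)))
    exact Real.exp_le_exp.2 (mul_le_mul_of_nonneg_right hσle (hJ0 k))
  rw [neg_mul, Real.exp_neg, ← div_eq_mul_inv, le_div_iff₀ (Real.exp_pos _), mul_comm]
  exact (mul_le_mul_of_nonneg_right h3 (norm_nonneg _)).trans h2

/-! ### Exponential decay of the coefficients of analytic functions -/

/-- Local Cauchy estimates for a real-analytic function. -/
theorem exists_iteratedFDeriv_bound {E : Type*} [NormedAddCommGroup E] [NormedSpace ℝ E]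
    {g : E → ℝ} {z₀ : E} (hg : AnalyticAt ℝ g z₀) (v : E) (hv : ‖v‖ ≤ 1) :
    ∃ C R : ℝ, 0 < C ∧ 0 < R ∧ ∃ s ∈ nhds z₀, ∀ z ∈ s, ∀ n : ℕ,
      |iteratedFDeriv ℝ n g z (fun _ => v)| ≤ C * R ^ n * n.factorial := by
  obtain ⟨p, ρ, hp⟩ := hg
  -- With `2s < ρ` the series re-expanded at any point within `s` of `z₀` converges absolutely at
  -- radius `s`, with a total mass `S` independent of the point.
  obtain ⟨s, hs0, hsρ⟩ := ENNReal.lt_iff_exists_nnreal_btwn.1 (ENNReal.half_pos hp.r_pos.ne')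
  have hs0' : 0 < s := by exact_mod_cast hs0
  have hss : (s : ENNReal) + s < ρ := by
    calc (s : ENNReal) + s < ρ / 2 + ρ / 2 := ENNReal.add_lt_add hsρ hsρ
      _ = ρ := ENNReal.add_halves ρ
  have hsum := p.changeOriginSeries_summable_aux₁ (hss.trans_le hp.r_le)
  set S := ∑' q : Σ k l : ℕ, { s : Finset (Fin (k + l)) // s.card = l },
    ‖p (q.1 + q.2.1)‖₊ * s ^ q.2.1 * s ^ q.1 with hS
  refine ⟨S + 1, (s : ℝ)⁻¹, by positivity, by positivity, Metric.ball z₀ s,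
    Metric.ball_mem_nhds _ (by exact_mod_cast hs0'), fun z hz n => ?_⟩
  set y := z - z₀ with hy
  have hys : ‖y‖₊ < s := by
    rw [Metric.mem_ball, dist_eq_norm] at hz
    exact_mod_cast hz
  have hyρ : (‖y‖₊ : ENNReal) < ρ :=
    lt_of_lt_of_le (ENNReal.coe_lt_coe.2 hys) (le_self_add.trans hss.le)
  have hq := hp.changeOrigin hyρ
  rw [hy, add_sub_cancel, ← hy] at hq
  -- The derivative sums the `n`-th coefficient over all permutations of its equal arguments, which
  -- is the source of `n!`.
  rw [hq.iteratedFDeriv_eq_sum_of_completeSpace, Finset.sum_const, Finset.card_univ,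
    Fintype.card_perm, Fintype.card_fin, nsmul_eq_mul, abs_mul, Nat.abs_cast, mul_comm]
  refine mul_le_mul_of_nonneg_right ?_ (Nat.cast_nonneg _)
  have h1 : |p.changeOrigin y n (fun _ => v)| ≤ ‖p.changeOrigin y n‖ := by
    have := (p.changeOrigin y n).le_opNorm (fun _ => v)
    rw [Real.norm_eq_abs, Finset.prod_const] at this
    exact this.trans (mul_le_of_le_one_right (norm_nonneg _) (pow_le_one₀ (norm_nonneg _) hv))
  refine h1.trans ?_
  have h2 := p.nnnorm_changeOrigin_le n (hyρ.trans_le hp.r_le)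
  have hsρ' : (s : ENNReal) < p.radius := lt_of_le_of_lt le_self_add (hss.trans_le hp.r_le)
  have a2 := p.changeOriginSeries_summable_aux₂ hsρ' n
  have h3 : ‖p.changeOrigin y n‖₊ ≤ ∑' q : Σ l : ℕ, { s : Finset (Fin (n + l)) // s.card = l },
      ‖p (n + q.1)‖₊ * s ^ q.1 := by
    refine h2.trans (Summable.tsum_le_tsum (fun q => ?_) ?_ a2)
    · gcongr
    · refine NNReal.summable_of_le (fun q => ?_) a2
      gcongr
  have h4 : (∑' q : Σ l : ℕ, { s : Finset (Fin (n + l)) // s.card = l },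
      ‖p (n + q.1)‖₊ * s ^ q.1) * s ^ n ≤ S := by
    have hh := NNReal.summable_sigma.1 hsum
    rw [hS, hsum.tsum_sigma' hh.1, ← NNReal.tsum_mul_right]
    exact hh.2.le_tsum n (fun _ _ => zero_le)
  have h5 : ‖p.changeOrigin y n‖₊ * s ^ n ≤ S := (mul_le_mul_left h3 _).trans h4
  have h6 : ‖p.changeOrigin y n‖ * (s : ℝ) ^ n ≤ S := by exact_mod_cast h5
  rw [inv_pow, ← div_eq_mul_inv, le_div_iff₀ (by positivity)]
  linarith

/-- Cauchy estimates on a compact set for a real-analytic function. -/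
theorem exists_iteratedFDeriv_bound_compact {E : Type*} [NormedAddCommGroup E] [NormedSpace ℝ E]
    {g : E → ℝ} (hg : AnalyticOnNhd ℝ g univ) (v : E) (hv : ‖v‖ ≤ 1) {K : Set E}
    (hK : IsCompact K) : ∃ C R : ℝ, 0 < C ∧ 0 < R ∧ ∀ z ∈ K, ∀ n : ℕ,
      |iteratedFDeriv ℝ n g z (fun _ => v)| ≤ C * R ^ n * n.factorial := by
  refine hK.induction_on (p := fun K => ∃ C R : ℝ, 0 < C ∧ 0 < R ∧ ∀ z ∈ K, ∀ n : ℕ,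
      |iteratedFDeriv ℝ n g z (fun _ => v)| ≤ C * R ^ n * n.factorial) ?_ ?_ ?_ ?_
  · exact ⟨1, 1, one_pos, one_pos, by simp⟩
  · rintro s t hst ⟨C, R, hC, hR, h⟩
    exact ⟨C, R, hC, hR, fun z hz => h z (hst hz)⟩
  · rintro s t ⟨C, R, hC, hR, h⟩ ⟨C', R', hC', hR', h'⟩
    refine ⟨max C C', max R R', lt_max_of_lt_left hC, lt_max_of_lt_left hR, ?_⟩
    rintro z (hz | hz) n
    · refine (h z hz n).trans ?_
      gcongr <;> exact le_max_left _ _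
    · refine (h' z hz n).trans ?_
      gcongr <;> exact le_max_right _ _
  · intro z _
    obtain ⟨C, R, hC, hR, s, hs, h⟩ := exists_iteratedFDeriv_bound (hg z (mem_univ z)) v hv
    exact ⟨s, mem_nhdsWithin_of_mem_nhds hs, C, R, hC, hR, h⟩

theorem cellMeasure_eq_prod : cellMeasure =
    (volume.restrict (Icc (-Real.pi) Real.pi)).prod (volume.restrict (Icc (-Real.pi) Real.pi)) := by
  rw [cellMeasure, cell, Measure.volume_eq_prod, Measure.prod_restrict]

theorem integrable_cell_of_continuous {f : ℝ × ℝ → ℂ} (hf : Continuous f) :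
    Integrable f cellMeasure :=
  hf.continuousOn.integrableOn_compact (isCompact_Icc.prod isCompact_Icc)

/-- Integration by parts for Fourier coefficients of periodic functions. -/
theorem coeff_deriv_fst {h h' : ℝ × ℝ → ℂ} (hc : Continuous h) (hc' : Continuous h')
    (hd : ∀ x y, HasDerivAt (fun s => h (s, y)) (h' (x, y)) x)
    (hp : ∀ x y, h (x + 2 * Real.pi, y) = h (x, y)) (k : ℤ × ℤ) :
    coeff h' k = I * k.1 * coeff h k := by
  unfold coeff
  rw [mul_left_comm]
  congr 1
  have i1 : Integrable (fun x => h' x * expFun (-k) x) cellMeasure :=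
    integrable_cell_of_continuous (hc'.mul (continuous_expFun (-k)))
  have i2 : Integrable (fun x => h x * expFun (-k) x) cellMeasure :=
    integrable_cell_of_continuous (hc.mul (continuous_expFun (-k)))
  rw [cellMeasure_eq_prod] at i1 i2 ⊢
  rw [integral_prod_symm _ i1, integral_prod_symm _ i2, ← integral_const_mul]
  congr 1
  ext y
  have hpi : -Real.pi ≤ Real.pi := by linarith [Real.pi_pos]
  simp only [integral_Icc_eq_integral_Ioc, ← intervalIntegral.integral_of_le hpi]
  have hed : ∀ x, HasDerivAt (fun s => expFun (-k) (s, y)) (-(I * k.1) * expFun (-k) (x, y)) x := by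
    intro x
    unfold expFun
    have h1 : HasDerivAt (fun s : ℝ => ((((-k).1 : ℝ) * s + ((-k).2 : ℝ) * y : ℝ) : ℂ))
        (((-k).1 : ℝ) : ℂ) x := by
      have : HasDerivAt (fun s : ℝ => ((-k).1 : ℝ) * s + ((-k).2 : ℝ) * y) ((-k).1 : ℝ) x := by
        simpa using ((hasDerivAt_id x).const_mul ((-k).1 : ℝ)).add_const (((-k).2 : ℝ) * y)
      exact this.ofReal_comp
    refine ((h1.const_mul I).cexp).congr_deriv ?_
    simp only [Prod.fst_neg]
    push_cast
    ring
  have hper : h (Real.pi, y) * expFun (-k) (Real.pi, y) =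
      h (-Real.pi, y) * expFun (-k) (-Real.pi, y) := by
    have e1 : Real.pi = -Real.pi + 2 * Real.pi := by ring
    have e2 : expFun (-k) (Real.pi, y) = expFun (-k) (-Real.pi, y) := by
      unfold expFun
      rw [Complex.exp_eq_exp_iff_exists_int]
      refine ⟨(-k).1, ?_⟩
      push_cast
      ring
    rw [e2]
    congr 1
    conv_lhs => rw [e1]
    exact hp _ _
  have hibp := intervalIntegral.integral_deriv_mul_eq_sub (a := -Real.pi) (b := Real.pi)
    (u := fun s => h (s, y)) (v := fun s => expFun (-k) (s, y)) (u' := fun s => h' (s, y))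
    (v' := fun s => -(I * k.1) * expFun (-k) (s, y)) (fun x _ => hd x y) (fun x _ => hed x)
    ((hc'.comp (by fun_prop)).intervalIntegrable _ _)
    (((continuous_const.mul ((continuous_expFun (-k)).comp (by fun_prop)))).intervalIntegrable _ _)
  have hce := continuous_expFun (-k)
  have c1 : Continuous fun x => h' (x, y) * expFun (-k) (x, y) := by fun_prop
  have c2 : Continuous fun x => h (x, y) * (-(I * k.1) * expFun (-k) (x, y)) := by fun_prop
  rw [hper, sub_self, intervalIntegral.integral_add (c1.intervalIntegrable _ _)
    (c2.intervalIntegrable _ _)] at hibp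
  rw [← intervalIntegral.integral_const_mul]
  have e3 : ∫ x in (-Real.pi)..Real.pi, h (x, y) * (-(I * k.1) * expFun (-k) (x, y)) =
      -∫ x in (-Real.pi)..Real.pi, I * k.1 * (h (x, y) * expFun (-k) (x, y)) := by
    rw [← intervalIntegral.integral_neg]
    congr 1
    ext x
    ring
  rw [e3] at hibp
  exact add_neg_eq_zero.1 hibp

theorem norm_coeff_le {f : ℝ × ℝ → ℂ} {C : ℝ} (hf : ∀ x ∈ cell, ‖f x‖ ≤ C) (k : ℤ × ℤ) :
    ‖coeff f k‖ ≤ C := by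
  have hpi := Real.pi_pos
  have hvol : cellMeasure.real univ = (2 * Real.pi) ^ 2 := by
    rw [cellMeasure_eq_prod, measureReal_def, ← univ_prod_univ, Measure.prod_prod]
    simp only [Measure.restrict_apply_univ, Real.volume_Icc]
    rw [ENNReal.toReal_mul, ENNReal.toReal_ofReal (by linarith)]
    ring
  have h1 : ‖∫ x, f x * expFun (-k) x ∂cellMeasure‖ ≤ C * cellMeasure.real univ := by
    refine norm_integral_le_of_norm_le_const ?_
    rw [cellMeasure, ae_restrict_iff'
      (show MeasurableSet cell from measurableSet_Icc.prod measurableSet_Icc)]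
    refine Filter.Eventually.of_forall fun x hx => ?_
    rw [norm_mul, expFun, mul_comm I, Complex.norm_exp_ofReal_mul_I, mul_one]
    exact hf x hx
  unfold coeff
  rw [norm_mul, Complex.norm_real, Real.norm_of_nonneg (by positivity),
    inv_mul_le_iff₀ (by positivity), mul_comm _ C, ← hvol]
  exact h1

/-- Exponential decay of the Fourier coefficients in the first frequency. -/
theorem exists_exp_decay_fst {g : ℝ × ℝ → ℝ} (hg : AnalyticOnNhd ℝ g univ)
    (hp : ∀ x y, g (x + 2 * Real.pi, y) = g (x, y)) :
    ∃ C σ : ℝ, 0 < C ∧ 0 < σ ∧ ∀ k : ℤ × ℤ,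
      ‖coeff (fun x => (g x : ℂ)) k‖ ≤ C * Real.exp (-σ * |(k.1 : ℝ)|) := by
  set v : ℝ × ℝ := (1, 0) with hv
  obtain ⟨C, R, hC, hR, hbd⟩ := exists_iteratedFDeriv_bound_compact hg v (by simp [hv])
    (isCompact_Icc.prod isCompact_Icc : IsCompact cell)
  have hcd : ContDiff ℝ ⊤ g := contDiffOn_univ.1 (hg.contDiffOn uniqueDiffOn_univ)
  set h : ℕ → ℝ × ℝ → ℝ := fun n z => iteratedFDeriv ℝ n g z (fun _ => v) with hh
  have hdiff : ∀ n, Differentiable ℝ (iteratedFDeriv ℝ n g) := fun n =>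
    hcd.differentiable_iteratedFDeriv (WithTop.coe_lt_top _)
  have hcont : ∀ n, Continuous (h n) := fun n => by
    have := (hdiff n).continuous
    simp only [hh]
    fun_prop
  have hder : ∀ n x y, HasDerivAt (fun s => h n (s, y)) (h (n + 1) (x, y)) x := by
    intro n x y
    have h1 : HasFDerivAt (h n) ((ContinuousMultilinearMap.apply ℝ (fun _ : Fin n => ℝ × ℝ) ℝ
        (fun _ => v)).comp (fderiv ℝ (iteratedFDeriv ℝ n g) (x, y))) (x, y) :=
      (ContinuousMultilinearMap.apply ℝ (fun _ : Fin n => ℝ × ℝ) ℝ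
        (fun _ => v)).hasFDerivAt.comp (x, y) (hdiff n (x, y)).hasFDerivAt
    have h2 : HasDerivAt (fun s : ℝ => (s, y)) v x := (hasDerivAt_id x).prodMk (hasDerivAt_const x y)
    have h3 := h1.comp_hasDerivAt x h2
    exact h3
  have hper : ∀ n x y, h n (x + 2 * Real.pi, y) = h n (x, y) := by
    intro n x y
    have h1 : (fun z : ℝ × ℝ => g (z + (2 * Real.pi, 0))) = g := by
      ext ⟨a, b⟩
      simpa using hp a b
    have h2 := iteratedFDeriv_comp_add_right' (𝕜 := ℝ) (f := g) n (2 * Real.pi, (0 : ℝ))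
    rw [h1] at h2
    have h3 := congrFun h2 (x, y)
    simp only [hh]
    rw [h3]
    simp
  have hcoeff : ∀ n (k : ℤ × ℤ), coeff (fun x => (h n x : ℂ)) k =
      (I * k.1) ^ n * coeff (fun x => (g x : ℂ)) k := by
    intro n k
    induction n with
    | zero => simp [hh]
    | succ n ih =>
      rw [coeff_deriv_fst (h := fun x => (h n x : ℂ)) (h' := fun x => (h (n + 1) x : ℂ))
        (by have := hcont n; fun_prop) (by have := hcont (n + 1); fun_prop)
        (fun x y => (hder n x y).ofReal_comp) (fun x y => by rw [hper n x y]), ih]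
      ring
  refine ⟨2 * C, (2 * R)⁻¹, by positivity, by positivity, fun k => ?_⟩
  set a := ‖coeff (fun x => (g x : ℂ)) k‖ with ha
  have hn : ∀ n : ℕ, |(k.1 : ℝ)| ^ n * a ≤ C * R ^ n * n.factorial := by
    intro n
    have h1 := norm_coeff_le (f := fun x => (h n x : ℂ)) (C := C * R ^ n * n.factorial)
      (fun x hx => by rw [Complex.norm_real]; exact hbd x hx n) k
    rw [hcoeff] at h1
    simpa [norm_mul, norm_pow] using h1
  -- The bounds `|k₁|^n a ≤ C R^n n!` are summed with weights `(2R)^{-n}/n!`: an exponential series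
  -- on the left, a geometric series of sum `2C` on the right.
  have hexp := (NormedSpace.expSeries_div_hasSum_exp ((2 * R)⁻¹ * |(k.1 : ℝ)|)).mul_right a
  have hgeo := hasSum_geometric_two.mul_left C
  have hle : NormedSpace.exp ((2 * R)⁻¹ * |(k.1 : ℝ)|) * a ≤ C * 2 := by
    refine hasSum_le (fun n => ?_) hexp hgeo
    have hf : (0 : ℝ) < n.factorial := by exact_mod_cast n.factorial_pos
    calc ((2 * R)⁻¹ * |(k.1 : ℝ)|) ^ n / n.factorial * a
        = ((2 * R)⁻¹) ^ n / n.factorial * (|(k.1 : ℝ)| ^ n * a) := by ring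
      _ ≤ ((2 * R)⁻¹) ^ n / n.factorial * (C * R ^ n * n.factorial) :=
          mul_le_mul_of_nonneg_left (hn n) (by positivity)
      _ = C * (1 / 2) ^ n := by
          have e : R⁻¹ ^ n * R ^ n = 1 := by
            rw [← mul_pow, inv_mul_cancel₀ hR.ne', one_pow]
          rw [mul_inv, mul_pow, one_div]
          calc (2 : ℝ)⁻¹ ^ n * R⁻¹ ^ n / n.factorial * (C * R ^ n * n.factorial)
              = C * 2⁻¹ ^ n * (R⁻¹ ^ n * R ^ n) * (n.factorial / n.factorial) := by ring
            _ = C * 2⁻¹ ^ n := by rw [e, div_self hf.ne', mul_one, mul_one]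
  rw [← Real.exp_eq_exp_ℝ] at hle
  rw [neg_mul, Real.exp_neg, ← div_eq_mul_inv, le_div_iff₀ (Real.exp_pos _)]
  linarith

theorem coeff_comp_swap (f : ℝ × ℝ → ℂ) (k : ℤ × ℤ) :
    coeff (fun x => f x.swap) k.swap = coeff f k := by
  unfold coeff
  congr 1
  rw [cellMeasure_eq_prod, ← integral_prod_swap]
  congr 1
  ext x
  simp only [Prod.swap_swap]
  congr 1
  unfold expFun
  simp only [Prod.fst_swap, Prod.snd_swap, Prod.fst_neg, Prod.snd_neg]
  congr 3
  ring

/-- Exponential decay of the Fourier coefficients of a real-analytic periodic function. -/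
theorem IsRealAnalytic.exists_exp_decay {f : L2per} (hf : IsRealAnalytic f) :
    ∃ C σ : ℝ, 0 < C ∧ 0 < σ ∧ ∀ k, ‖coeff f k‖ ≤ C * Real.exp (-σ * absWeight k) := by
  obtain ⟨g, hg, hp, hfg⟩ := hf
  obtain ⟨C, σ, hC, hσ, h⟩ := exists_exp_decay_fst hg fun x y => (hp x y).1
  have hsw : AnalyticOnNhd ℝ (fun x : ℝ × ℝ => g x.swap) univ := by
    have h1 : AnalyticOnNhd ℝ (fun x : ℝ × ℝ => x.swap) univ :=
      (ContinuousLinearEquiv.prodComm ℝ ℝ ℝ).toContinuousLinearMap.analyticOnNhd univ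
    exact hg.comp h1 (mapsTo_univ _ _)
  obtain ⟨C', σ', hC', hσ', h'⟩ := exists_exp_decay_fst hsw fun x y => (hp y x).2
  set D := max C C' with hD
  -- The decay `e^{-2τ max(|k₁|, |k₂|)}` implies `e^{-τ(|k₁| + |k₂|)}`; the factor `e^τ` in the
  -- constant accounts for the `1` in `absWeight`.
  set τ := min σ σ' / 2 with hτ
  have hτ0 : 0 < τ := by have := lt_min hσ hσ'; positivity
  have hD0 : 0 < D := lt_max_of_lt_left hC
  refine ⟨D * Real.exp τ, τ, by positivity, hτ0, fun k => ?_⟩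
  have e : coeff f k = coeff (fun x => (g x : ℂ)) k := coeff_congr hfg k
  have e1 : ‖coeff f k‖ ≤ D * Real.exp (-(2 * τ) * |(k.1 : ℝ)|) := by
    rw [e]
    refine (h k).trans ?_
    have h1 : C ≤ D := le_max_left _ _
    have h2 : 2 * τ ≤ σ := by rw [hτ]; linarith [min_le_left σ σ']
    gcongr
  have e2 : ‖coeff f k‖ ≤ D * Real.exp (-(2 * τ) * |(k.2 : ℝ)|) := by
    rw [e, ← coeff_comp_swap]
    refine (h' k.swap).trans ?_
    have h1 : C' ≤ D := le_max_right _ _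
    have h2 : 2 * τ ≤ σ' := by rw [hτ]; linarith [min_le_right σ σ']
    simp only [Prod.fst_swap]
    gcongr
  rw [mul_assoc, ← Real.exp_add]
  rcases le_total |(k.1 : ℝ)| |(k.2 : ℝ)| with hk | hk
  · refine e2.trans ?_
    gcongr
    unfold absWeight
    nlinarith
  · refine e1.trans ?_
    gcongr
    unfold absWeight
    nlinarith

/-! ### Propagation of analyticity and the exponential rate -/

theorem summable_absWeight_pow_mul_exp {σ : ℝ} (hσ : 0 < σ) (n : ℕ) :
    Summable fun k : ℤ × ℤ => absWeight k ^ n * Real.exp (-σ * absWeight k) := by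
  have hJ : ∀ k : ℤ × ℤ, 0 < absWeight k := fun k => zero_lt_one.trans_le (one_le_absWeight k)
  refine (summable_absWeight_inv.mul_left (((n + 4).factorial : ℝ) / σ ^ (n + 4))).of_nonneg_of_le
    (fun k => by have := hJ k; positivity) fun k => ?_
  have h := Real.pow_div_factorial_le_exp (σ * absWeight k) (mul_pos hσ (hJ k)).le (n + 4)
  have hf : (0 : ℝ) < (n + 4).factorial := by exact_mod_cast Nat.factorial_pos _
  have hj := hJ k
  rw [div_le_iff₀ hf] at h
  rw [neg_mul, Real.exp_neg, ← div_eq_mul_inv, div_le_iff₀ (Real.exp_pos _), inv_pow, ← pow_mul,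
    div_mul_eq_mul_div, div_mul_eq_mul_div, le_div_iff₀ (by positivity), mul_assoc, mul_comm _⁻¹,
    ← mul_assoc, ← div_eq_mul_inv, le_div_iff₀ (by positivity)]
  calc absWeight k ^ n * σ ^ (n + 4) * absWeight k ^ (2 * 2) = (σ * absWeight k) ^ (n + 4) := by ring
    _ ≤ _ := by rw [mul_comm (_ : ℝ) (Real.exp _)]; exact h

theorem lt_absWeight_of_notMem_box {N : ℕ} {k : ℤ × ℤ} (hk : k ∉ box N) : (N : ℝ) < absWeight k := by
  rw [mem_box, not_le, lt_max_iff] at hk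
  unfold absWeight
  rcases hk with h | h
  · have : (N : ℝ) < |(k.1 : ℝ)| := by exact_mod_cast h
    linarith [abs_nonneg (k.2 : ℝ)]
  · have : (N : ℝ) < |(k.2 : ℝ)| := by exact_mod_cast h
    linarith [abs_nonneg (k.1 : ℝ)]

theorem absWeight_le_of_mem_box {N : ℕ} (hN : 1 ≤ N) {k : ℤ × ℤ} (hk : k ∈ box N) :
    absWeight k ≤ 3 * N := by
  rw [mem_box, max_le_iff] at hk
  have h1 : |(k.1 : ℝ)| ≤ N := by exact_mod_cast hk.1
  have h2 : |(k.2 : ℝ)| ≤ N := by exact_mod_cast hk.2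
  have h3 : (1 : ℝ) ≤ N := by exact_mod_cast hN
  unfold absWeight
  linarith

/-- Decay of the tail of an exponentially decaying sequence. -/
theorem tail_le_of_exp_decay {c : ℤ × ℤ → ℂ} {m : ℤ × ℤ → ℝ} {C σ : ℝ} (hσ : 0 < σ)
    (hm : ∀ k, 0 ≤ m k) (hm' : ∀ k, m k ≤ absWeight k)
    (hc : ∀ k, ‖c k‖ ≤ C * Real.exp (-σ * absWeight k)) (N : ℕ) :
    (Summable fun k => (m k * ‖c k - trunc N c k‖) ^ 2) ∧
      ∑' k, (m k * ‖c k - trunc N c k‖) ^ 2 ≤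
        (C * Real.sqrt (∑' k, absWeight k ^ 2 * Real.exp (-σ * absWeight k)) *
          Real.exp (-(σ / 2) * N)) ^ 2 := by
  -- Of the squared decay `e^{-2σ|k|}`, one factor `e^{-σ|k|}` gives `e^{-σN}` outside the box and
  -- the other keeps the sum finite; hence the rate `σ/2`.
  have key : ∀ k, (m k * ‖c k - trunc N c k‖) ^ 2 ≤ C ^ 2 * Real.exp (-σ * N) *
      (absWeight k ^ 2 * Real.exp (-σ * absWeight k)) := by
    intro k
    by_cases hk : k ∈ box N
    · simp only [trunc, hk, if_true, sub_self, norm_zero, mul_zero, zero_pow two_ne_zero]; positivity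
    · rw [trunc_of_notMem c hk, sub_zero]
      have h1 : m k * ‖c k‖ ≤ absWeight k * (C * Real.exp (-σ * absWeight k)) :=
        mul_le_mul (hm' k) (hc k) (norm_nonneg _) ((hm k).trans (hm' k))
      have h2 := pow_le_pow_left₀ (mul_nonneg (hm k) (norm_nonneg _)) h1 2
      have h3 : Real.exp (-σ * absWeight k) ≤ Real.exp (-σ * N) := by
        have := (lt_absWeight_of_notMem_box hk).le
        apply Real.exp_le_exp.2
        nlinarith
      calc _ ≤ _ := h2
        _ = C ^ 2 * Real.exp (-σ * absWeight k) *
            (absWeight k ^ 2 * Real.exp (-σ * absWeight k)) := by ring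
        _ ≤ _ := by gcongr
  have hs := summable_absWeight_pow_mul_exp hσ 2
  have hs1 := hs.mul_left (C ^ 2 * Real.exp (-σ * N))
  have hs2 := hs1.of_nonneg_of_le (fun _ => sq_nonneg _) key
  refine ⟨hs2, (Summable.tsum_le_tsum key hs2 hs1).trans (le_of_eq ?_)⟩
  rw [tsum_mul_left, mul_pow, mul_pow, Real.sq_sqrt (tsum_nonneg fun k => by positivity),
    ← Real.exp_nat_mul]
  have : ((2 : ℕ) : ℝ) * (-(σ / 2) * N) = -σ * N := by push_cast; ring
  rw [this]
  ring

/-- The modes with `k₁ = 0` are conserved. -/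
theorem CoeffSolution.conserved {α T : ℝ} {c : ℝ → ℤ × ℤ → ℂ} (hc : CoeffSolution α T c)
    {k : ℤ × ℤ} (hk : k.1 = 0) {t : ℝ} (ht : t ∈ Icc 0 T) : c t k = c 0 k := by
  have h := exp_growth_bound (y := fun s => ‖c s k - c 0 k‖ ^ 2) (y' := fun _ => 0) (A := 0) (T := T)
    ((((hc.continuousOn k).sub continuousOn_const).norm).pow 2)
    (fun s hs => by
      have h1 := hc.hasDerivAt s hs k
      have h2 : rhs α (c s) k = 0 := by simp [rhs, hk]
      rw [h2] at h1
      have h3 := hasDerivWithinAt_norm_sq (h1.sub_const (c 0 k)).hasDerivWithinAt (s := univ)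
      simpa [hasDerivWithinAt_univ] using h3)
    (fun s _ => by simp) t ht
  simp only [sub_self, norm_zero, zero_pow two_ne_zero, zero_mul] at h
  have h1 : ‖c t k - c 0 k‖ = 0 := pow_eq_zero_iff two_ne_zero |>.1 (le_antisymm h (sq_nonneg _))
  exact sub_eq_zero.1 (norm_eq_zero.1 h1)

/-- Dispersive smoothing in the Wiener algebra. -/
theorem SobolevBound.sum_absWeight_le {α r M : ℝ} {c : ℤ × ℤ → ℂ} (h : SobolevBound α r M c)
    (hα : 1 ≤ α) (hr : 2 ≤ r) (hM : 0 ≤ M) {d : ℤ × ℤ → ℝ} (hd : ∀ k, 0 ≤ d k) (hds : Summable d)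
    (hcd : ∀ k : ℤ × ℤ, k.1 = 0 → absWeight k * ‖c k‖ ≤ d k) (s : Finset (ℤ × ℤ)) :
    ∑ k ∈ s, absWeight k * ‖c k‖ ≤
      3 * (wienerConst * M + (wienerConst * M) ^ 2 / 2) + ∑' k, d k := by
  obtain ⟨s1, l1⟩ := h.smoothing_wiener hr hM
  -- Off the line `k₁ = 0` each of the three summands of `absWeight` is at most `|k|^α`, so
  -- smoothing applies; on the line the majorant `d` takes over.
  have key : ∀ k, absWeight k * ‖c k‖ ≤ 3 * (‖rhs α c k‖ + ‖conv c c k‖ / 2) + d k := by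
    intro k
    by_cases hk : k.1 = 0
    · have : 0 ≤ 3 * (‖rhs α c k‖ + ‖conv c c k‖ / 2) := by positivity
      linarith [hcd k hk]
    · have h1 := smoothing_le α c hk
      obtain ⟨h2, h3, h4⟩ := abs_fst_le_rpow hα hk
      have h5 : absWeight k * ‖c k‖ ≤ 3 * Real.sqrt (normSq k) ^ α * ‖c k‖ := by
        refine mul_le_mul_of_nonneg_right ?_ (norm_nonneg _)
        unfold absWeight
        linarith
      linarith [hd k]
  have s2 := (s1.mul_left 3).add hds
  calc ∑ k ∈ s, absWeight k * ‖c k‖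
      ≤ ∑ k ∈ s, (3 * (‖rhs α c k‖ + ‖conv c c k‖ / 2) + d k) := Finset.sum_le_sum fun k _ => key k
    _ ≤ ∑' k, (3 * (‖rhs α c k‖ + ‖conv c c k‖ / 2) + d k) :=
        s2.sum_le_tsum s fun k _ => add_nonneg (by positivity) (hd k)
    _ ≤ _ := by
        rw [(s1.mul_left 3).tsum_add hds, tsum_mul_left]
        linarith

/-- An inverse inequality: at most `(3N)²` frequencies, each of weight at most `3N`, cost `9N²` by
Cauchy–Schwarz, and `r ≥ 2` absorbs `N²`. -/
theorem sum_box_absWeight_le {N : ℕ} (hN : 1 ≤ N) {e : ℤ × ℤ → ℝ} (he : ∀ k, 0 ≤ e k) {C r : ℝ}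
    (hC : 0 ≤ C) (hr : 2 ≤ r) (h : ∑ k ∈ box N, e k ^ 2 ≤ (C * (N : ℝ) ^ (-r)) ^ 2) :
    ∑ k ∈ box N, absWeight k * e k ≤ 9 * C := by
  have hN1 : (1 : ℝ) ≤ N := by exact_mod_cast hN
  have hN0 : (0 : ℝ) < N := by linarith
  have hJ0 : ∀ k, 0 ≤ absWeight k := fun k => zero_le_one.trans (one_le_absWeight k)
  have hcard : ((box N).card : ℝ) ≤ (3 * N) ^ 2 := by
    have e1 : (box N).card = (2 * N + 1) ^ 2 := by
      rw [box, Finset.card_product, Int.card_Icc, sq]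
      congr 1 <;> omega
    rw [e1]
    push_cast
    gcongr
    linarith
  have hJ : ∑ k ∈ box N, absWeight k ^ 2 ≤ ((3 * N : ℝ) ^ 2) ^ 2 := by
    calc ∑ k ∈ box N, absWeight k ^ 2 ≤ ∑ k ∈ box N, (3 * N : ℝ) ^ 2 :=
          Finset.sum_le_sum fun k hk => pow_le_pow_left₀ (hJ0 k) (absWeight_le_of_mem_box hN hk) 2
      _ = (box N).card * (3 * N : ℝ) ^ 2 := by rw [Finset.sum_const, nsmul_eq_mul]
      _ ≤ (3 * N : ℝ) ^ 2 * (3 * N : ℝ) ^ 2 := by gcongr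
      _ = _ := by ring
  have hcs := Finset.sum_mul_sq_le_sq_mul_sq (box N) absWeight e
  have hpow : (N : ℝ) ^ 2 * (N : ℝ) ^ (-r) ≤ 1 := by
    rw [← Real.rpow_natCast, ← Real.rpow_add hN0]
    refine Real.rpow_le_one_of_one_le_of_nonpos hN1 ?_
    push_cast
    linarith
  have hNr : 0 ≤ (N : ℝ) ^ (-r) := Real.rpow_nonneg hN0.le _
  refine (sq_le_sq₀ (Finset.sum_nonneg fun k _ => mul_nonneg (hJ0 k) (he k)) (by positivity)).1 ?_
  calc (∑ k ∈ box N, absWeight k * e k) ^ 2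
      ≤ ((3 * N : ℝ) ^ 2) ^ 2 * (C * (N : ℝ) ^ (-r)) ^ 2 :=
        hcs.trans (mul_le_mul hJ h (Finset.sum_nonneg fun _ _ => sq_nonneg _) (by positivity))
    _ = (9 * C) ^ 2 * ((N : ℝ) ^ 2 * (N : ℝ) ^ (-r)) ^ 2 := by ring
    _ ≤ (9 * C) ^ 2 * 1 ^ 2 := by gcongr
    _ = _ := by ring

/-- A solution with analytic initial datum stays analytic as long as it is smooth. -/
theorem CoeffSolution.exp_decay {α r T M : ℝ} (hα : 1 ≤ α) (hr : 2 ≤ r) (hM : 0 ≤ M) (hT : 0 < T)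
    {c : ℝ → ℤ × ℤ → ℂ} (hc : CoeffSolution α T c)
    (hbd : ∀ t ∈ Ioo 0 T, SobolevBound α r M (c t)) {C₀ σ : ℝ} (hC₀ : 0 < C₀) (hσ : 0 < σ)
    (h0 : ∀ k, ‖c 0 k‖ ≤ C₀ * Real.exp (-σ * absWeight k)) :
    ∃ C σ₁ : ℝ, 0 < C ∧ 0 < σ₁ ∧ ∀ t ∈ Icc 0 T, ∀ k, ‖c t k‖ ≤ C * Real.exp (-σ₁ * absWeight k) := by
  have hJ0 : ∀ k, 0 ≤ absWeight k := fun k => zero_le_one.trans (one_le_absWeight k)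
  obtain ⟨CA, hCA, halg⟩ := CoeffSolution.algebraic_rate (α := α) (r := r) (T := T) hα hr hM
  set d : ℤ × ℤ → ℝ := fun k => C₀ * (absWeight k ^ 1 * Real.exp (-σ * absWeight k)) with hd
  have hds : Summable d := (summable_absWeight_pow_mul_exp hσ 1).mul_left C₀
  have hd0 : ∀ k, 0 ≤ d k := fun k => by have := hJ0 k; simp only [hd]; positivity
  have hcd : ∀ k, absWeight k * ‖c 0 k‖ ≤ d k := fun k => by
    refine (mul_le_mul_of_nonneg_left (h0 k) (hJ0 k)).trans (le_of_eq ?_)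
    simp only [hd]; ring
  set W := 3 * (wienerConst * M + (wienerConst * M) ^ 2 / 2) with hW
  have hW0 : 0 ≤ W := by have := wienerConst_nonneg; positivity
  -- A bound for the weighted Wiener norm of every Galerkin solution: smoothing (`W`) and the
  -- conserved modes (`d`) control `c`, and `9 * CA` controls `c - b`.
  set L := W + ∑' k, d k + 9 * CA with hL
  have hcw : ∀ t ∈ Ico 0 T, ∀ s : Finset (ℤ × ℤ),
      ∑ k ∈ s, absWeight k * ‖c t k‖ ≤ W + ∑' k, d k := by
    intro t ht s
    rcases ht.1.eq_or_lt with h | h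
    · subst h
      have h1 := (Finset.sum_le_sum fun k _ => hcd k).trans (hds.sum_le_tsum s fun k _ => hd0 k)
      linarith
    · exact (hbd t ⟨h, ht.2⟩).sum_absWeight_le hα hr hM hd0 hds (fun k hk => by
        rw [hc.conserved hk (Ico_subset_Icc_self ht)]; exact hcd k) s
  set E₀ := C₀ ^ 2 * ∑' k, absWeight k ^ 8 * Real.exp (-σ * absWeight k) + 1 with hE
  have hE₀ : 0 < E₀ := by
    have : 0 ≤ ∑' k, absWeight k ^ 8 * Real.exp (-σ * absWeight k) :=
      tsum_nonneg fun k => mul_nonneg (pow_nonneg (hJ0 k) _) (Real.exp_pos _).le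
    positivity
  have hgev : ∀ s : Finset (ℤ × ℤ),
      ∑ k ∈ s, (gevrey (σ / 2) (absWeight k) * ‖c 0 k‖) ^ 2 ≤ E₀ := by
    intro s
    have h1 : ∀ k, (gevrey (σ / 2) (absWeight k) * ‖c 0 k‖) ^ 2 ≤
        C₀ ^ 2 * (absWeight k ^ 8 * Real.exp (-σ * absWeight k)) := by
      intro k
      have h2 := pow_le_pow_left₀ (mul_nonneg (gevrey_nonneg _ _) (norm_nonneg _))
        (mul_le_mul_of_nonneg_left (h0 k) (gevrey_nonneg (σ / 2) (absWeight k))) 2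
      refine h2.trans (le_of_eq ?_)
      have e1 : Real.exp (-σ * absWeight k) =
          (Real.exp (σ / 2 * absWeight k) * Real.exp (-σ * absWeight k)) ^ 2 := by
        rw [← Real.exp_add, ← Real.exp_nat_mul]
        congr 1
        push_cast
        ring
      conv_rhs => rw [e1]
      unfold gevrey
      ring
    have h2 := (summable_absWeight_pow_mul_exp hσ 8).mul_left (C₀ ^ 2)
    have h3 := (Finset.sum_le_sum fun k (_ : k ∈ s) => h1 k).trans
      (h2.sum_le_tsum s fun k _ => by have := hJ0 k; positivity)
    rw [tsum_mul_left] at h3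
    linarith
  obtain ⟨σ₁, C₁, hσ₁, hC₁, hG⟩ := gevrey_bound α (T := T) (σ₀ := σ / 2) (L := L) (E₀ := E₀)
    (by positivity) (by have : 0 ≤ ∑' k, d k := tsum_nonneg hd0; positivity) hE₀
  refine ⟨C₁, σ₁, hC₁, hσ₁, fun t ht k => ?_⟩
  -- The Galerkin solution of degree `N` decays uniformly in `N` and differs from `c` by
  -- `O(N^{-r})`; at fixed `k` the limit `N → ∞` removes the error.
  have happ : ∀ N : ℕ, 1 ≤ N → k ∈ box N →
      ‖c t k‖ ≤ C₁ * Real.exp (-σ₁ * absWeight k) + CA * (N : ℝ) ^ (-r) := by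
    intro N hN hk
    have hh0 := hc.hermitian 0 ⟨le_rfl, hT.le⟩
    obtain ⟨b, hb⟩ := exists_coeffGalerkin α hT N hh0
    have hA := halg c hc hbd N b hN hb
    have h1 := hG N (c 0) b hb (hb.hermitian hh0) (fun s hs => by
      have hs' := Ico_subset_Icc_self hs
      rw [tsum_eq_sum (s := box N) fun k hk => by simp [hb.support s hs' k hk]]
      have h2 := sum_box_absWeight_le hN (fun k => norm_nonneg (c s k - b s k)) hCA.le hr (hA s hs')
      have h3 := hcw s hs (box N)
      calc ∑ k ∈ box N, absWeight k * ‖b s k‖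
          ≤ ∑ k ∈ box N, (absWeight k * ‖c s k‖ + absWeight k * ‖c s k - b s k‖) :=
            Finset.sum_le_sum fun k _ => by
              rw [← mul_add]
              refine mul_le_mul_of_nonneg_left ?_ (hJ0 k)
              have := norm_sub_norm_le (b s k) (c s k)
              rw [norm_sub_rev] at this
              linarith
        _ ≤ L := by rw [Finset.sum_add_distrib]; linarith)
      (le_trans (le_of_eq (Finset.sum_congr rfl fun k hk => by rw [hb.initial k hk])) (hgev (box N)))
      t ht k hk
    have hNr : 0 ≤ (N : ℝ) ^ (-r) := Real.rpow_nonneg (Nat.cast_nonneg _) _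
    have h4 : ‖c t k - b t k‖ ≤ CA * (N : ℝ) ^ (-r) := by
      refine (sq_le_sq₀ (norm_nonneg _) (by positivity)).1 (le_trans ?_ (hA t ht))
      exact Finset.single_le_sum (f := fun k => ‖c t k - b t k‖ ^ 2) (fun _ _ => sq_nonneg _) hk
    have := norm_sub_norm_le (c t k) (b t k)
    linarith
  have hlim : Filter.Tendsto (fun N : ℕ => C₁ * Real.exp (-σ₁ * absWeight k) + CA * (N : ℝ) ^ (-r))
      Filter.atTop (nhds (C₁ * Real.exp (-σ₁ * absWeight k) + CA * 0)) :=
    (((tendsto_rpow_neg_atTop (by linarith : 0 < r)).comp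
      tendsto_natCast_atTop_atTop).const_mul CA).const_add _
  rw [mul_zero, add_zero] at hlim
  refine ge_of_tendsto hlim ?_
  filter_upwards [Filter.eventually_ge_atTop (max 1 (max |k.1| |k.2|).toNat)] with N hN
  refine happ N ((le_max_left _ _).trans hN) ?_
  rw [mem_box]
  exact Int.toNat_le.1 ((le_max_right _ _).trans hN)

/-- Since the coefficients of `u` decay exponentially throughout `[0, T]`, the tails of `u` and
`∂₁u` are both `O(e^{-σN/2})`, and the energy estimate of the algebraic case applies with this `ε`.
The bound `M` comes from compactness of `[0, T]`. -/
theorem exponential_convergence {α r T : ℝ} (hα : 1 ≤ α) (hr : 2 ≤ r) (hT : 0 < T) {u₀ : L2per}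
    {u : ℝ → L2per} {U : ℝ → lp (fun _ : ℤ × ℤ => ℂ) 2} (hu : IsSolution α T u₀ u)
    (hU : IsC1Hper r T u U) (han : IsRealAnalytic u₀) :
    ∃ C σ : ℝ, 0 < C ∧ 0 < σ ∧
      ∀ (N : ℕ) (uN : ℝ → L2per), 1 ≤ N → IsGalerkin α T N u₀ uN →
        ∀ t ∈ Ico 0 T, ‖u t - uN t‖ ≤ C * Real.exp (-σ * N) := by
  obtain ⟨M₁, hM₁⟩ := isCompact_Icc.exists_bound_of_continuousOn hU.1.continuousOn
  obtain ⟨M₂, hM₂⟩ := isCompact_Icc.exists_bound_of_continuousOn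
    (hU.1.continuousOn_derivWithin (uniqueDiffOn_Icc hT) le_rfl)
  set M := max M₁ M₂
  have hM : 0 ≤ M := (norm_nonneg _).trans ((hM₁ 0 ⟨le_rfl, hT.le⟩).trans (le_max_left _ _))
  have hc := hu.coeffSolution hα hU
  have hbd : ∀ t ∈ Ioo 0 T, SobolevBound α r M (coeff (u t)) := fun t ht =>
    hU.sobolevBound hc ht ((hM₁ t (Ioo_subset_Icc_self ht)).trans (le_max_left _ _))
      ((hM₂ t (Ioo_subset_Icc_self ht)).trans (le_max_right _ _))
  obtain ⟨C₀, σ₀, hC₀, hσ₀, h0⟩ := han.exists_exp_decay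
  rw [← hu.initial] at h0
  obtain ⟨C₁, σ, hC₁, hσ, hdec⟩ := hc.exp_decay hα hr hM hT hbd hC₀ hσ₀ h0
  set D := C₁ * Real.sqrt (∑' k, absWeight k ^ 2 * Real.exp (-σ * absWeight k)) with hD
  have hD0 : 0 ≤ D := by positivity
  set A := wienerConst * M + 2 * (wienerConst * M + (wienerConst * M) ^ 2 / 2) with hA
  have hA0 : 0 ≤ A := by have := wienerConst_nonneg; positivity
  refine ⟨2 * Real.pi * (D * Real.exp (A * T) + D) + 1, σ / 2,
    by have := Real.pi_pos; positivity, by positivity, ?_⟩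
  intro N uN hN huN t ht
  have ht' := Ico_subset_Icc_self ht
  have hb := huN.coeffGalerkin
  rw [← hu.initial] at hb
  have htail : ∀ s ∈ Icc 0 T, (Summable fun k => ‖coeff (u s) k - trunc N (coeff (u s)) k‖ ^ 2) ∧
      ∑' k, ‖coeff (u s) k - trunc N (coeff (u s)) k‖ ^ 2 ≤
        (D * Real.exp (-(σ / 2) * N)) ^ 2 := fun s hs => by
    have := tail_le_of_exp_decay (m := 1) hσ (fun _ => zero_le_one) one_le_absWeight (hdec s hs) N
    simpa only [Pi.one_apply, one_mul] using this
  have key := hc.error_le (L0 := wienerConst * M)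
    (L1 := wienerConst * M + (wienerConst * M) ^ 2 / 2) (ε := D * Real.exp (-(σ / 2) * N))
    (by positivity) hb (hb.hermitian (hc.hermitian 0 ⟨le_rfl, hT.le⟩))
    (fun s hs => wiener_le_sobolev hr hM (hbd s hs).summable (hbd s hs).le)
    (fun s hs => (hbd s hs).wiener_fst hα hr hM)
    (fun s hs => htail s (Ioo_subset_Icc_self hs))
    (fun s hs => tail_le_of_exp_decay (m := fun k : ℤ × ℤ => |(k.1 : ℝ)|) hσ
      (fun _ => abs_nonneg _) (fun k => by unfold absWeight; linarith [abs_nonneg (k.2 : ℝ)])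
      (hdec s (Ioo_subset_Icc_self hs)) N) t ht'
  have key' : ∑ k ∈ box N, ‖coeff (u t) k - coeff (uN t) k‖ ^ 2 ≤
      (D * Real.exp (-(σ / 2) * N) * Real.exp (A * T)) ^ 2 := by
    refine key.trans ?_
    rw [← hA, mul_pow _ (Real.exp (A * T))]
    gcongr
    rw [← Real.exp_nat_mul]
    apply Real.exp_le_exp.2
    push_cast
    nlinarith [mul_le_mul_of_nonneg_left ht'.2 hA0, mul_nonneg hA0 hT.le]
  refine (norm_sub_le_of_coeff (hb.support t ht') (by positivity) (by positivity) key'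
    (htail t ht').2).trans ?_
  have := Real.exp_pos (-(σ / 2) * N)
  nlinarith

end FZK

end

theorem theorem4p3 (α r T : ℝ) (hα : α ∈ Set.Icc (1 : ℝ) 2) (hr : α + 1 ≤ r) (hT : 0 < T) :
    (∀ M : ℝ, ∃ C : ℝ, 0 < C ∧
      ∀ (u₀ : FZK.L2per) (u : ℝ → FZK.L2per) (U : ℝ → lp (fun _ : ℤ × ℤ => ℂ) 2),
        FZK.IsSolution α T u₀ u → FZK.IsC1Hper r T u U →
        (∀ t ∈ Set.Icc 0 T, ‖U t‖ ≤ M ∧ ‖derivWithin U (Set.Icc 0 T) t‖ ≤ M) →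
        ∀ (N : ℕ) (uN : ℝ → FZK.L2per), 1 ≤ N → FZK.IsGalerkin α T N u₀ uN →
          ∀ t ∈ Set.Ico 0 T, ‖u t - uN t‖ ≤ C * (N : ℝ) ^ (-r)) ∧
    (∀ (u₀ : FZK.L2per) (u : ℝ → FZK.L2per) (U : ℝ → lp (fun _ : ℤ × ℤ => ℂ) 2),
      FZK.IsSolution α T u₀ u → FZK.IsC1Hper r T u U → FZK.IsRealAnalytic u₀ →
      ∃ C σ : ℝ, 0 < C ∧ 0 < σ ∧
        ∀ (N : ℕ) (uN : ℝ → FZK.L2per), 1 ≤ N → FZK.IsGalerkin α T N u₀ uN →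
          ∀ t ∈ Set.Ico 0 T, ‖u t - uN t‖ ≤ C * Real.exp (-σ * N)) := by
  have hr' : 2 ≤ r := by linarith [hα.1]
  exact ⟨FZK.algebraic_convergence α r T hα.1 hr', fun _ _ _ hu hU han =>
    FZK.exponential_convergence hα.1 hr' hT hu hU han⟩
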